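/- Let $d\ge 2$. For a compactly supported Radon measure $\mu$ on $\mathbb{R}^d$ and $s>0$ write $$I_s(\mu)=\iint \frac{d\mu(x)\,d\mu(y)}{|x-y|^{s}}\in[0,\infty],$$ where $|x-y|^{-s}=\infty$ when $x=y$. For $x\in\mathbb{R}^d$ let $\pi_x(y)=\frac{y-x}{|y-x|}\in S^{d-1}$ $(y\ne x)$ be the radial projection with centre $x$, and let $$\mathcal S(\mu)=\{x\in\mathbb{R}^d\setminus\operatorname{spt}\mu:\ \pi_{x\sharp}\mu \text{ is not absolutely continuous with respect to } \mathcal H^{d-1}|_{S^{d-1}}\}.$$ (a) If $\mu$ is a compactly supported Radon measure on $\mathbb{R}^d$ with $I_s(\mu)<\infty$ for some $s>d-1$, then $\dim_{\mathrm H}\mathcal S(\mu)\le \max\{2(d-1)-s,\,0\}$, where $\dim_{\mathrm H}\emptyset=0$. (The maximum is $2(d-1)-s$ whenever $d-1<s<d$; for $s\ge d$ the hypothesis forces $\mu=0$ and $\mathcal S(\mu)=\emptyset$.) (b) The bound is sharp: for every $s\in(d-1,d)$ and every real $t<2(d-1)-s$ there is a compactly supported Radon measure $\mu$ on $\mathbb{R}^d$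 with $I_s(\mu)<\infty$ and $\dim_{\mathrm H}\mathcal S(\mu)>\max\{t,0\}$. -/

import Mathlib

open MeasureTheory
open scoped ENNReal

/-- Compactly supported Radon measures on `ℝ^d`. -/
structure IsCompactlySupportedRadon {d : ℕ} (μ : Measure (EuclideanSpace ℝ (Fin d))) : Prop where
  regular : μ.Regular
  isCompact_support : IsCompact μ.support

/-- The `s`-energy `I_s(μ) = ∬ |x - y|^{-s} dμ(x) dμ(y)`, with values in `[0, ∞]`.
For `s > 0` the kernel is `∞` on the diagonal. -/
noncomputable def energy {d : ℕ} (s : ℝ) (μ : Measure (EuclideanSpace ℝ (Fin d))) : ℝ≥0∞ :=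
  ∫⁻ x, ∫⁻ y, (edist x y) ^ (-s) ∂μ ∂μ

/-- The radial projection `π_x(y) = (y - x) / |y - x|`, viewed as a map into `ℝ^d`.
For `y ≠ x` its value lies on the unit sphere; the value `0` at `y = x` is irrelevant
for measures whose support does not contain `x`. -/
noncomputable def radialProj {d : ℕ} (x y : EuclideanSpace ℝ (Fin d)) :
    EuclideanSpace ℝ (Fin d) :=
  ‖y - x‖⁻¹ • (y - x)

/-- The restriction of the `(d-1)`-dimensional Hausdorff measure to the unit sphere `S^{d-1}`. -/
noncomputable def sphereMeasure (d : ℕ) : Measure (EuclideanSpace ℝ (Fin d)) :=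
  (Measure.hausdorffMeasure ((d : ℝ) - 1)).restrict (Metric.sphere 0 1)

/-- The exceptional set `S(μ)`: all `x` outside the support of `μ` such that the push-forward of
`μ` under `π_x` is not absolutely continuous with respect to surface measure on `S^{d-1}`. -/
def exceptionalSet {d : ℕ} (μ : Measure (EuclideanSpace ℝ (Fin d))) :
    Set (EuclideanSpace ℝ (Fin d)) :=
  {x | x ∉ μ.support ∧ ¬ (μ.map (radialProj x)).AbsolutelyContinuous (sphereMeasure d)}

/-- The radial projection is Borel measurable, so that its push-forward is the genuine one. -/
theorem measurable_radialProj {d : ℕ} (x : EuclideanSpace ℝ (Fin d)) :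
    Measurable (radialProj x) := by
  unfold radialProj
  fun_prop

/-! Upper bound. Write n = d - 1 and pass to n-dimensional slopes a, one chart for each choice of
distinguished coordinate. Smoothing the projection of μ along the direction (1, a) at scale 2^{-k}
and evaluating at the image of x gives `coneDensity μ k x a`, an approximate density at a of the
radial projection from x. If the weighted L¹ distances `coneOscillation μ k x` between consecutive
scales are summable in k, the densities have an integrable majorant. Fatou's lemma and outer
regularity then show that μ gives no mass to the lines through x with slopes in a Lebesgue null set
(`measure_slopeOf_mem_eq_zero`). So x can be exceptional only if the series diverges in some chart.

The divergence set is measured by duality. Let ν be a t-Frostman measure down to scale δ = 2^{-k},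
living where the oscillation is at least τ. The difference of two consecutive autocorrelation
kernels factors as the correlation of a sum of bumps with a difference of bumps
(`corr_self_sub_corr_self`). Hence the ν-integral of the oscillation is controlled by two quadratic
forms: one for μ with the mean-zero difference kernel, one for ν with the positive sum kernel.
Averaging over slopes, the first is O(δ^{s-n}) by finite energy, cancellation allowing every s ≤ n +
1 (`integral_projAvg_bump_sub_le`). The second is O((k+1) δ^{t-n}) times the mass of ν
(`integral_projAvg_bump_add_le`). Thus ν has mass O((k+1) δ^{s+t-2n} τ^{-2}). For t > 2n - s and τ a
small power of δ this is summable in k, and a finite-scale Frostman lemma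
(`exists_discrete_frostman_measure`) turns it into summable coverings, so the divergence set is
`μH[t]`-null.

Sharpness. Take random numbers whose binary digits vanish on long blocks: y is near 2^{-p}ℤ, x near
2^{-r}ℤ and z near 2^{-(p+r)}ℤ, all to precision 2^{-l} with l = p + r + j at stage j. Then z - x(1
+ y) is within O(2^{-l}) of 2^{-(p+r)}ℤ at every stage, which confines it to a null set. A
projective change of coordinates makes z - x(1 + y) the slope of the line from a point with one
coordinate 0 and another equal to x to a point determined by (y, z). With free remaining
coordinates, the measure has Frostman exponent slightly above s, while the exceptional points carry
a measure of exponent close to 2(d-1) - s, or close to d-2 if that is larger than the requested t.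
-/

/-! ### Discrete Frostman measures and coverings of limsup sets. -/

open Classical in
/-- Greedy weights: a maximal nonnegative weight on a finite set subject to finitely many upper
bounds makes one of the bounds tight at every point. -/
theorem exists_saturated_weights {X κ : Type*} (C : Finset κ) (B : κ → Set X) (r : κ → ℝ)
    (hr : ∀ c ∈ C, 0 ≤ r c) (F : Finset X) (hF : ∀ x ∈ F, ∃ c ∈ C, x ∈ B c) :
    ∃ W : X → ℝ, (∀ x, 0 ≤ W x) ∧ (∀ c ∈ C, ∑ x ∈ F with x ∈ B c, W x ≤ r c) ∧
      ∀ x ∈ F, ∃ c ∈ C, x ∈ B c ∧ ∑ x ∈ F with x ∈ B c, W x = r c := by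
  induction F using Finset.induction_on with
  | empty => exact ⟨0, by simp, by simpa using hr, by simp⟩
  | insert a F ha ih =>
    obtain ⟨W, hW0, hWle, hWeq⟩ := ih fun x hx => hF x (Finset.mem_insert_of_mem hx)
    obtain ⟨c₀, hc₀, hac₀⟩ := hF a (Finset.mem_insert_self a F)
    obtain ⟨c₁, hc₁, hmin⟩ := (C.filter fun c => a ∈ B c).exists_min_image
      (fun c => r c - ∑ x ∈ F with x ∈ B c, W x) ⟨c₀, by simp [hc₀, hac₀]⟩
    rw [Finset.mem_filter] at hc₁
    -- The new point receives the smallest slack among the constraints that see it. This saturates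
    -- `c₁` and violates nothing.
    set m := r c₁ - ∑ x ∈ F with x ∈ B c₁, W x with hm
    have hupd : ∀ c, ∑ x ∈ F with x ∈ B c, Function.update W a m x
        = ∑ x ∈ F with x ∈ B c, W x := by
      intro c
      refine Finset.sum_congr rfl fun x hx => ?_
      rw [Function.update_of_ne]
      rintro rfl
      exact ha (Finset.mem_filter.1 hx).1
    have hin : ∀ c, a ∈ B c → ∑ x ∈ insert a F with x ∈ B c, Function.update W a m x
        = m + ∑ x ∈ F with x ∈ B c, W x := by
      intro c hc
      rw [Finset.filter_insert, if_pos hc, Finset.sum_insert (by simp [ha]), hupd]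
      simp
    have hout : ∀ c, a ∉ B c → ∑ x ∈ insert a F with x ∈ B c, Function.update W a m x
        = ∑ x ∈ F with x ∈ B c, W x := by
      intro c hc
      rw [Finset.filter_insert, if_neg hc, hupd]
    refine ⟨Function.update W a m, fun x => ?_, fun c hc => ?_, fun x hx => ?_⟩
    · by_cases hx : x = a
      · subst hx
        simpa [hm] using hWle c₁ hc₁.1
      · simpa [hx] using hW0 x
    · by_cases hac : a ∈ B c
      · have := hmin c (by simp [hc, hac])
        rw [hin c hac]
        linarith
      · rw [hout c hac]
        exact hWle c hc
    · rcases Finset.mem_insert.1 hx with rfl | hx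
      · exact ⟨c₁, hc₁.1, hc₁.2, by rw [hin c₁ hc₁.2]; linarith⟩
      · obtain ⟨c, hc, hxc, hceq⟩ := hWeq x hx
        refine ⟨c, hc, hxc, ?_⟩
        -- An already tight constraint containing `a` has zero slack, which forces `m = 0`, so it
        -- stays tight.
        by_cases hac : a ∈ B c
        · have h1 := hmin c (by simp [hc, hac])
          have h2 := hWle c₁ hc₁.1
          rw [hin c hac]
          linarith
        · rw [hout c hac, hceq]

open Classical in
/-- A discrete Frostman lemma at scales `1, 1/2, …, 2^{-k}`. -/
theorem exists_discrete_frostman_measure {X : Type*} [PseudoMetricSpace X] [MeasurableSpace X]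
    [BorelSpace X] [T1Space X] {S : Set X} (hS : TotallyBounded S) (t : ℝ) (k : ℕ) :
    ∃ (F : Finset X) (ν : Measure X) (u : Finset (X × ℕ)), IsFiniteMeasure ν ∧ (F : Set X) ⊆ S ∧
      ν (F : Set X)ᶜ = 0 ∧
      (∀ x ∈ F, ∀ j ≤ k,
        ν (Metric.closedBall x ((1 / 2 : ℝ) ^ j)) ≤ ENNReal.ofReal (((1 / 2 : ℝ) ^ j) ^ t)) ∧
      S ⊆ ⋃ p ∈ u, Metric.closedBall p.1 (6 * (1 / 2 : ℝ) ^ p.2) ∧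
      ∑ p ∈ u, ENNReal.ofReal (((1 / 2 : ℝ) ^ p.2) ^ t) ≤ ν Set.univ := by
  obtain ⟨F₀, hF₀S, hF₀fin, hF₀⟩ := Metric.finite_approx_of_totallyBounded hS ((1 / 2 : ℝ) ^ k)
    (by positivity)
  lift F₀ to Finset X using hF₀fin
  rename' F₀ => F
  set C : Finset (X × ℕ) := F ×ˢ Finset.range (k + 1) with hC
  set B : X × ℕ → Set X := fun p => Metric.closedBall p.1 ((1 / 2 : ℝ) ^ p.2) with hB
  obtain ⟨W, hW0, hWle, hWeq⟩ := exists_saturated_weights C B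
    (fun p => ((1 / 2 : ℝ) ^ p.2) ^ t) (fun c _ => by positivity) F
    (fun x hx => ⟨(x, 0), by simp [hC, hx], by simp [hB]⟩)
  set ν : Measure X := ∑ x ∈ F, ENNReal.ofReal (W x) • Measure.dirac x with hν
  have hνB : ∀ A : Set X, MeasurableSet A → ν A = ENNReal.ofReal (∑ x ∈ F with x ∈ A, W x) := by
    intro A hA
    rw [ENNReal.ofReal_sum_of_nonneg fun x _ => hW0 x, Finset.sum_filter, hν,
      Measure.finsetSum_apply]
    refine Finset.sum_congr rfl fun x _ => ?_
    by_cases hx : x ∈ A <;> simp [hx, Measure.dirac_apply' _ hA]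
  -- The tight balls cover the net. A disjoint Vitali subfamily still covers after enlargement, and
  -- its total content is exactly the mass it carries.
  set T : Set (X × ℕ) := {p | p ∈ C ∧ ∑ x ∈ F with x ∈ B p, W x = ((1 / 2 : ℝ) ^ p.2) ^ t}
  have hTfin : T.Finite := C.finite_toSet.subset fun p hp => hp.1
  obtain ⟨u, huT, hudisj, hucov⟩ := Vitali.exists_disjoint_subfamily_covering_enlargement_closedBall
    T (fun p => p.1) (fun p => (1 / 2 : ℝ) ^ p.2) 1
    (fun p _ => pow_le_one₀ (by norm_num) (by norm_num)) 5 (by norm_num)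
  lift u to Finset (X × ℕ) using hTfin.subset huT
  refine ⟨F, ν, u, ⟨?_⟩, hF₀S, ?_, ?_, ?_, ?_⟩
  · rw [hνB _ MeasurableSet.univ]; exact ENNReal.ofReal_lt_top
  · rw [hνB _ F.measurableSet.compl]
    refine ENNReal.ofReal_eq_zero.2 (Finset.sum_eq_zero fun x hx => ?_).le
    simp only [Finset.mem_filter] at hx
    exact absurd hx.1 hx.2
  · intro x hx j hj
    rw [hνB _ Metric.isClosed_closedBall.measurableSet]
    exact ENNReal.ofReal_le_ofReal (hWle (x, j) (by simp [hC, hx]; omega))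
  · intro y hy
    obtain ⟨x, hx, hyx⟩ := Set.mem_iUnion₂.1 (hF₀ hy)
    obtain ⟨c, hc, hxc, hceq⟩ := hWeq x hx
    obtain ⟨b, hb, hsub⟩ := hucov c ⟨hc, hceq⟩
    -- The factor 6 is the Vitali factor 5 plus the net error 2^{-k}, which is at most one further
    -- radius.
    refine Set.mem_iUnion₂.2 ⟨b, hb, ?_⟩
    have h1 : dist x b.1 ≤ 5 * (1 / 2 : ℝ) ^ b.2 := hsub hxc
    have h2 : dist y x < (1 / 2 : ℝ) ^ k := hyx
    have hbk : b.2 ≤ k := by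
      have := (huT hb).1
      simp only [hC, Finset.mem_product, Finset.mem_range] at this
      omega
    have h3 : (1 / 2 : ℝ) ^ k ≤ (1 / 2 : ℝ) ^ b.2 :=
      pow_le_pow_of_le_one (by norm_num) (by norm_num) hbk
    rw [Metric.mem_closedBall]
    linarith [dist_triangle y x b.1]
  · calc ∑ p ∈ u, ENNReal.ofReal (((1 / 2 : ℝ) ^ p.2) ^ t)
        = ∑ p ∈ u, ν (B p) := by
          refine Finset.sum_congr rfl fun p hp => ?_
          rw [hνB _ Metric.isClosed_closedBall.measurableSet, (huT hp).2]
      _ = ν (⋃ p ∈ u, B p) := by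
          rw [measure_biUnion_finset hudisj fun p _ => Metric.isClosed_closedBall.measurableSet]
      _ ≤ ν Set.univ := measure_mono (Set.subset_univ _)

/-- A limsup set covered by small balls with summable content is Hausdorff-null. -/
theorem hausdorffMeasure_limsup_eq_zero {X : Type*} [MetricSpace X] [MeasurableSpace X]
    [BorelSpace X] {t : ℝ} (ht : 0 < t) {S : Set X} {A : ℕ → Set X}
    (hSA : ∀ m, S ⊆ ⋃ k, A (k + m)) (u : ℕ → Finset (X × ℕ))
    (hcov : ∀ k, A k ⊆ ⋃ p ∈ u k, Metric.closedBall p.1 (6 * (1 / 2 : ℝ) ^ p.2))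
    (hsum : ∑' k, ∑ p ∈ u k, ENNReal.ofReal (((1 / 2 : ℝ) ^ p.2) ^ t) ≠ ∞) :
    μH[t] S = 0 := by
  set f : ℕ → ℝ≥0∞ := fun k => ∑ p ∈ u k, ENNReal.ofReal (((1 / 2 : ℝ) ^ p.2) ^ t) with hf
  have htail : Filter.Tendsto (fun m => ∑' k, f (k + m)) Filter.atTop (nhds 0) :=
    ENNReal.tendsto_sum_nat_add f hsum
  have hdiam : ∀ p : X × ℕ, Metric.ediam (Metric.closedBall p.1 (6 * (1 / 2 : ℝ) ^ p.2)) ^ t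
      ≤ ENNReal.ofReal (12 ^ t) * ENNReal.ofReal (((1 / 2 : ℝ) ^ p.2) ^ t) := by
    intro p
    have h1 : Metric.ediam (Metric.closedBall p.1 (6 * (1 / 2 : ℝ) ^ p.2))
        ≤ ENNReal.ofReal (12 * (1 / 2 : ℝ) ^ p.2) := by
      refine Metric.ediam_le_of_forall_dist_le fun x hx y hy => ?_
      rw [Metric.mem_closedBall] at hx hy
      linarith [dist_triangle_right x y p.1]
    calc _ ≤ ENNReal.ofReal (12 * (1 / 2 : ℝ) ^ p.2) ^ t := ENNReal.rpow_le_rpow h1 ht.le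
      _ = _ := by
        rw [ENNReal.ofReal_rpow_of_nonneg (by positivity) ht.le,
          Real.mul_rpow (by positivity) (by positivity), ENNReal.ofReal_mul (by positivity)]
  have hlim : Filter.Tendsto (fun m => ENNReal.ofReal (12 ^ t) * ∑' k, f (k + m)) Filter.atTop
      (nhds 0) := by
    simpa using ENNReal.Tendsto.const_mul htail (Or.inr ENNReal.ofReal_ne_top)
  have hr : Filter.Tendsto (fun m => (ENNReal.ofReal (12 ^ t) * ∑' k, f (k + m)) ^ t⁻¹)
      Filter.atTop (nhds 0) := by
    have := hlim.ennrpow_const t⁻¹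
    rwa [ENNReal.zero_rpow_of_pos (by positivity)] at this
  -- The radii in `u k` need not be related to `k`. The mesh is instead bounded by the 1/t-th power
  -- of the tail sum, which dominates the t-th power of each single diameter.
  have key := Measure.hausdorffMeasure_le_liminf_tsum (l := Filter.atTop)
    (ι := fun m : ℕ => Σ k : ℕ, u (k + m)) t S
    (fun m => (ENNReal.ofReal (12 ^ t) * ∑' k, f (k + m)) ^ t⁻¹) hr
    (fun m i => Metric.closedBall i.2.1.1 (6 * (1 / 2 : ℝ) ^ i.2.1.2))
    (Filter.Eventually.of_forall fun m i => ?_) (Filter.Eventually.of_forall fun m x hx => ?_)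
  · rw [← nonpos_iff_eq_zero]
    refine key.trans (le_of_le_of_eq (Filter.liminf_le_liminf
      (Filter.Eventually.of_forall fun m => ?_)) hlim.liminf_eq)
    rw [ENNReal.tsum_sigma', ← ENNReal.tsum_mul_left]
    refine ENNReal.tsum_le_tsum fun k => ?_
    rw [tsum_fintype, hf, Finset.mul_sum, ← Finset.sum_coe_sort (u (k + m))]
    exact Finset.sum_le_sum fun p _ => hdiam p
  · rw [ENNReal.le_rpow_inv_iff ht]
    refine (hdiam _).trans (mul_le_mul_right ?_ _)
    refine le_trans ?_ (ENNReal.le_tsum i.1)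
    exact Finset.single_le_sum (f := fun p : X × ℕ => ENNReal.ofReal (((1 / 2 : ℝ) ^ p.2) ^ t))
      (fun _ _ => zero_le) i.2.2
  · obtain ⟨k, hk⟩ := Set.mem_iUnion.1 (hSA m hx)
    obtain ⟨p, hp, hxp⟩ := Set.mem_iUnion₂.1 (hcov _ hk)
    exact Set.mem_iUnion.2 ⟨⟨k, p, hp⟩, hxp⟩

/-! ### Slope projections and the averages of kernels over slopes. -/

section Kernels

variable {ι : Type*}

/-- The projection of `ℝ × ℝ^ι` along the direction `(1, a)`. -/
def slopeProj (a : ι → ℝ) (y : ℝ × (ι → ℝ)) : ι → ℝ := y.2 - y.1 • a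

theorem slopeProj_sub (a : ι → ℝ) (x y : ℝ × (ι → ℝ)) :
    slopeProj a (x - y) = slopeProj a x - slopeProj a y := by
  simp only [slopeProj, Prod.fst_sub, Prod.snd_sub, sub_smul]; abel

variable [Fintype ι]

/-- A Lipschitz cutoff on the space of slopes. -/
noncomputable def tent (a : ι → ℝ) : ℝ := max 0 (2 - ‖a‖)

@[fun_prop]
theorem measurable_slopeProj {α : Type*} [MeasurableSpace α] {f : α → ι → ℝ}
    {g : α → ℝ × (ι → ℝ)} (hf : Measurable f) (hg : Measurable g) :
    Measurable fun x => slopeProj (f x) (g x) := by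
  unfold slopeProj; fun_prop

@[fun_prop]
theorem measurable_tent : Measurable (tent : (ι → ℝ) → ℝ) := by
  unfold tent; fun_prop

theorem tent_nonneg (a : ι → ℝ) : 0 ≤ tent a := le_max_left _ _

theorem tent_le_two (a : ι → ℝ) : tent a ≤ 2 := max_le (by norm_num) (by linarith [norm_nonneg a])

theorem abs_tent_le_two (a : ι → ℝ) : |tent a| ≤ 2 := by
  rw [abs_of_nonneg (tent_nonneg a)]; exact tent_le_two a

theorem tent_eq_zero {a : ι → ℝ} (ha : 2 ≤ ‖a‖) : tent a = 0 := max_eq_left (by linarith)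

theorem abs_tent_sub_le (a b : ι → ℝ) : |tent a - tent b| ≤ ‖a - b‖ := by
  have h1 := abs_norm_sub_norm_le a b
  have := abs_max_sub_max_le_max 0 (2 - ‖a‖) 0 (2 - ‖b‖)
  unfold tent
  refine this.trans (max_le (by simp) ?_)
  rw [show 2 - ‖a‖ - (2 - ‖b‖) = -(‖a‖ - ‖b‖) by ring, abs_neg]
  exact h1

theorem norm_slopeProj_le {a : ι → ℝ} (ha : ‖a‖ ≤ 2) (y : ℝ × (ι → ℝ)) :
    ‖slopeProj a y‖ ≤ 3 * ‖y‖ := by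
  have h1 : ‖y.2‖ ≤ ‖y‖ := norm_snd_le y
  have h2 : ‖y.1‖ ≤ ‖y‖ := norm_fst_le y
  calc ‖slopeProj a y‖ ≤ ‖y.2‖ + ‖y.1 • a‖ := norm_sub_le _ _
    _ ≤ ‖y‖ + ‖y‖ * 2 := by
      rw [norm_smul]; gcongr
    _ = _ := by ring

theorem volume_real_closedBall (c : ι → ℝ) {r : ℝ} (hr : 0 ≤ r) :
    volume.real (Metric.closedBall c r) = (2 * r) ^ Fintype.card ι := by
  rw [measureReal_def, Real.volume_pi_closedBall c hr, ENNReal.toReal_ofReal (by positivity)]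

theorem integrable_of_bounded_support {α : Type*} [MeasurableSpace α] {m : Measure α} {f : α → ℝ}
    (hf : Measurable f) {A : Set α} (hmA : m A ≠ ∞) {M : ℝ}
    (hM : ∀ a, |f a| ≤ M) (h0 : ∀ a, a ∉ A → f a = 0) : Integrable f m := by
  rw [← integrableOn_iff_integrable_of_support_subset
    (fun a ha => by_contra fun hn => ha (h0 a hn) : Function.support f ⊆ A)]
  exact Measure.integrableOn_of_bounded hmA hf.aestronglyMeasurable (Filter.Eventually.of_forall hM)

theorem abs_integral_le_of_bounded_support {f : (ι → ℝ) → ℝ} {c : ι → ℝ} {r M : ℝ} (hr : 0 ≤ r)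
    (hM : ∀ a, |f a| ≤ M) (h0 : ∀ a, r < ‖a - c‖ → f a = 0) :
    |∫ a, f a| ≤ M * (2 * r) ^ Fintype.card ι := by
  rw [← setIntegral_eq_integral_of_forall_compl_eq_zero (s := Metric.closedBall c r)
    fun a ha => h0 a (by simpa [dist_eq_norm] using ha), ← volume_real_closedBall c hr]
  exact norm_setIntegral_le_of_norm_le_const (f := f) measure_closedBall_lt_top (fun a _ => hM a)

/-- Far from the origin the kernel is only seen by slopes close to that of `z`. -/
theorem slope_alternative {z : ℝ × (ι → ℝ)} {δ : ℝ} (hδ : 0 < δ) (hz : 4 * δ < ‖z‖) :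
    (∀ a, ‖a‖ ≤ 2 → δ < ‖slopeProj a z‖) ∨
      (‖z‖ / 4 ≤ |z.1| ∧ ∀ a, slopeProj a z = z.1 • (z.1⁻¹ • z.2 - a)) := by
  by_cases h : ‖z‖ / 4 ≤ |z.1|
  · refine Or.inr ⟨h, fun a => ?_⟩
    have : z.1 ≠ 0 := by
      rintro h0
      rw [h0, abs_zero] at h
      linarith
    rw [slopeProj, smul_sub, smul_inv_smul₀ this]
  · push Not at h
    refine Or.inl fun a ha => ?_
    have hz2 : ‖z‖ = ‖z.2‖ := by
      rw [Prod.norm_def]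
      refine max_eq_right (le_of_not_gt fun hlt => ?_)
      have : ‖z‖ = |z.1| := by rw [Prod.norm_def, max_eq_left hlt.le, Real.norm_eq_abs]
      linarith
    have h1 : ‖z.2‖ - ‖z.1 • a‖ ≤ ‖slopeProj a z‖ := norm_sub_norm_le _ _
    have h2 : ‖z.1 • a‖ ≤ ‖z‖ / 4 * 2 := by
      rw [norm_smul, Real.norm_eq_abs]
      gcongr
    linarith

variable {Ψ : (ι → ℝ) → ℝ} {B δ : ℝ}

theorem abs_integral_tent_mul_le (hB : ∀ u, |Ψ u| ≤ B) (z : ℝ × (ι → ℝ)) :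
    |∫ a, tent a * Ψ (slopeProj a z)| ≤ 2 * B * 4 ^ Fintype.card ι := by
  have hB0 : 0 ≤ B := (abs_nonneg _).trans (hB 0)
  have := abs_integral_le_of_bounded_support (f := fun a => tent a * Ψ (slopeProj a z)) (c := 0)
    (r := 2) (M := 2 * B) (by norm_num)
    (fun a => by
      rw [abs_mul]
      exact mul_le_mul (abs_tent_le_two a) (hB _) (abs_nonneg _) (by norm_num))
    (fun a ha => by rw [tent_eq_zero (by simpa using ha.le), zero_mul])
  norm_num at this ⊢
  exact this

/-- Bound without cancellation. -/
theorem abs_integral_tent_mul_le_pow (hδ : 0 < δ) (hB : ∀ u, |Ψ u| ≤ B)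
    (hsupp : ∀ u, δ < ‖u‖ → Ψ u = 0) {z : ℝ × (ι → ℝ)} (hz : 4 * δ < ‖z‖) :
    |∫ a, tent a * Ψ (slopeProj a z)| ≤ 2 * B * (8 * δ / ‖z‖) ^ Fintype.card ι := by
  have hB0 : 0 ≤ B := (abs_nonneg _).trans (hB 0)
  have hz0 : 0 < ‖z‖ := by linarith
  rcases slope_alternative hδ hz with h | ⟨h1, h⟩
  · have : ∀ a, tent a * Ψ (slopeProj a z) = 0 := fun a => by
      rcases le_or_gt ‖a‖ 2 with ha | ha
      · rw [hsupp _ (h a ha), mul_zero]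
      · rw [tent_eq_zero ha.le, zero_mul]
    simp only [this, integral_zero, abs_zero]
    positivity
  · have hz1 : 0 < |z.1| := by linarith
    refine (abs_integral_le_of_bounded_support (c := z.1⁻¹ • z.2) (r := δ / |z.1|) (M := 2 * B)
      (by positivity) (fun a => by
        rw [abs_mul]
        exact mul_le_mul (abs_tent_le_two a) (hB _) (abs_nonneg _) (by norm_num))
      (fun a ha => ?_)).trans ?_
    · rw [hsupp, mul_zero]
      rw [h a, norm_smul, Real.norm_eq_abs, norm_sub_rev]
      rwa [div_lt_iff₀' hz1] at ha
    · gcongr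
      rw [mul_div_assoc', div_le_div_iff₀ hz1 hz0]
      nlinarith

/-- Bound for kernels with mean zero. -/
theorem abs_integral_tent_mul_le_rpow (hδ : 0 < δ) (hΨ : Measurable Ψ) (hB : ∀ u, |Ψ u| ≤ B)
    (hsupp : ∀ u, δ < ‖u‖ → Ψ u = 0) (hmean : ∫ u, Ψ u = 0) {s : ℝ} (hs0 : 0 ≤ s)
    (hs : s ≤ Fintype.card ι + 1) {z : ℝ × (ι → ℝ)} (hz0 : z ≠ 0) :
    |∫ a, tent a * Ψ (slopeProj a z)|
      ≤ 2 * B * 4 ^ Fintype.card ι * (4 * δ / ‖z‖) ^ s := by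
  have hB0 : 0 ≤ B := (abs_nonneg _).trans (hB 0)
  have hz0 : 0 < ‖z‖ := norm_pos_iff.2 hz0
  rcases le_or_gt ‖z‖ (4 * δ) with hz | hz
  · refine (abs_integral_tent_mul_le hB z).trans (le_mul_of_one_le_right (by positivity) ?_)
    exact Real.one_le_rpow ((one_le_div hz0).2 hz) hs0
  rcases slope_alternative hδ hz with h | ⟨h1, h⟩
  · have : ∀ a, tent a * Ψ (slopeProj a z) = 0 := fun a => by
      rcases le_or_gt ‖a‖ 2 with ha | ha
      · rw [hsupp _ (h a ha), mul_zero]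
      · rw [tent_eq_zero ha.le, zero_mul]
    simp only [this, integral_zero, abs_zero]
    positivity
  have hz1 : 0 < |z.1| := by linarith
  set a₀ := z.1⁻¹ • z.2
  have hsupp' : ∀ a, δ / |z.1| < ‖a - a₀‖ → Ψ (slopeProj a z) = 0 := by
    intro a ha
    rw [hsupp]
    rw [h a, norm_smul, Real.norm_eq_abs, norm_sub_rev]
    rwa [div_lt_iff₀' hz1] at ha
  have hzero : ∫ a, Ψ (slopeProj a z) = 0 := by
    simp only [h]
    rw [integral_sub_left_eq_self (fun a => Ψ (z.1 • a)) volume a₀, Measure.integral_comp_smul,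
      hmean, smul_zero]
  have hmeas : Measurable fun a => Ψ (slopeProj a z) := hΨ.comp (by fun_prop)
  have hsupp'' : ∀ a, a ∉ Metric.closedBall a₀ (δ / |z.1|) → Ψ (slopeProj a z) = 0 :=
    fun a ha => hsupp' a (by simpa [dist_eq_norm] using ha)
  have hint1 : Integrable fun a => Ψ (slopeProj a z) :=
    integrable_of_bounded_support hmeas
      measure_closedBall_lt_top.ne (fun a => hB _) hsupp''
  have hint2 : Integrable fun a => tent a * Ψ (slopeProj a z) :=
    integrable_of_bounded_support (measurable_tent.mul hmeas)
      measure_closedBall_lt_top.ne (M := 2 * B)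
      (fun a => by
        rw [abs_mul]
        exact mul_le_mul (abs_tent_le_two a) (hB _) (abs_nonneg _) (by norm_num))
      (fun a ha => by rw [hsupp'' a ha, mul_zero])
  -- Mean zero allows a constant to be subtracted from the cutoff. Its Lipschitz bound on the
  -- support then gains one extra factor δ/|z.1|, raising the decay exponent from n to n + 1.
  have heq : ∫ a, tent a * Ψ (slopeProj a z) = ∫ a, (tent a - tent a₀) * Ψ (slopeProj a z) := by
    simp only [sub_mul]
    rw [integral_sub hint2 (hint1.const_mul _), integral_const_mul, hzero, mul_zero, sub_zero]
  have hle : |∫ a, (tent a - tent a₀) * Ψ (slopeProj a z)|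
      ≤ (δ / |z.1| * B) * (2 * (δ / |z.1|)) ^ Fintype.card ι := by
    refine abs_integral_le_of_bounded_support (c := a₀) (by positivity) (fun a => ?_)
      (fun a ha => by rw [hsupp' a ha, mul_zero])
    rcases le_or_gt ‖a - a₀‖ (δ / |z.1|) with ha | ha
    · rw [abs_mul]
      exact mul_le_mul ((abs_tent_sub_le _ _).trans ha) (hB _) (abs_nonneg _) (by positivity)
    · rw [hsupp' a ha, mul_zero, abs_zero]
      positivity
  have hq : δ / |z.1| ≤ 4 * δ / ‖z‖ := by
    rw [div_le_div_iff₀ hz1 hz0]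
    nlinarith
  have hq1 : 4 * δ / ‖z‖ ≤ 1 := (div_le_one hz0).2 hz.le
  rw [heq]
  calc _ ≤ (δ / |z.1| * B) * (2 * (δ / |z.1|)) ^ Fintype.card ι := hle
    _ ≤ (4 * δ / ‖z‖ * B) * (2 * (4 * δ / ‖z‖)) ^ Fintype.card ι := by gcongr
    _ = B * 2 ^ Fintype.card ι * (4 * δ / ‖z‖) ^ ((Fintype.card ι : ℝ) + 1) := by
      rw [Real.rpow_add_one (by positivity), Real.rpow_natCast, mul_pow]; ring
    -- The base is at most 1 here, so exponent n + 1 may be lowered to s.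
    _ ≤ (2 * B) * 4 ^ Fintype.card ι * (4 * δ / ‖z‖) ^ s := by
      refine mul_le_mul ?_ (Real.rpow_le_rpow_of_exponent_ge (by positivity) hq1 hs)
        (by positivity) (by positivity)
      gcongr
      · linarith
      · norm_num

/-- Cross-correlation. -/
noncomputable def corr (f g : (ι → ℝ) → ℝ) (u : ι → ℝ) : ℝ := ∫ v, f v * g (v + u)

theorem integral_sub_mul_sub (f g : (ι → ℝ) → ℝ) (p q : ι → ℝ) :
    ∫ v, f (v - p) * g (v - q) = corr f g (p - q) := by
  rw [corr, ← integral_sub_right_eq_self (fun v => f v * g (v + (p - q))) p]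
  congr with v
  congr 2
  abel

variable {f g : (ι → ℝ) → ℝ} {M : ℝ}

@[fun_prop]
theorem measurable_corr (hf : Measurable f) (hg : Measurable g) : Measurable (corr f g) := by
  have : Measurable fun q : (ι → ℝ) × (ι → ℝ) => f q.2 * g (q.2 + q.1) := by fun_prop
  exact this.stronglyMeasurable.integral_prod_right.measurable

theorem abs_corr_le (hδ : 0 < δ) (hfM : ∀ u, |f u| ≤ M) (hgM : ∀ u, |g u| ≤ M)
    (hf0 : ∀ u, δ / 2 < ‖u‖ → f u = 0) (u : ι → ℝ) :
    |corr f g u| ≤ M ^ 2 * δ ^ Fintype.card ι := by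
  have := abs_integral_le_of_bounded_support (f := fun v => f v * g (v + u)) (c := 0)
    (r := δ / 2) (M := M ^ 2) (by positivity) (fun a => by
      rw [abs_mul, sq]
      exact mul_le_mul (hfM _) (hgM _) (abs_nonneg _) ((abs_nonneg _).trans (hfM 0)))
    (fun a ha => by rw [hf0 a (by simpa using ha), zero_mul])
  rwa [mul_div_cancel₀ _ two_ne_zero] at this

theorem corr_eq_zero (hf0 : ∀ u, δ / 2 < ‖u‖ → f u = 0) (hg0 : ∀ u, δ / 2 < ‖u‖ → g u = 0)
    (u : ι → ℝ) (hu : δ < ‖u‖) : corr f g u = 0 := by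
  rw [corr, ← integral_zero (ι → ℝ) ℝ]
  congr with v
  rcases le_or_gt ‖v‖ (δ / 2) with hv | hv
  · rw [hg0, mul_zero]
    have := norm_sub_le (v + u) v
    rw [add_sub_cancel_left] at this
    linarith
  · rw [hf0 v hv, zero_mul]

/-- By Fubini the integral of a correlation is the product of the two integrals. -/
theorem integral_corr_eq_zero (hf : Measurable f) (hg : Measurable g) (hfM : ∀ u, |f u| ≤ M)
    (hgM : ∀ u, |g u| ≤ M)
    (hf0 : ∀ u, δ / 2 < ‖u‖ → f u = 0) (hg0 : ∀ u, δ / 2 < ‖u‖ → g u = 0)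
    (hmean : ∫ u, g u = 0) : ∫ u, corr f g u = 0 := by
  unfold corr
  rw [integral_integral_swap]
  · simp only [integral_const_mul, integral_add_left_eq_self g, hmean, mul_zero, integral_zero]
  · refine integrable_of_bounded_support (M := M ^ 2)
      (A := Metric.closedBall 0 δ ×ˢ Metric.closedBall 0 (δ / 2)) ?_ ?_ ?_ ?_
    · simp only [Function.uncurry_def]
      fun_prop
    · rw [Measure.prod_prod]
      exact ENNReal.mul_ne_top measure_closedBall_lt_top.ne measure_closedBall_lt_top.ne
    · rintro ⟨u, v⟩
      simp only [Function.uncurry_apply_pair]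
      rw [abs_mul, sq]
      exact mul_le_mul (hfM _) (hgM _) (abs_nonneg _) ((abs_nonneg _).trans (hfM 0))
    · rintro ⟨u, v⟩ huv
      simp only [Function.uncurry_apply_pair]
      rcases le_or_gt ‖v‖ (δ / 2) with hv | hv
      · rw [hg0, mul_zero]
        have hu : δ < ‖u‖ := by
          by_contra hu
          exact huv ⟨by simpa using hu, by simpa using hv⟩
        have := norm_sub_le (v + u) v
        rw [add_sub_cancel_left] at this
        linarith
      · rw [hf0 v hv, zero_mul]

theorem corr_comm_of_even (hf : ∀ u, f (-u) = f u) (hg : ∀ u, g (-u) = g u) (u : ι → ℝ) :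
    corr f g u = corr g f u := by
  rw [corr, corr, ← integral_sub_left_eq_self (fun v => f v * g (v + u)) volume (-u)]
  congr with v
  rw [show -u - v = -(v + u) by abel, hf, show -(v + u) + u = -v by abel, hg, mul_comm]

/-- A difference of two squares: the mixed terms cancel because even functions have commuting
correlations. The factor `f - g`, which has mean zero for normalised bumps, will be paired with μ,
and the positive factor `f + g` with the test measure ν. -/
theorem corr_self_sub_corr_self (hf : Measurable f) (hg : Measurable g) (hfM : ∀ u, |f u| ≤ M)
    (hgM : ∀ u, |g u| ≤ M)
    (hf0 : ∀ u, δ / 2 < ‖u‖ → f u = 0) (hg0 : ∀ u, δ / 2 < ‖u‖ → g u = 0)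
    (hfe : ∀ u, f (-u) = f u) (hge : ∀ u, g (-u) = g u) (u : ι → ℝ) :
    corr f f u - corr g g u = corr (f + g) (f - g) u := by
  have hint : ∀ {f₁ f₂ : (ι → ℝ) → ℝ}, Measurable f₁ → Measurable f₂ → (∀ u, |f₁ u| ≤ M) →
      (∀ u, |f₂ u| ≤ M) → (∀ u, δ / 2 < ‖u‖ → f₁ u = 0) →
      Integrable fun v => f₁ v * f₂ (v + u) := by
    intro f₁ f₂ h1 h2 hM1 hM2 h0
    refine integrable_of_bounded_support (M := M ^ 2) (A := Metric.closedBall 0 (δ / 2))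
      (by fun_prop) measure_closedBall_lt_top.ne ?_ ?_
    · intro v
      rw [abs_mul, sq]
      exact mul_le_mul (hM1 _) (hM2 _) (abs_nonneg _) ((abs_nonneg _).trans (hM1 0))
    · intro v hv
      rw [h0 v (by simpa using hv), zero_mul]
  have hc := corr_comm_of_even hfe hge u
  have h1 := hint hf hf hfM hfM hf0
  have h2 := hint hg hg hgM hgM hg0
  have h3 := hint hf hg hfM hgM hf0
  have h4 := hint hg hf hgM hfM hg0
  have : corr (f + g) (f - g) u = corr f f u - corr f g u + corr g f u - corr g g u := by
    simp only [corr]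
    rw [← integral_sub h1 h3]
    rw [← integral_add (f := fun v => f v * f (v + u) - f v * g (v + u)) (h1.sub h3) h4]
    rw [← integral_sub (f := fun v => f v * f (v + u) - f v * g (v + u) + g v * f (v + u))
      ((h1.sub h3).add h4) h2]
    congr with v
    simp only [Pi.add_apply, Pi.sub_apply]
    ring
  rw [this, hc]
  ring

end Kernels

/-! ### Quadratic forms of projected measures and the duality between μ and ν. -/

section QuadraticForms

variable {ι : Type*}

/-- The convolution of `η` with the projected measure. -/
noncomputable def projAvg (η : (ι → ℝ) → ℝ) (μ : Measure (ℝ × (ι → ℝ)))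
    (q : (ι → ℝ) × (ι → ℝ)) : ℝ := ∫ y, η (q.2 - slopeProj q.1 y) ∂μ

theorem abs_projAvg_le {μ : Measure (ℝ × (ι → ℝ))} [IsFiniteMeasure μ] {f : (ι → ℝ) → ℝ} {M : ℝ}
    (hfM : ∀ u, |f u| ≤ M) (q : (ι → ℝ) × (ι → ℝ)) :
    |projAvg f μ q| ≤ M * μ.real Set.univ :=
  norm_integral_le_of_norm_le_const (f := fun y => f (q.2 - slopeProj q.1 y))
    (Filter.Eventually.of_forall fun _ => hfM _)

theorem integrable_of_abs_le {α : Type*} [MeasurableSpace α] {m : Measure α} [IsFiniteMeasure m]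
    {f : α → ℝ} (hf : Measurable f) {M : ℝ} (hM : ∀ a, |f a| ≤ M) : Integrable f m :=
  Integrable.of_bound hf.aestronglyMeasurable M (Filter.Eventually.of_forall hM)

variable [Fintype ι]

/-- A bounded region of pairs (slope, point of the image of the projection). -/
noncomputable def boxMeasure (ι : Type*) [Fintype ι] (R : ℝ) : Measure ((ι → ℝ) × (ι → ℝ)) :=
  (volume.restrict (Metric.closedBall 0 2)).prod
    (volume.restrict (Metric.closedBall 0 (3 * R + 1)))

instance isFiniteMeasure_restrict_closedBall (c : ι → ℝ) (r : ℝ) :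
    IsFiniteMeasure (volume.restrict (Metric.closedBall c r)) :=
  isFiniteMeasure_restrict.2 measure_closedBall_lt_top.ne

instance isFiniteMeasure_boxMeasure (R : ℝ) : IsFiniteMeasure (boxMeasure ι R) := by
  unfold boxMeasure; infer_instance

variable {μ ν : Measure (ℝ × (ι → ℝ))} [IsFiniteMeasure μ] [IsFiniteMeasure ν]
  {f g : (ι → ℝ) → ℝ} {M R : ℝ}

theorem measurable_projAvg (hf : Measurable f) : Measurable (projAvg f μ) := by
  have : Measurable fun p : ((ι → ℝ) × (ι → ℝ)) × (ℝ × (ι → ℝ)) =>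
      f (p.1.2 - slopeProj p.1.1 p.2) := by fun_prop
  exact this.stronglyMeasurable.integral_prod_right.measurable

/-- Projections of points of norm at most R have norm at most 3R for slopes of norm at most 2, and
`f` lives in the unit ball. The radius 3R + 1 therefore truncates nothing, and on the resulting
finite box boundedness alone justifies Fubini. -/
theorem setIntegral_sub_mul_sub (hf0 : ∀ u, 1 < ‖u‖ → f u = 0) {a : ι → ℝ} (ha : ‖a‖ ≤ 2)
    {x y : ℝ × (ι → ℝ)} (hx : ‖x‖ ≤ R) :
    ∫ v in Metric.closedBall 0 (3 * R + 1), f (v - slopeProj a x) * g (v - slopeProj a y)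
      = corr f g (slopeProj a (x - y)) := by
  rw [slopeProj_sub, ← integral_sub_mul_sub]
  refine setIntegral_eq_integral_of_forall_compl_eq_zero fun v hv => ?_
  rw [hf0, zero_mul]
  have h1 : 3 * R + 1 < ‖v‖ := by simpa using hv
  have h2 := norm_slopeProj_le ha x
  have h3 := norm_sub_norm_le v (slopeProj a x)
  linarith

theorem integral_tent_mul_eq (h : (ι → ℝ) → ℝ) :
    ∫ a, tent a * h a = ∫ a in Metric.closedBall 0 2, tent a * h a :=
  (setIntegral_eq_integral_of_forall_compl_eq_zero fun a ha => by
    rw [tent_eq_zero (by simpa using (not_le.1 (by simpa using ha)).le), zero_mul]).symm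

/-- Expanding the square reduces an L² norm of smoothed projections to a two-point kernel, to which
the slope-average bounds apply pointwise. -/
theorem integral_boxMeasure_tent_mul_sq (hf : Measurable f) (hfM : ∀ u, |f u| ≤ M)
    (hf0 : ∀ u, 1 < ‖u‖ → f u = 0) (hμ : ∀ᵐ y ∂μ, ‖y‖ ≤ R) :
    ∫ q, tent q.1 * projAvg f μ q ^ 2 ∂(boxMeasure ι R)
      = ∫ p, (∫ a, tent a * corr f f (slopeProj a (p.1 - p.2))) ∂(μ.prod μ) := by
  have hM0 : 0 ≤ M := (abs_nonneg _).trans (hfM 0)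
  have h1 : ∀ q : (ι → ℝ) × (ι → ℝ), tent q.1 * projAvg f μ q ^ 2
      = ∫ p : (ℝ × (ι → ℝ)) × (ℝ × (ι → ℝ)),
        tent q.1 * (f (q.2 - slopeProj q.1 p.1) * f (q.2 - slopeProj q.1 p.2)) ∂(μ.prod μ) := by
    intro q
    rw [integral_const_mul, sq, projAvg, integral_prod_mul (fun y => f (q.2 - slopeProj q.1 y))
      fun y => f (q.2 - slopeProj q.1 y)]
  have hF : Measurable fun r : ((ι → ℝ) × (ι → ℝ)) × ((ℝ × (ι → ℝ)) × (ℝ × (ι → ℝ))) =>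
      tent r.1.1 * (f (r.1.2 - slopeProj r.1.1 r.2.1) * f (r.1.2 - slopeProj r.1.1 r.2.2)) := by
    fun_prop
  have hb : ∀ (a v : ι → ℝ) (x y : ℝ × (ι → ℝ)),
      |tent a * (f (v - slopeProj a x) * f (v - slopeProj a y))| ≤ 2 * (M * M) := by
    intro a v x y
    rw [abs_mul, abs_mul]
    exact mul_le_mul (abs_tent_le_two a) (mul_le_mul (hfM _) (hfM _) (abs_nonneg _) hM0)
      (by positivity) (by norm_num)
  simp only [h1]
  rw [integral_integral_swap]
  swap
  · exact integrable_of_abs_le hF fun r => hb _ _ _ _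
  refine integral_congr_ae ?_
  have hμ2 : ∀ᵐ p ∂(μ.prod μ), ‖p.1‖ ≤ R := Measure.quasiMeasurePreserving_fst.ae hμ
  filter_upwards [hμ2] with p hp
  rw [boxMeasure, integral_prod, integral_tent_mul_eq]
  · refine setIntegral_congr_fun Metric.isClosed_closedBall.measurableSet fun a ha => ?_
    simp only
    rw [integral_const_mul, setIntegral_sub_mul_sub hf0 (by simpa using ha) hp]
  · exact integrable_of_abs_le (by fun_prop) fun r => hb _ _ _ _

/-- Fubini separates the two kernels: `g` smooths the projection of μ, while `f` stays at the point
x and will smooth the projection of ν after integration in x. -/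
theorem integral_corr_slopeProj (hf : Measurable f) (hg : Measurable g)
    (hfM : ∀ u, |f u| ≤ M) (hgM : ∀ u, |g u| ≤ M) (hf0 : ∀ u, 1 < ‖u‖ → f u = 0)
    {a : ι → ℝ} (ha : ‖a‖ ≤ 2) {x : ℝ × (ι → ℝ)} (hx : ‖x‖ ≤ R) :
    ∫ y, corr f g (slopeProj a (x - y)) ∂μ
      = ∫ v in Metric.closedBall 0 (3 * R + 1), f (v - slopeProj a x) * projAvg g μ (a, v) := by
  have hM0 : 0 ≤ M := (abs_nonneg _).trans (hfM 0)
  simp only [← setIntegral_sub_mul_sub (g := g) hf0 ha hx, projAvg, ← integral_const_mul]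
  rw [integral_integral_swap]
  refine integrable_of_abs_le (M := M * M) ?_ fun r => ?_
  · simp only [Function.uncurry_def]; fun_prop
  · simp only [Function.uncurry_def, abs_mul]
    exact mul_le_mul (hfM _) (hgM _) (abs_nonneg _) hM0

/-- Arithmetic-geometric mean form of the duality between `μ` and `ν`. -/
theorem integral_abs_corr_le (hf : Measurable f) (hg : Measurable g)
    (hfM : ∀ u, |f u| ≤ M) (hgM : ∀ u, |g u| ≤ M) (hf0 : ∀ u, 1 < ‖u‖ → f u = 0)
    (hfpos : ∀ u, 0 ≤ f u) (hν : ∀ᵐ x ∂ν, ‖x‖ ≤ R) {c : ℝ} (hc : 0 < c) :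
    ∫ x, (∫ a, tent a * |∫ y, corr f g (slopeProj a (x - y)) ∂μ|) ∂ν
      ≤ (c * ∫ q, tent q.1 * projAvg g μ q ^ 2 ∂(boxMeasure ι R)
        + c⁻¹ * ∫ q, tent q.1 * projAvg f ν q ^ 2 ∂(boxMeasure ι R)) / 2 := by
  have hM0 : 0 ≤ M := (abs_nonneg _).trans (hfM 0)
  have hmg : Measurable (projAvg g μ) := measurable_projAvg hg
  have hmf : Measurable (projAvg f ν) := measurable_projAvg hf
  have hbg := fun q => abs_projAvg_le (μ := μ) hgM q
  have hbf := fun q => abs_projAvg_le (μ := ν) hfM q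
  set Mg := M * μ.real Set.univ
  set Mf := M * ν.real Set.univ
  have hMg0 : 0 ≤ Mg := by positivity
  have hMf0 : 0 ≤ Mf := by positivity
  have hmF : Measurable fun r : (ℝ × (ι → ℝ)) × ((ι → ℝ) × (ι → ℝ)) =>
      tent r.2.1 * (f (r.2.2 - slopeProj r.2.1 r.1) * |projAvg g μ r.2|) := by fun_prop
  have hbF : ∀ (x : ℝ × (ι → ℝ)) (q : (ι → ℝ) × (ι → ℝ)),
      |tent q.1 * (f (q.2 - slopeProj q.1 x) * |projAvg g μ q|)| ≤ 2 * (M * Mg) := by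
    intro x q
    rw [abs_mul, abs_mul, abs_abs]
    exact mul_le_mul (abs_tent_le_two _) (mul_le_mul (hfM _) (hbg _) (abs_nonneg _) hM0)
      (by positivity) (by norm_num)
  have hpt : ∀ᵐ x ∂ν, ∫ a, tent a * |∫ y, corr f g (slopeProj a (x - y)) ∂μ|
      ≤ ∫ q, tent q.1 * (f (q.2 - slopeProj q.1 x) * |projAvg g μ q|) ∂(boxMeasure ι R) := by
    filter_upwards [hν] with x hx
    have hint : Integrable (fun q : (ι → ℝ) × (ι → ℝ) =>
        tent q.1 * (f (q.2 - slopeProj q.1 x) * |projAvg g μ q|)) (boxMeasure ι R) :=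
      integrable_of_abs_le (by fun_prop) (fun q => hbF x q)
    rw [boxMeasure] at hint ⊢
    rw [integral_prod _ hint, integral_tent_mul_eq]
    refine integral_mono_of_nonneg (Filter.Eventually.of_forall fun a =>
      mul_nonneg (tent_nonneg a) (abs_nonneg _)) hint.integral_prod_left ?_
    refine (ae_restrict_iff' Metric.isClosed_closedBall.measurableSet).2
      (Filter.Eventually.of_forall fun a ha => ?_)
    simp only
    rw [integral_const_mul, integral_corr_slopeProj hf hg hfM hgM hf0 (by simpa using ha) hx]
    refine mul_le_mul_of_nonneg_left ?_ (tent_nonneg a)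
    -- The absolute value moves onto the μ-factor alone because `f` is nonnegative, so the ν-factor
    -- remains a genuine smoothed projection.
    refine abs_integral_le_integral_abs.trans_eq ?_
    congr with v
    rw [abs_mul, abs_of_nonneg (hfpos _)]
  have hint := integrable_of_abs_le (m := ν.prod (boxMeasure ι R)) hmF fun r => hbF r.1 r.2
  have hsq : ∀ {h : (ι → ℝ) × (ι → ℝ) → ℝ} {N : ℝ}, Measurable h → (∀ q, |h q| ≤ N) →
      Integrable (fun q => tent q.1 * h q ^ 2) (boxMeasure ι R) := by
    intro h N hh hN
    refine integrable_of_abs_le (M := 2 * N ^ 2) (by fun_prop) fun q => ?_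
    rw [abs_mul, abs_pow]
    have := hN q
    exact mul_le_mul (abs_tent_le_two _) (by gcongr) (by positivity) (by norm_num)
  calc ∫ x, (∫ a, tent a * |∫ y, corr f g (slopeProj a (x - y)) ∂μ|) ∂ν
      ≤ ∫ x, (∫ q, tent q.1 * (f (q.2 - slopeProj q.1 x) * |projAvg g μ q|)
          ∂(boxMeasure ι R)) ∂ν :=
        integral_mono_of_nonneg (Filter.Eventually.of_forall fun x => integral_nonneg fun a =>
          mul_nonneg (tent_nonneg a) (abs_nonneg _)) hint.integral_prod_left hpt
    _ = ∫ q, tent q.1 * (projAvg f ν q * |projAvg g μ q|) ∂(boxMeasure ι R) := by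
        rw [integral_integral_swap hint]
        refine integral_congr_ae (Filter.Eventually.of_forall fun q => ?_)
        simp only
        rw [integral_const_mul, integral_mul_const]
        rfl
    _ ≤ ∫ q, (c * (tent q.1 * projAvg g μ q ^ 2) + c⁻¹ * (tent q.1 * projAvg f ν q ^ 2)) / 2
          ∂(boxMeasure ι R) := by
        refine integral_mono ?_ ((((hsq hmg hbg).const_mul c).add
          ((hsq hmf hbf).const_mul c⁻¹)).div_const 2) fun q => ?_
        · refine integrable_of_abs_le (M := 2 * (Mf * Mg)) (by fun_prop) fun q => ?_
          rw [abs_mul, abs_mul, abs_abs]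
          exact mul_le_mul (abs_tent_le_two _) (mul_le_mul (hbf _) (hbg _) (abs_nonneg _) hMf0)
            (by positivity) (by norm_num)
        · simp only
          have h1 : 2 * (projAvg f ν q * |projAvg g μ q|)
              ≤ c * projAvg g μ q ^ 2 + c⁻¹ * projAvg f ν q ^ 2 := by
            have h2 : 0 ≤ c⁻¹ * (c * |projAvg g μ q| - projAvg f ν q) ^ 2 := by positivity
            have h3 : c⁻¹ * (c * |projAvg g μ q| - projAvg f ν q) ^ 2
                = c * |projAvg g μ q| ^ 2 + c⁻¹ * projAvg f ν q ^ 2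
                  - 2 * (projAvg f ν q * |projAvg g μ q|) := by
              field_simp
              ring
            rw [sq_abs] at h3
            linarith
          have := mul_le_mul_of_nonneg_left h1 (tent_nonneg q.1)
          linarith
    _ = _ := by
        rw [integral_div, integral_add ((hsq hmg hbg).const_mul c) ((hsq hmf hbf).const_mul c⁻¹),
          integral_const_mul, integral_const_mul]

end QuadraticForms

/-! ### Dyadic scales: decay for μ, growth for Frostman measures ν, and the resulting mass bound. -/

section Scales

variable {ι : Type*} [Fintype ι]

/-- Normalised indicator of the cube of side `2^{-k}`. -/
noncomputable def bump (ι : Type*) [Fintype ι] (k : ℕ) (u : ι → ℝ) : ℝ :=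
  (Metric.closedBall 0 ((1 / 2 : ℝ) ^ k / 2)).indicator (fun _ => ((2 : ℝ) ^ k) ^ Fintype.card ι) u

theorem measurable_bump (k : ℕ) : Measurable (bump ι k) :=
  measurable_const.indicator Metric.isClosed_closedBall.measurableSet

theorem bump_nonneg (k : ℕ) (u : ι → ℝ) : 0 ≤ bump ι k u :=
  Set.indicator_nonneg (fun _ _ => by positivity) u

theorem bump_le (k : ℕ) (u : ι → ℝ) : bump ι k u ≤ ((2 : ℝ) ^ k) ^ Fintype.card ι :=
  Set.indicator_le_self' (fun _ _ => by positivity) u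

theorem bump_of_norm_le {k : ℕ} {u : ι → ℝ} (hu : ‖u‖ ≤ (1 / 2 : ℝ) ^ k / 2) :
    bump ι k u = ((2 : ℝ) ^ k) ^ Fintype.card ι :=
  Set.indicator_of_mem (by simpa using hu) _

theorem bump_eq_zero {k : ℕ} {u : ι → ℝ} (hu : (1 / 2 : ℝ) ^ k / 2 < ‖u‖) : bump ι k u = 0 :=
  Set.indicator_of_notMem (by simpa using hu) _

theorem bump_neg (k : ℕ) (u : ι → ℝ) : bump ι k (-u) = bump ι k u := by
  simp [bump, Set.indicator]

theorem integral_bump (k : ℕ) : ∫ u, bump ι k u = 1 := by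
  unfold bump
  rw [integral_indicator Metric.isClosed_closedBall.measurableSet, setIntegral_const,
    volume_real_closedBall _ (by positivity), smul_eq_mul, mul_div_cancel₀ _ two_ne_zero, ← mul_pow,
    ← mul_pow]
  norm_num

theorem integrable_bump (k : ℕ) : Integrable (bump ι k) :=
  integrable_of_bounded_support (measurable_bump k) (A := Metric.closedBall 0 ((1 / 2 : ℝ) ^ k / 2))
    measure_closedBall_lt_top.ne
    (fun a => by rw [abs_of_nonneg (bump_nonneg k a)]; exact bump_le k a)
    fun _ ha => bump_eq_zero (by simpa using ha)

/-- The density at slope `a` of the smoothed radial projection of `μ` from `x`. -/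
noncomputable def coneDensity (μ : Measure (ℝ × (ι → ℝ))) (k : ℕ) (x : ℝ × (ι → ℝ)) (a : ι → ℝ) :
    ℝ := ∫ y, corr (bump ι k) (bump ι k) (slopeProj a (x - y)) ∂μ

/-- Weighted `L¹` distance of the smoothed radial projections at consecutive scales. -/
noncomputable def coneOscillation (μ : Measure (ℝ × (ι → ℝ))) (k : ℕ) (x : ℝ × (ι → ℝ)) : ℝ :=
  ∫ a, tent a * |coneDensity μ (k + 1) x a - coneDensity μ k x a|

theorem abs_bump_add_le (k : ℕ) (u : ι → ℝ) :
    |(bump ι (k + 1) + bump ι k) u| ≤ 2 * ((2 : ℝ) ^ (k + 1)) ^ Fintype.card ι := by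
  rw [Pi.add_apply, abs_of_nonneg (add_nonneg (bump_nonneg _ _) (bump_nonneg _ _))]
  have h1 := bump_le (k + 1) u
  have h2 : bump ι k u ≤ ((2 : ℝ) ^ (k + 1)) ^ Fintype.card ι := (bump_le k u).trans (by
    gcongr <;> norm_num)
  linarith

theorem abs_bump_sub_le (k : ℕ) (u : ι → ℝ) :
    |(bump ι (k + 1) - bump ι k) u| ≤ 2 * ((2 : ℝ) ^ (k + 1)) ^ Fintype.card ι := by
  refine le_trans ?_ (abs_bump_add_le k u)
  rw [Pi.add_apply, abs_of_nonneg (add_nonneg (bump_nonneg _ _) (bump_nonneg _ _)), Pi.sub_apply,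
    abs_sub_le_iff]
  constructor <;> linarith [bump_nonneg k u, bump_nonneg (k + 1) u]

theorem bump_succ_eq_zero {k : ℕ} {u : ι → ℝ} (hu : (1 / 2 : ℝ) ^ k / 2 < ‖u‖) :
    bump ι (k + 1) u = 0 := by
  refine bump_eq_zero (lt_of_le_of_lt ?_ hu)
  have : (0 : ℝ) < (1 / 2) ^ k := by positivity
  rw [pow_succ]
  linarith

theorem bump_add_eq_zero {k : ℕ} {u : ι → ℝ} (hu : (1 / 2 : ℝ) ^ k / 2 < ‖u‖) :
    (bump ι (k + 1) + bump ι k) u = 0 := by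
  rw [Pi.add_apply, bump_eq_zero hu, bump_succ_eq_zero hu, add_zero]

theorem bump_sub_eq_zero {k : ℕ} {u : ι → ℝ} (hu : (1 / 2 : ℝ) ^ k / 2 < ‖u‖) :
    (bump ι (k + 1) - bump ι k) u = 0 := by
  rw [Pi.sub_apply, bump_eq_zero hu, bump_succ_eq_zero hu, sub_zero]

theorem half_pow_div_two_lt {k : ℕ} {r : ℝ} (hr : 1 < r) : (1 / 2 : ℝ) ^ k / 2 < r := by
  have : (1 / 2 : ℝ) ^ k ≤ 1 := pow_le_one₀ (by norm_num) (by norm_num)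
  linarith

/-- The height squared is 4 · 4^n · 2^{2kn}, and the supporting cube has volume 2^{-kn}. -/
theorem abs_corr_bump_le {f : (ι → ℝ) → ℝ} {k : ℕ}
    (hM : ∀ u, |f u| ≤ 2 * ((2 : ℝ) ^ (k + 1)) ^ Fintype.card ι)
    (h0 : ∀ u, (1 / 2 : ℝ) ^ k / 2 < ‖u‖ → f u = 0) (u : ι → ℝ) :
    |corr f f u| ≤ 4 * 4 ^ Fintype.card ι * (2 ^ k) ^ Fintype.card ι := by
  refine (abs_corr_le (δ := (1 / 2 : ℝ) ^ k) (by positivity) hM hM h0 u).trans_eq ?_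
  have h1 : ((1 / 2 : ℝ) ^ k) ^ Fintype.card ι * (2 ^ k) ^ Fintype.card ι = 1 := by
    rw [← mul_pow, ← mul_pow]; norm_num
  have h2 : ((2 : ℝ) ^ (k + 1)) ^ Fintype.card ι
      = 2 ^ Fintype.card ι * (2 ^ k) ^ Fintype.card ι := by
    rw [pow_succ, mul_pow, mul_comm]
  have h3 : (4 : ℝ) ^ Fintype.card ι = 2 ^ Fintype.card ι * 2 ^ Fintype.card ι := by
    rw [← mul_pow]; norm_num
  rw [h2, h3]
  linear_combination (4 * 2 ^ Fintype.card ι * 2 ^ Fintype.card ι * (2 ^ k) ^ Fintype.card ι) * h1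

variable {μ ν : Measure (ℝ × (ι → ℝ))} [IsFiniteMeasure μ] [IsFiniteMeasure ν] {R : ℝ}

/-- Smoothing with autocorrelations of even bumps is what makes this factorisation, and hence the
duality argument, available. -/
theorem coneDensity_succ_sub (k : ℕ) (x : ℝ × (ι → ℝ)) (a : ι → ℝ) :
    coneDensity μ (k + 1) x a - coneDensity μ k x a
      = ∫ y, corr (bump ι (k + 1) + bump ι k) (bump ι (k + 1) - bump ι k)
        (slopeProj a (x - y)) ∂μ := by
  have hM : ∀ j ≤ k + 1, ∀ u, |bump ι j u| ≤ ((2 : ℝ) ^ (k + 1)) ^ Fintype.card ι := by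
    intro j hj u
    rw [abs_of_nonneg (bump_nonneg j u)]
    exact (bump_le j u).trans (by gcongr; norm_num)
  have h0 : ∀ u, (1 / 2 : ℝ) ^ k / 2 < ‖u‖ → bump ι k u = 0 := fun u => bump_eq_zero
  have h1 : ∀ u, (1 / 2 : ℝ) ^ k / 2 < ‖u‖ → bump ι (k + 1) u = 0 := fun u => bump_succ_eq_zero
  have hint : ∀ j ≤ k + 1, (∀ u, (1 / 2 : ℝ) ^ k / 2 < ‖u‖ → bump ι j u = 0) →
      Integrable (fun y => corr (bump ι j) (bump ι j) (slopeProj a (x - y))) μ := by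
    intro j hj hj0
    refine integrable_of_abs_le (M := _) ?_ fun y =>
      abs_corr_le (by positivity) (hM j hj) (hM j hj) hj0 _
    exact (measurable_corr (measurable_bump j) (measurable_bump j)).comp (by fun_prop)
  rw [coneDensity, coneDensity, ← integral_sub (hint _ le_rfl h1) (hint _ (Nat.le_succ k) h0)]
  congr with y
  exact corr_self_sub_corr_self (measurable_bump _) (measurable_bump _) (hM _ le_rfl)
    (hM _ (Nat.le_succ k)) h1 h0 (bump_neg _) (bump_neg _) _

theorem integral_coneOscillation_le (k : ℕ) (hν : ∀ᵐ x ∂ν, ‖x‖ ≤ R) {c : ℝ} (hc : 0 < c) :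
    ∫ x, coneOscillation μ k x ∂ν
      ≤ (c * ∫ q, tent q.1 * projAvg (bump ι (k + 1) - bump ι k) μ q ^ 2 ∂(boxMeasure ι R)
        + c⁻¹ * ∫ q, tent q.1 * projAvg (bump ι (k + 1) + bump ι k) ν q ^ 2
          ∂(boxMeasure ι R)) / 2 := by
  simp only [coneOscillation, coneDensity_succ_sub]
  exact integral_abs_corr_le ((measurable_bump _).add (measurable_bump _))
    ((measurable_bump _).sub (measurable_bump _)) (abs_bump_add_le k) (abs_bump_sub_le k)
    (fun u hu => bump_add_eq_zero (half_pow_div_two_lt hu))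
    (fun u => add_nonneg (bump_nonneg _ _) (bump_nonneg _ _)) hν hc

theorem integral_prod_le_of_lintegral_le {α : Type*} [MeasurableSpace α] {m : Measure α}
    [SFinite m] {J : α × α → ℝ} (hJ : Measurable J) {C : ℝ} (hC : 0 ≤ C)
    (h : ∫⁻ x, ∫⁻ y, ENNReal.ofReal |J (x, y)| ∂m ∂m ≤ ENNReal.ofReal C) :
    ∫ p, J p ∂(m.prod m) ≤ C := by
  refine (le_abs_self _).trans ?_
  rw [← ENNReal.ofReal_le_ofReal_iff hC, ← Real.enorm_eq_ofReal_abs]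
  refine (enorm_integral_le_lintegral_enorm _).trans ?_
  rw [lintegral_prod _ (by fun_prop)]
  simpa only [Real.enorm_eq_ofReal_abs] using h

theorem measurable_integral_tent_mul_corr {f : (ι → ℝ) → ℝ} (hf : Measurable f) :
    Measurable fun p : (ℝ × (ι → ℝ)) × (ℝ × (ι → ℝ)) =>
      ∫ a, tent a * corr f f (slopeProj a (p.1 - p.2)) := by
  have : Measurable fun r : ((ℝ × (ι → ℝ)) × (ℝ × (ι → ℝ))) × (ι → ℝ) =>
      tent r.2 * corr f f (slopeProj r.2 (r.1.1 - r.1.2)) := by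
    have := measurable_corr hf hf
    fun_prop
  exact this.stronglyMeasurable.integral_prod_right.measurable

theorem half_pow_rpow_sub (k : ℕ) (r : ℝ) (n : ℕ) :
    ((1 / 2 : ℝ) ^ k) ^ (r - n) = ((1 / 2 : ℝ) ^ k) ^ r * (2 ^ k) ^ n := by
  rw [Real.rpow_sub (by positivity), Real.rpow_natCast, div_eq_mul_inv, ← inv_pow, ← inv_pow]
  norm_num

/-- Decay of the high frequency part of projections, on average over directions. -/
theorem integral_projAvg_bump_sub_le (k : ℕ) (hμ : ∀ᵐ y ∂μ, ‖y‖ ≤ R) {s : ℝ} (hs0 : 0 < s)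
    (hs : s ≤ Fintype.card ι + 1) {E : ℝ} (hE0 : 0 ≤ E)
    (hE : ∫⁻ x, ∫⁻ y, edist x y ^ (-s) ∂μ ∂μ ≤ ENNReal.ofReal E) :
    ∫ q, tent q.1 * projAvg (bump ι (k + 1) - bump ι k) μ q ^ 2 ∂(boxMeasure ι R)
      ≤ 2 * (4 * 4 ^ Fintype.card ι) * 4 ^ Fintype.card ι * 4 ^ s * E
        * ((1 / 2 : ℝ) ^ k) ^ (s - Fintype.card ι) := by
  set n := Fintype.card ι with hn
  have hmg : Measurable (bump ι (k + 1) - bump ι k) := (measurable_bump _).sub (measurable_bump _)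
  rw [integral_boxMeasure_tent_mul_sq hmg (abs_bump_sub_le k)
    (fun u hu => bump_sub_eq_zero (half_pow_div_two_lt hu)) hμ, half_pow_rpow_sub]
  set D : ℝ := 2 * (4 * 4 ^ n * (2 ^ k) ^ n) * 4 ^ n * (4 * (1 / 2 : ℝ) ^ k) ^ s with hD
  have hD0 : 0 < D := by positivity
  have hDE : 2 * (4 * 4 ^ n) * 4 ^ n * 4 ^ s * E * (((1 / 2 : ℝ) ^ k) ^ s * (2 ^ k) ^ n) = D * E := by
    rw [hD, Real.mul_rpow (by norm_num) (by positivity)]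
    ring
  rw [hDE]
  refine integral_prod_le_of_lintegral_le (measurable_integral_tent_mul_corr hmg) (by positivity) ?_
  calc _ ≤ ∫⁻ x, ∫⁻ y, ENNReal.ofReal D * edist x y ^ (-s) ∂μ ∂μ := by
        refine lintegral_mono fun x => lintegral_mono fun y => ?_
        simp only
        rcases eq_or_ne x y with rfl | hxy
        · rw [edist_self, ENNReal.zero_rpow_of_neg (by linarith), ENNReal.mul_top]
          · exact le_top
          · simpa using hD0
        · have hpos : 0 < ‖x - y‖ := norm_pos_iff.2 (sub_ne_zero.2 hxy)
          rw [edist_dist, dist_eq_norm, ENNReal.ofReal_rpow_of_pos hpos,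
            ← ENNReal.ofReal_mul hD0.le]
          refine ENNReal.ofReal_le_ofReal ?_
          -- Pointwise, the mean-zero kernel is dominated by a multiple of the energy kernel |x -
          -- y|^{-s}.
          refine (abs_integral_tent_mul_le_rpow (δ := (1 / 2 : ℝ) ^ k) (by positivity)
            (measurable_corr hmg hmg) (abs_corr_bump_le (abs_bump_sub_le k)
              fun u => bump_sub_eq_zero) (corr_eq_zero (fun u => bump_sub_eq_zero)
              fun u => bump_sub_eq_zero) (integral_corr_eq_zero hmg hmg (abs_bump_sub_le k)
              (abs_bump_sub_le k) (fun u => bump_sub_eq_zero) (fun u => bump_sub_eq_zero) ?_)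
            hs0.le hs (sub_ne_zero.2 hxy)).trans_eq ?_
          · simp only [Pi.sub_apply]
            rw [integral_sub (integrable_bump _) (integrable_bump _), integral_bump, integral_bump,
              sub_self]
          · rw [hD, Real.div_rpow (by positivity) hpos.le, Real.rpow_neg hpos.le]
            ring
    _ = ENNReal.ofReal D * ∫⁻ x, ∫⁻ y, edist x y ^ (-s) ∂μ ∂μ := by
        rw [← lintegral_const_mul' _ _ ENNReal.ofReal_ne_top]
        congr with x
        rw [← lintegral_const_mul' _ _ ENNReal.ofReal_ne_top]
    _ ≤ _ := by
        rw [ENNReal.ofReal_mul hD0.le]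
        gcongr

/-- The bound without cancellation decays like |x - y|^{-n}. It is written as a sum over dyadic
balls of radius at least 2^{-k}, precisely the balls on which a discrete Frostman measure is
controlled. -/
theorem abs_integral_tent_mul_corr_le_sum {f : (ι → ℝ) → ℝ} {k : ℕ}
    (hM : ∀ u, |f u| ≤ 2 * ((2 : ℝ) ^ (k + 1)) ^ Fintype.card ι)
    (h0 : ∀ u, (1 / 2 : ℝ) ^ k / 2 < ‖u‖ → f u = 0) {x y : ℝ × (ι → ℝ)} (hxy : dist y x ≤ 1) :
    |∫ a, tent a * corr f f (slopeProj a (x - y))|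
      ≤ ∑ j ∈ Finset.range (k + 1), (Metric.closedBall x ((1 / 2 : ℝ) ^ j)).indicator
        (fun _ => 2 * (4 * 4 ^ Fintype.card ι * (2 ^ k) ^ Fintype.card ι)
          * (32 * (2 ^ j * (1 / 2 : ℝ) ^ k)) ^ Fintype.card ι) y := by
  set n := Fintype.card ι with hn
  set B : ℝ := 4 * 4 ^ n * (2 ^ k) ^ n with hB
  have hB0 : 0 < B := by positivity
  set δ : ℝ := (1 / 2 : ℝ) ^ k with hδ
  have hδ0 : 0 < δ := by positivity
  have hdist : ‖x - y‖ = dist y x := by rw [dist_comm, dist_eq_norm]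
  have hcB : ∀ u, |corr f f u| ≤ B := abs_corr_bump_le hM h0
  have hb1 := abs_integral_tent_mul_le (Ψ := corr f f) hcB (x - y)
  have hb2 : 4 * δ < ‖x - y‖ → |∫ a, tent a * corr f f (slopeProj a (x - y))|
      ≤ 2 * B * (8 * δ / ‖x - y‖) ^ n :=
    abs_integral_tent_mul_le_pow hδ0 hcB (corr_eq_zero h0 h0)
  have hterm : ∀ j ≤ k, dist y x ≤ (1 / 2 : ℝ) ^ j →
      2 * B * (32 * (2 ^ j * δ)) ^ n
      ≤ ∑ j ∈ Finset.range (k + 1), (Metric.closedBall x ((1 / 2 : ℝ) ^ j)).indicator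
        (fun _ => 2 * B * (32 * (2 ^ j * δ)) ^ n) y := by
    intro j hj hjd
    refine le_trans ?_ (Finset.single_le_sum (f := fun j : ℕ =>
      (Metric.closedBall x ((1 / 2 : ℝ) ^ j)).indicator
        (fun _ => 2 * B * (32 * (2 ^ j * δ)) ^ n) y)
      (fun i _ => Set.indicator_nonneg (fun _ _ => by positivity) y)
      (Finset.mem_range.2 (Nat.lt_succ_of_le hj)))
    rw [Set.indicator_of_mem (by simpa using hjd)]
  rcases le_or_gt (dist y x) δ with hd | hd
  · refine hb1.trans (le_trans ?_ (hterm k le_rfl hd))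
    have : (2 : ℝ) ^ k * δ = 1 := by rw [hδ, ← mul_pow]; norm_num
    rw [this, mul_one]
    gcongr
    norm_num
  · obtain ⟨j, hj1, hj2⟩ := exists_nat_pow_near_of_lt_one (hδ0.trans hd) hxy
      (by norm_num : (0 : ℝ) < 1 / 2) (by norm_num)
    have hjk : j ≤ k := by
      by_contra hlt
      push Not at hlt
      have : (1 / 2 : ℝ) ^ j ≤ (1 / 2 : ℝ) ^ k :=
        pow_le_pow_of_le_one (by norm_num) (by norm_num) hlt.le
      linarith
    have hd0 : 0 < dist y x := hδ0.trans hd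
    have h2j : 1 ≤ dist y x * (2 * 2 ^ j) := by
      have : (1 / 2 : ℝ) ^ (j + 1) * (2 * 2 ^ j) = 1 := by
        rw [pow_succ, show (1 / 2 : ℝ) ^ j * (1 / 2) * (2 * 2 ^ j) = (1 / 2 : ℝ) ^ j * 2 ^ j by ring,
          ← mul_pow]
        norm_num
      rw [← this]
      gcongr
    refine le_trans ?_ (hterm j hjk hj2)
    -- The transition range fixes the constant 32: there 1 ≤ 8 · 2^j δ, so the trivial bound 4^n is
    -- at most (32 · 2^j δ)^n. Farther out 16 would do.
    rcases le_or_gt (dist y x) (4 * δ) with h4 | h4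
    · refine hb1.trans ?_
      gcongr
      have h8 : dist y x * (2 * 2 ^ j) ≤ 4 * δ * (2 * 2 ^ j) := by gcongr
      linarith
    · refine (hb2 (hdist ▸ h4)).trans ?_
      gcongr
      rw [hdist, div_le_iff₀ hd0]
      have : δ * 1 ≤ δ * (dist y x * (2 * 2 ^ j)) := by gcongr
      linarith

/-- Energy bound for projections of Frostman measures, on average over directions. -/
theorem integral_projAvg_bump_add_le (k : ℕ) (hν : ∀ᵐ y ∂ν, ‖y‖ ≤ R) {t : ℝ}
    (ht : t ≤ Fintype.card ι) (hdiam : ∀ᵐ x ∂ν, ∀ᵐ y ∂ν, dist y x ≤ 1)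
    (hfrost : ∀ᵐ x ∂ν, ∀ j ≤ k,
      ν (Metric.closedBall x ((1 / 2 : ℝ) ^ j)) ≤ ENNReal.ofReal (((1 / 2 : ℝ) ^ j) ^ t)) :
    ∫ q, tent q.1 * projAvg (bump ι (k + 1) + bump ι k) ν q ^ 2 ∂(boxMeasure ι R)
      ≤ 2 * (4 * 4 ^ Fintype.card ι) * 32 ^ Fintype.card ι * (k + 1)
        * ((1 / 2 : ℝ) ^ k) ^ (t - Fintype.card ι) * ν.real Set.univ := by
  set n := Fintype.card ι with hn
  have hmf : Measurable (bump ι (k + 1) + bump ι k) := (measurable_bump _).add (measurable_bump _)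
  rw [integral_boxMeasure_tent_mul_sq hmf (abs_bump_add_le k)
    (fun u hu => bump_add_eq_zero (half_pow_div_two_lt hu)) hν, half_pow_rpow_sub]
  refine integral_prod_le_of_lintegral_le (measurable_integral_tent_mul_corr hmf)
    (by positivity) ?_
  set B : ℝ := 4 * 4 ^ n * (2 ^ k) ^ n with hB
  set δ : ℝ := (1 / 2 : ℝ) ^ k with hδ
  have hδ0 : 0 < δ := by positivity
  have hinner : ∀ᵐ x ∂ν, ∫⁻ y, ENNReal.ofReal
      |∫ a, tent a * corr (bump ι (k + 1) + bump ι k) (bump ι (k + 1) + bump ι k)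
        (slopeProj a (x - y))| ∂ν ≤ ENNReal.ofReal (2 * B * 32 ^ n * (k + 1) * δ ^ t) := by
    filter_upwards [hdiam, hfrost] with x hx hfx
    calc _ ≤ ∫⁻ y, ∑ j ∈ Finset.range (k + 1), (Metric.closedBall x ((1 / 2 : ℝ) ^ j)).indicator
          (fun _ => ENNReal.ofReal (2 * B * (32 * (2 ^ j * δ)) ^ n)) y ∂ν := by
          refine lintegral_mono_ae ?_
          filter_upwards [hx] with y hy
          refine (ENNReal.ofReal_le_ofReal (abs_integral_tent_mul_corr_le_sum (abs_bump_add_le k)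
            (fun u => bump_add_eq_zero) hy)).trans_eq ?_
          rw [ENNReal.ofReal_sum_of_nonneg fun j _ =>
            Set.indicator_nonneg (fun _ _ => by positivity) y]
          refine Finset.sum_congr rfl fun j _ => ?_
          by_cases hj : y ∈ Metric.closedBall x ((1 / 2 : ℝ) ^ j)
          · rw [Set.indicator_of_mem hj, Set.indicator_of_mem hj]
          · rw [Set.indicator_of_notMem hj, Set.indicator_of_notMem hj, ENNReal.ofReal_zero]
      _ = ∑ j ∈ Finset.range (k + 1), ENNReal.ofReal (2 * B * (32 * (2 ^ j * δ)) ^ n)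
            * ν (Metric.closedBall x ((1 / 2 : ℝ) ^ j)) := by
          rw [lintegral_finsetSum _ fun j _ =>
            measurable_const.indicator Metric.isClosed_closedBall.measurableSet]
          refine Finset.sum_congr rfl fun j _ => ?_
          rw [lintegral_indicator_const Metric.isClosed_closedBall.measurableSet]
      _ ≤ ∑ j ∈ Finset.range (k + 1), ENNReal.ofReal (2 * B * 32 ^ n * δ ^ t) := by
          refine Finset.sum_le_sum fun j hj => ?_
          have hjk : j ≤ k := Nat.lt_succ_iff.1 (Finset.mem_range.1 hj)
          refine (mul_le_mul_right (hfx j hjk) _).trans ?_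
          rw [← ENNReal.ofReal_mul (by positivity)]
          refine ENNReal.ofReal_le_ofReal ?_
          -- Since t ≤ n and 2^j δ ≤ 1, every scale contributes at most a multiple of δ^t. Summing
          -- the k + 1 scales costs only a factor linear in k.
          have h1 : (2 ^ j * δ) ^ n * ((1 / 2 : ℝ) ^ j) ^ t ≤ δ ^ t := by
            have h2 : ((1 / 2 : ℝ) ^ j) ^ t = ((2 : ℝ) ^ j) ^ (-t) := by
              rw [Real.rpow_neg (by positivity), ← Real.inv_rpow (by positivity), ← inv_pow]
              norm_num
            have h3 : (0 : ℝ) < 2 ^ j := by positivity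
            have h4 : (2 : ℝ) ^ j * δ ≤ 1 := by
              have : (2 : ℝ) ^ k * δ = 1 := by rw [hδ, ← mul_pow]; norm_num
              rw [← this]
              gcongr
              norm_num
            have h5 : (2 ^ j * δ) ^ n ≤ (2 ^ j * δ) ^ t := by
              rw [← Real.rpow_natCast]
              exact Real.rpow_le_rpow_of_exponent_ge (by positivity) h4 ht
            calc _ ≤ (2 ^ j * δ) ^ t * ((1 / 2 : ℝ) ^ j) ^ t := by gcongr
              _ = δ ^ t := by
                rw [h2, Real.mul_rpow h3.le hδ0.le, mul_right_comm, ← Real.rpow_add h3]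
                simp
          calc 2 * B * (32 * (2 ^ j * δ)) ^ n * ((1 / 2 : ℝ) ^ j) ^ t
              = 2 * B * 32 ^ n * ((2 ^ j * δ) ^ n * ((1 / 2 : ℝ) ^ j) ^ t) := by
                rw [mul_pow]; ring
            _ ≤ _ := by gcongr
      _ = _ := by
          rw [Finset.sum_const, Finset.card_range, nsmul_eq_mul,
            ← ENNReal.ofReal_natCast, ← ENNReal.ofReal_mul (by positivity)]
          congr 1
          push_cast
          ring
  calc _ ≤ ∫⁻ _, ENNReal.ofReal (2 * B * 32 ^ n * (k + 1) * δ ^ t) ∂ν := lintegral_mono_ae hinner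
    _ = ENNReal.ofReal (2 * B * 32 ^ n * (k + 1) * δ ^ t) * ENNReal.ofReal (ν.real Set.univ) := by
        rw [lintegral_const, ofReal_measureReal]
    _ = _ := by
        rw [← ENNReal.ofReal_mul (by positivity), hB]
        congr 1
        ring

/-- The set where the oscillation at scale `2^{-k}` is large carries little Frostman mass. -/
theorem measure_le_of_le_coneOscillation (k : ℕ) (hμ : ∀ᵐ y ∂μ, ‖y‖ ≤ R) (hν : ∀ᵐ y ∂ν, ‖y‖ ≤ R)
    {s t : ℝ} (hs0 : 0 < s) (hs : s ≤ Fintype.card ι + 1) (ht : t ≤ Fintype.card ι) {E : ℝ}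
    (hE0 : 0 ≤ E) (hE : ∫⁻ x, ∫⁻ y, edist x y ^ (-s) ∂μ ∂μ ≤ ENNReal.ofReal E)
    (hdiam : ∀ᵐ x ∂ν, ∀ᵐ y ∂ν, dist y x ≤ 1)
    (hfrost : ∀ᵐ x ∂ν, ∀ j ≤ k,
      ν (Metric.closedBall x ((1 / 2 : ℝ) ^ j)) ≤ ENNReal.ofReal (((1 / 2 : ℝ) ^ j) ^ t))
    {τ : ℝ} (hτ : 0 < τ) (hosc : ∀ᵐ x ∂ν, τ ≤ coneOscillation μ k x)
    (hint : Integrable (coneOscillation μ k) ν) :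
    ν.real Set.univ ≤ 2 * (4 * 4 ^ Fintype.card ι) * 4 ^ Fintype.card ι * 4 ^ s * E
      * (2 * (4 * 4 ^ Fintype.card ι) * 32 ^ Fintype.card ι) * (k + 1)
      * ((1 / 2 : ℝ) ^ k) ^ (s + t - 2 * Fintype.card ι) / τ ^ 2 := by
  set n := Fintype.card ι with hn
  set C₁ : ℝ := 2 * (4 * 4 ^ n) * 4 ^ n * 4 ^ s * E with hC₁
  set C₂ : ℝ := 2 * (4 * 4 ^ n) * 32 ^ n with hC₂
  set δ : ℝ := (1 / 2 : ℝ) ^ k with hδ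
  have hδ0 : 0 < δ := by positivity
  set m := ν.real Set.univ with hm
  have hX := integral_projAvg_bump_sub_le k hμ hs0 hs hE0 hE
  have hY := integral_projAvg_bump_add_le k hν ht hdiam hfrost
  rw [← hn, ← hδ, ← hC₁] at hX
  rw [← hn, ← hδ, ← hC₂, ← hm] at hY
  set P : ℝ := C₂ * (k + 1) * δ ^ (t - n) with hP
  have hP0 : 0 < P := by positivity
  -- This weight bounds the ν-term by exactly τ m, and the overall factor 1/2 then lets the left
  -- side absorb it.
  have hmain := integral_coneOscillation_le (μ := μ) k hν (c := P / τ) (by positivity)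
  have hlow : τ * m ≤ ∫ x, coneOscillation μ k x ∂ν := by
    have := integral_mono_ae (integrable_const τ) hint hosc
    rwa [integral_const, smul_eq_mul, mul_comm] at this
  have h1 : τ * m ≤ (P / τ * (C₁ * δ ^ (s - n)) + (P / τ)⁻¹ * (P * m)) / 2 := by
    refine (hlow.trans hmain).trans ?_
    gcongr
  have h2 : (P / τ)⁻¹ * (P * m) = τ * m := by
    field_simp
  have h3 : τ * m ≤ P / τ * (C₁ * δ ^ (s - n)) := by linarith
  rw [le_div_iff₀ (by positivity)]
  calc m * τ ^ 2 = τ * (τ * m) := by ring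
    _ ≤ τ * (P / τ * (C₁ * δ ^ (s - n))) := by gcongr
    _ = P * (C₁ * δ ^ (s - n)) := by field_simp
    _ = C₁ * C₂ * (k + 1) * (δ ^ (t - n) * δ ^ (s - n)) := by rw [hP]; ring
    _ = _ := by
      rw [← Real.rpow_add hδ0]
      congr 2
      ring

end Scales

/-! ### Divergence of the oscillations is rare, and convergence gives absolute continuity in slopes.
-/

section ExceptionalSet

variable {ι : Type*} [Fintype ι] {μ : Measure (ℝ × (ι → ℝ))}

theorem corr_bump_nonneg (k : ℕ) (u : ι → ℝ) : 0 ≤ corr (bump ι k) (bump ι k) u :=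
  integral_nonneg fun _ => mul_nonneg (bump_nonneg _ _) (bump_nonneg _ _)

theorem coneDensity_nonneg (k : ℕ) (x : ℝ × (ι → ℝ)) (a : ι → ℝ) : 0 ≤ coneDensity μ k x a :=
  integral_nonneg fun _ => corr_bump_nonneg _ _

theorem coneOscillation_nonneg (k : ℕ) (x : ℝ × (ι → ℝ)) : 0 ≤ coneOscillation μ k x :=
  integral_nonneg fun a => mul_nonneg (tent_nonneg a) (abs_nonneg _)

/-- The maximal function of the smoothed densities along scales. -/
noncomputable def coneMajorant (μ : Measure (ℝ × (ι → ℝ))) (x : ℝ × (ι → ℝ)) (a : ι → ℝ) : ℝ≥0∞ :=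
  ENNReal.ofReal (tent a * coneDensity μ 0 x a)
    + ∑' k, ENNReal.ofReal (tent a * |coneDensity μ (k + 1) x a - coneDensity μ k x a|)

theorem ofReal_tent_mul_coneDensity_le (k : ℕ) (x : ℝ × (ι → ℝ)) (a : ι → ℝ) :
    ENNReal.ofReal (tent a * coneDensity μ k x a) ≤ coneMajorant μ x a := by
  have h : ENNReal.ofReal (tent a * coneDensity μ k x a)
      ≤ ENNReal.ofReal (tent a * coneDensity μ 0 x a) + ∑ j ∈ Finset.range k,
        ENNReal.ofReal (tent a * |coneDensity μ (j + 1) x a - coneDensity μ j x a|) := by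
    induction k with
    | zero => simp
    | succ k ih =>
      rw [Finset.sum_range_succ, ← add_assoc]
      refine le_trans ?_ (add_le_add_left ih _)
      rw [← ENNReal.ofReal_add (mul_nonneg (tent_nonneg a) (coneDensity_nonneg _ _ _))
        (mul_nonneg (tent_nonneg a) (abs_nonneg _)), ← mul_add]
      refine ENNReal.ofReal_le_ofReal (mul_le_mul_of_nonneg_left ?_ (tent_nonneg a))
      linarith [le_abs_self (coneDensity μ (k + 1) x a - coneDensity μ k x a)]
  exact h.trans (add_le_add_right (ENNReal.sum_le_tsum _) _)

variable [IsFiniteMeasure μ]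

/-- Where the series diverges, the oscillation exceeds 2^{-kε} for infinitely many k. Each such
superlevel set carries a discrete Frostman measure of small mass, hence has a covering of small
t-content, and these contents are summable. -/
theorem hausdorffMeasure_setOf_not_summable_coneOscillation [Nonempty ι]
    {R : ℝ} (hμ : ∀ᵐ y ∂μ, ‖y‖ ≤ R) {s t : ℝ}
    (hs0 : 0 < s) (hs : s ≤ Fintype.card ι + 1) (ht0 : 0 < t) (ht : t ≤ Fintype.card ι)
    (hst : 2 * (Fintype.card ι : ℝ) < s + t) (hE : ∫⁻ x, ∫⁻ y, edist x y ^ (-s) ∂μ ∂μ ≠ ∞) :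
    μH[t] {x : ℝ × (ι → ℝ) | ¬ Summable fun k => coneOscillation μ k x} = 0 := by
  set n := Fintype.card ι with hn
  -- The mass estimate gains 2^{-4kε}. The threshold 2^{-kε} costs its inverse square 2^{2kε}, so
  -- 2^{-2kε} is left to beat the factor k + 1.
  set ε : ℝ := (s + t - 2 * n) / 4 with hε
  have hε0 : 0 < ε := by rw [hε]; linarith
  set Bad := {x : ℝ × (ι → ℝ) | ¬ Summable fun k => coneOscillation μ k x} with hBad
  -- Balls of radius 1/2 give total boundedness and keep all mutual distances at most 1, as the
  -- dyadic kernel bound requires.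
  have hcover : Bad ⊆ ⋃ i : ℕ, Bad ∩ Metric.closedBall
      (TopologicalSpace.denseSeq (ℝ × (ι → ℝ)) i) (1 / 2) := by
    intro x hx
    obtain ⟨i, hi⟩ := (TopologicalSpace.denseRange_denseSeq (ℝ × (ι → ℝ))).exists_dist_lt x
      (by norm_num : (0 : ℝ) < 1 / 2)
    exact Set.mem_iUnion.2 ⟨i, hx, hi.le⟩
  refine measure_mono_null hcover (measure_iUnion_null fun i => ?_)
  set c := TopologicalSpace.denseSeq (ℝ × (ι → ℝ)) i
  set A : ℕ → Set (ℝ × (ι → ℝ)) := fun k =>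
    {x | x ∈ Metric.closedBall c (1 / 2) ∧ ((1 / 2 : ℝ) ^ k) ^ ε < coneOscillation μ k x} with hA
  have hgeom : ∀ r : ℝ, 0 < r → ∃ q : ℝ, 0 ≤ q ∧ q < 1 ∧ ∀ k : ℕ, ((1 / 2 : ℝ) ^ k) ^ r = q ^ k := by
    intro r hr
    refine ⟨(1 / 2 : ℝ) ^ r, by positivity, Real.rpow_lt_one (by norm_num) (by norm_num) hr,
      fun k => ?_⟩
    rw [← Real.rpow_natCast, ← Real.rpow_natCast, ← Real.rpow_mul (by norm_num),
      ← Real.rpow_mul (by norm_num), mul_comm]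
  have hSA : ∀ m, Bad ∩ Metric.closedBall c (1 / 2) ⊆ ⋃ k, A (k + m) := by
    rintro m x ⟨hx, hxc⟩
    by_contra hcon
    simp only [Set.mem_iUnion, not_exists] at hcon
    refine hx ((summable_nat_add_iff m).1 ?_)
    obtain ⟨q, hq0, hq1, hq⟩ := hgeom ε hε0
    have hsum : Summable fun k : ℕ => q ^ (k + m) :=
      (summable_nat_add_iff m).2 (summable_geometric_of_lt_one hq0 hq1)
    refine Summable.of_nonneg_of_le (fun k => coneOscillation_nonneg _ _) (fun k => ?_) hsum
    rw [← hq]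
    by_contra hlt
    exact hcon k ⟨hxc, not_le.1 hlt⟩
  have htb : ∀ k, TotallyBounded (A k) := fun k =>
    (isCompact_closedBall c (1 / 2)).totallyBounded.subset fun x hx => hx.1
  choose F ν u hνfin hFA hνF hfrost hcov hsum using fun k => exists_discrete_frostman_measure
    (htb k) t k
  refine hausdorffMeasure_limsup_eq_zero ht0 hSA u hcov ?_
  set E : ℝ := (∫⁻ x, ∫⁻ y, edist x y ^ (-s) ∂μ ∂μ).toReal
  set C : ℝ := 2 * (4 * 4 ^ n) * 4 ^ n * 4 ^ s * E * (2 * (4 * 4 ^ n) * 32 ^ n) with hC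
  have hC0 : 0 ≤ C := by positivity
  obtain ⟨q, hq0, hq1, hq⟩ := hgeom (2 * ε) (by positivity)
  have hbound : ∀ k, ν k Set.univ ≤ ENNReal.ofReal (C * ((k + 1) * q ^ k)) := by
    intro k
    have hFae : ∀ᵐ x ∂(ν k), x ∈ F k := by
      rw [ae_iff]
      exact hνF k
    have hball : ∀ x ∈ F k, dist x c ≤ 1 / 2 := fun x hx => (hFA k hx).1
    set R' := max R (‖c‖ + 1)
    -- The measure lives on a finite set, so neither the oscillation nor its superlevel sets need
    -- any measurability.
    have hint : Integrable (coneOscillation μ k) (ν k) := by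
      have h1 : IntegrableOn (coneOscillation μ k) (F k : Set (ℝ × (ι → ℝ))) (ν k) :=
        IntegrableOn.finset
      rwa [IntegrableOn, Measure.restrict_eq_self_of_ae_mem (by simpa using hFae)] at h1
    have hτ : 0 < ((1 / 2 : ℝ) ^ k) ^ ε := by positivity
    have := measure_le_of_le_coneOscillation (μ := μ) (ν := ν k) (R := R') k
      (hμ.mono fun y hy => hy.trans (le_max_left _ _))
      (hFae.mono fun y hy => ?_) hs0 hs ht (ENNReal.toReal_nonneg)
      (ENNReal.ofReal_toReal hE).ge ?_
      (hFae.mono fun x hx j hj => hfrost k x hx j hj) hτ (hFae.mono fun x hx => (hFA k hx).2.le) hint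
    · rw [← ofReal_measureReal (μ := ν k)]
      refine ENNReal.ofReal_le_ofReal (this.trans_eq ?_)
      rw [← hn, ← hC, ← hq, ← Real.rpow_natCast _ 2, ← Real.rpow_mul (by positivity), mul_assoc,
        mul_div_assoc, mul_div_assoc, ← Real.rpow_sub (by positivity)]
      congr 3
      rw [hε]
      push_cast
      ring
    · have h1 := hball y hy
      have h2 : ‖y‖ ≤ ‖c‖ + ‖y - c‖ := norm_le_norm_add_norm_sub' y c
      rw [← dist_eq_norm] at h2
      exact (by linarith : ‖y‖ ≤ ‖c‖ + 1).trans (le_max_right _ _)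
    · filter_upwards [hFae] with x hx
      filter_upwards [hFae] with y hy
      linarith [dist_triangle_right y x c, hball x hx, hball y hy]
  refine ne_top_of_le_ne_top ?_ (ENNReal.tsum_le_tsum fun k => (hsum k).trans (hbound k))
  have hsummable : Summable fun k : ℕ => C * ((k + 1) * q ^ k) := by
    refine Summable.mul_left C ?_
    have h1 := summable_pow_mul_geometric_of_norm_lt_one 1
      (show ‖q‖ < 1 by rwa [Real.norm_of_nonneg hq0])
    have h2 := summable_geometric_of_lt_one hq0 hq1
    refine (h1.add h2).congr fun k => ?_
    ring
  exact hsummable.tsum_ofReal_ne_top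

theorem measurable_corr_bump (k : ℕ) : Measurable (corr (bump ι k) (bump ι k)) :=
  measurable_corr (measurable_bump k) (measurable_bump k)

theorem exists_corr_bump_le (k : ℕ) : ∃ B : ℝ, ∀ u, |corr (bump ι k) (bump ι k) u| ≤ B :=
  ⟨_, abs_corr_le (δ := (1 / 2 : ℝ) ^ k) (by positivity)
    (fun u => by rw [abs_of_nonneg (bump_nonneg k u)]; exact bump_le k u)
    (fun u => by rw [abs_of_nonneg (bump_nonneg k u)]; exact bump_le k u) fun _ => bump_eq_zero⟩

/-- Both bumps have full height on a cube of side 2^{-k}/2, and height squared times volume is the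
bound. -/
theorem le_corr_bump {k : ℕ} {u : ι → ℝ} (hu : ‖u‖ ≤ (1 / 2 : ℝ) ^ k / 4) :
    ((2 : ℝ) ^ k / 2) ^ Fintype.card ι ≤ corr (bump ι k) (bump ι k) u := by
  set n := Fintype.card ι with hn
  have h2 : (2 : ℝ) ^ k * (1 / 2 : ℝ) ^ k = 1 := by rw [← mul_pow]; norm_num
  have h1 : ((2 : ℝ) ^ k / 2) ^ n = ∫ v in Metric.closedBall (0 : ι → ℝ) ((1 / 2 : ℝ) ^ k / 4),
      bump ι k v * bump ι k (v + u) := by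
    rw [setIntegral_congr_fun (g := fun _ => ((2 : ℝ) ^ k) ^ n * (2 ^ k) ^ n)
      Metric.isClosed_closedBall.measurableSet, setIntegral_const,
      volume_real_closedBall _ (by positivity), smul_eq_mul, ← mul_pow, ← hn, ← mul_pow]
    · congr 1
      linear_combination (-(2 : ℝ) ^ k / 2) * h2
    · intro v hv
      have hv' : ‖v‖ ≤ (1 / 2 : ℝ) ^ k / 4 := by simpa using hv
      have : (0 : ℝ) < (1 / 2) ^ k := by positivity
      simp only
      rw [bump_of_norm_le (by linarith), bump_of_norm_le (by linarith [norm_add_le v u])]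
  rw [h1, corr]
  refine setIntegral_le_integral ?_ (Filter.Eventually.of_forall fun v =>
    mul_nonneg (bump_nonneg _ _) (bump_nonneg _ _))
  refine integrable_of_bounded_support (A := Metric.closedBall 0 ((1 / 2 : ℝ) ^ k / 2))
    ((measurable_bump k).mul ((measurable_bump k).comp (by fun_prop)))
    measure_closedBall_lt_top.ne (M := ((2 : ℝ) ^ k) ^ n * (2 ^ k) ^ n) (fun v => ?_) fun v hv => ?_
  · rw [abs_of_nonneg (mul_nonneg (bump_nonneg _ _) (bump_nonneg _ _))]
    exact mul_le_mul (bump_le _ _) (bump_le _ _) (bump_nonneg _ _) (by positivity)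
  · rw [bump_eq_zero (by simpa using hv), zero_mul]

theorem measurable_coneDensity (k : ℕ) (x : ℝ × (ι → ℝ)) : Measurable (coneDensity μ k x) := by
  have : Measurable fun p : (ι → ℝ) × (ℝ × (ι → ℝ)) =>
      corr (bump ι k) (bump ι k) (slopeProj p.1 (x - p.2)) :=
    (measurable_corr_bump k).comp (by fun_prop)
  exact this.stronglyMeasurable.integral_prod_right.measurable

theorem exists_coneDensity_le (k : ℕ) (x : ℝ × (ι → ℝ)) :
    ∃ B : ℝ, ∀ a, |coneDensity μ k x a| ≤ B := by
  obtain ⟨B, hB⟩ := exists_corr_bump_le (ι := ι) k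
  exact ⟨B * μ.real Set.univ, fun a => norm_integral_le_of_norm_le_const
    (f := fun y => corr (bump ι k) (bump ι k) (slopeProj a (x - y)))
    (Filter.Eventually.of_forall fun _ => hB _)⟩

theorem integrable_tent_mul {f : (ι → ℝ) → ℝ} (hf : Measurable f) {B : ℝ} (hB : ∀ a, |f a| ≤ B) :
    Integrable fun a => tent a * f a := by
  refine integrable_of_bounded_support (A := Metric.closedBall 0 2) (M := 2 * B) (by fun_prop)
    measure_closedBall_lt_top.ne (fun a => ?_) fun a ha => ?_
  · rw [abs_mul]
    exact mul_le_mul (abs_tent_le_two a) (hB a) (abs_nonneg _) (by norm_num)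
  · rw [tent_eq_zero (by simpa using (not_le.1 (by simpa using ha)).le), zero_mul]

theorem lintegral_coneMajorant_ne_top {x : ℝ × (ι → ℝ)}
    (hx : Summable fun k => coneOscillation μ k x) : ∫⁻ a, coneMajorant μ x a ≠ ∞ := by
  have hm := fun k => measurable_coneDensity (μ := μ) k x
  have hmt : Measurable (tent : (ι → ℝ) → ℝ) := measurable_tent
  unfold coneMajorant
  rw [lintegral_add_left (by have := hm 0; fun_prop), lintegral_tsum fun k => by
    have := hm k; have := hm (k + 1); fun_prop]
  refine ENNReal.add_ne_top.2 ⟨?_, ?_⟩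
  · obtain ⟨B, hB⟩ := exists_coneDensity_le (μ := μ) 0 x
    exact (integrable_tent_mul (hm 0) hB).lintegral_lt_top.ne
  · have heq : ∀ k, ∫⁻ a, ENNReal.ofReal (tent a * |coneDensity μ (k + 1) x a
        - coneDensity μ k x a|) = ENNReal.ofReal (coneOscillation μ k x) := by
      intro k
      obtain ⟨B, hB⟩ := exists_coneDensity_le (μ := μ) k x
      obtain ⟨B', hB'⟩ := exists_coneDensity_le (μ := μ) (k + 1) x
      rw [coneOscillation, ofReal_integral_eq_lintegral_ofReal]
      · refine integrable_tent_mul (B := B' + B) (by have := hm k; have := hm (k + 1); fun_prop)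
          fun a => ?_
        rw [abs_abs]
        exact (abs_sub _ _).trans (add_le_add (hB' a) (hB a))
      · exact Filter.Eventually.of_forall fun a => mul_nonneg (tent_nonneg a) (abs_nonneg _)
    simp only [heq]
    exact hx.tsum_ofReal_ne_top

/-- The slope of the line through `x` and `y`. -/
noncomputable def slopeOf (x y : ℝ × (ι → ℝ)) : ι → ℝ := (x - y).1⁻¹ • (x - y).2

theorem measurable_slopeOf (x : ℝ × (ι → ℝ)) : Measurable (slopeOf x) := by
  unfold slopeOf; fun_prop

/-- As a function of the slope, the kernel of a single point y concentrates at the slope of the line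
xy. It has height at least (2^k/2)^n on a ball of radius ρ = 2^{-k}/(4|z.1|). The product of height
and volume is (4|z.1|)^{-n}, independent of k. -/
theorem le_liminf_lintegral_corr_bump {x y : ℝ × (ι → ℝ)} (hxy : (x - y).1 ≠ 0) {U : Set (ι → ℝ)}
    (hU : IsOpen U) (hyU : slopeOf x y ∈ U) (hy1 : ‖slopeOf x y‖ ≤ 1) :
    ENNReal.ofReal (1 / 2 * (4 * |(x - y).1|)⁻¹ ^ Fintype.card ι) ≤ Filter.liminf (fun k : ℕ =>
      ∫⁻ a in U, ENNReal.ofReal (tent a * corr (bump ι k) (bump ι k) (slopeProj a (x - y))))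
      Filter.atTop := by
  set n := Fintype.card ι with hn
  set z := x - y with hz
  set a₀ := slopeOf x y with ha₀
  have hz1 : 0 < |z.1| := abs_pos.2 hxy
  obtain ⟨r, hr, hrU⟩ := Metric.isOpen_iff.1 hU a₀ hyU
  have hlim : Filter.Tendsto (fun k : ℕ => (1 / 2 : ℝ) ^ k / (4 * |z.1|)) Filter.atTop (nhds 0) := by
    have := (tendsto_pow_atTop_nhds_zero_of_lt_one (by norm_num : (0 : ℝ) ≤ 1 / 2)
      (by norm_num)).div_const (4 * |z.1|)
    rwa [zero_div] at this
  refine Filter.le_liminf_of_le (by isBoundedDefault) ?_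
  filter_upwards [hlim.eventually_lt_const (lt_min hr (by norm_num : (0 : ℝ) < 1 / 2))] with k hk
  set ρ : ℝ := (1 / 2 : ℝ) ^ k / (4 * |z.1|) with hρ
  have hρ0 : 0 < ρ := by positivity
  have hsub : Metric.closedBall a₀ ρ ⊆ U :=
    (Metric.closedBall_subset_ball (hk.trans_le (min_le_left _ _))).trans hrU
  have h2 : (2 : ℝ) ^ k * (1 / 2 : ℝ) ^ k = 1 := by rw [← mul_pow]; norm_num
  calc ENNReal.ofReal (1 / 2 * (4 * |z.1|)⁻¹ ^ n)
      = ENNReal.ofReal (1 / 2 * ((2 : ℝ) ^ k / 2) ^ n) * volume (Metric.closedBall a₀ ρ) := by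
        rw [Real.volume_pi_closedBall _ hρ0.le, ← ENNReal.ofReal_mul (by positivity), mul_assoc,
          ← hn, ← mul_pow]
        congr 3
        rw [hρ]
        field_simp
        linear_combination -h2
    _ = ∫⁻ a in Metric.closedBall a₀ ρ, ENNReal.ofReal (1 / 2 * ((2 : ℝ) ^ k / 2) ^ n) := by
        rw [setLIntegral_const]
    _ ≤ ∫⁻ a in Metric.closedBall a₀ ρ,
          ENNReal.ofReal (tent a * corr (bump ι k) (bump ι k) (slopeProj a z)) := by
        refine setLIntegral_mono' Metric.isClosed_closedBall.measurableSet fun a ha => ?_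
        have ha' : ‖a - a₀‖ ≤ ρ := by simpa [dist_eq_norm] using ha
        refine ENNReal.ofReal_le_ofReal (mul_le_mul ?_ (le_corr_bump ?_) (by positivity)
          (tent_nonneg a))
        -- A slope within 1/2 of one of norm at most 1 has norm at most 3/2, so the cutoff is at
        -- least 1/2.
        · refine le_max_of_le_right ?_
          have h3 : ‖a‖ ≤ ‖a₀‖ + ‖a - a₀‖ := norm_le_norm_add_norm_sub' a a₀
          have h4 := hk.trans_le (min_le_right _ _)
          linarith
        · have : slopeProj a z = z.1 • (a₀ - a) := by
            rw [slopeProj, smul_sub, ha₀, slopeOf, smul_inv_smul₀ hxy]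
          rw [this, norm_smul, norm_sub_rev, Real.norm_eq_abs]
          calc |z.1| * ‖a - a₀‖ ≤ |z.1| * ρ := by gcongr
            _ = _ := by rw [hρ]; field_simp
    _ ≤ _ := lintegral_mono_set hsub

/-- For open sets of slopes, Fatou bounds the mass of the cone, with a positive weight, by the
integral of the majorant. Finiteness of that integral lets open sets shrink to a null set, and
positivity of the weight removes it at the end. -/
theorem measure_slopeOf_mem_eq_zero {x : ℝ × (ι → ℝ)}
    (hx : Summable fun k => coneOscillation μ k x) {N : Set (ι → ℝ)} (hN : volume N = 0) :
    μ {y | (x - y).1 ≠ 0 ∧ ‖slopeOf x y‖ ≤ 1 ∧ slopeOf x y ∈ N} = 0 := by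
  set n := Fintype.card ι with hn
  set c : ℝ × (ι → ℝ) → ℝ≥0∞ := fun y => ENNReal.ofReal (1 / 2 * (4 * |(x - y).1|)⁻¹ ^ n) with hc
  have hcm : Measurable c := by fun_prop
  set T : Set (ι → ℝ) → Set (ℝ × (ι → ℝ)) :=
    fun U => {y | (x - y).1 ≠ 0 ∧ ‖slopeOf x y‖ ≤ 1 ∧ slopeOf x y ∈ U} with hT
  have hTm : ∀ U, MeasurableSet U → MeasurableSet (T U) := by
    intro U hU
    have h1 : MeasurableSet {y : ℝ × (ι → ℝ) | (x - y).1 ≠ 0} :=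
      (measurableSet_singleton (0 : ℝ)).compl.preimage (by fun_prop)
    have h2 : MeasurableSet {y : ℝ × (ι → ℝ) | ‖slopeOf x y‖ ≤ 1} :=
      measurableSet_le (measurable_slopeOf x).norm measurable_const
    exact h1.inter (h2.inter (hU.preimage (measurable_slopeOf x)))
  have hopen : ∀ U, IsOpen U → ∫⁻ y in T U, c y ∂μ ≤ ∫⁻ a in U, coneMajorant μ x a := by
    intro U hU
    have hjoint : ∀ k : ℕ, Measurable fun p : (ℝ × (ι → ℝ)) × (ι → ℝ) =>
        ENNReal.ofReal (tent p.2 * corr (bump ι k) (bump ι k) (slopeProj p.2 (x - p.1))) := by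
      intro k
      have := measurable_corr_bump (ι := ι) k
      fun_prop
    calc ∫⁻ y in T U, c y ∂μ
        ≤ ∫⁻ y in T U, Filter.liminf (fun k : ℕ => ∫⁻ a in U, ENNReal.ofReal
            (tent a * corr (bump ι k) (bump ι k) (slopeProj a (x - y)))) Filter.atTop ∂μ :=
          setLIntegral_mono' (hTm U hU.measurableSet) fun y hy =>
            le_liminf_lintegral_corr_bump hy.1 hU hy.2.2 hy.2.1
      _ ≤ ∫⁻ y, Filter.liminf (fun k : ℕ => ∫⁻ a in U, ENNReal.ofReal
            (tent a * corr (bump ι k) (bump ι k) (slopeProj a (x - y)))) Filter.atTop ∂μ :=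
          setLIntegral_le_lintegral _ _
      _ ≤ Filter.liminf (fun k : ℕ => ∫⁻ y, (∫⁻ a in U, ENNReal.ofReal
            (tent a * corr (bump ι k) (bump ι k) (slopeProj a (x - y)))) ∂μ) Filter.atTop :=
          lintegral_liminf_le fun k => (hjoint k).lintegral_prod_right'
      _ ≤ ∫⁻ a in U, coneMajorant μ x a := by
          -- After swapping the integrals, each single scale is already below the majorant.
          refine Filter.liminf_le_of_le (by isBoundedDefault) fun b hb => ?_
          obtain ⟨k, hk⟩ := hb.exists
          refine hk.trans ?_
          rw [lintegral_lintegral_swap (hjoint k).aemeasurable]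
          refine lintegral_mono fun a => ?_
          refine le_of_eq_of_le ?_ (ofReal_tent_mul_coneDensity_le k x a)
          obtain ⟨B, hB⟩ := exists_corr_bump_le (ι := ι) k
          rw [coneDensity, ← integral_const_mul, ofReal_integral_eq_lintegral_ofReal]
          · refine (integrable_of_abs_le (M := B) ?_ fun y => hB _).const_mul _
            exact (measurable_corr_bump k).comp (by fun_prop)
          · exact Filter.Eventually.of_forall fun y =>
              mul_nonneg (tent_nonneg a) (corr_bump_nonneg _ _)
  have hzero : ∫⁻ y in T N, c y ∂μ = 0 := by
    have := isFiniteMeasure_withDensity (μ := (volume : Measure (ι → ℝ)))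
      (lintegral_coneMajorant_ne_top hx)
    have hN' : (volume.withDensity (coneMajorant μ x)) N = 0 :=
      withDensity_absolutelyContinuous _ _ hN
    refine nonpos_iff_eq_zero.1 (le_of_forall_gt fun ε hε => ?_)
    -- Outer regularity of the finite measure with density the majorant. It does not ask for `N` to
    -- be measurable.
    obtain ⟨U, hNU, hU, hUε⟩ := N.exists_isOpen_lt_of_lt ε (hN'.trans_lt hε)
    rw [withDensity_apply _ hU.measurableSet] at hUε
    refine lt_of_le_of_lt ?_ ((hopen U hU).trans_lt hUε)
    exact lintegral_mono_set fun y hy => ⟨hy.1, hy.2.1, hNU hy.2.2⟩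
  rw [lintegral_eq_zero_iff hcm, Filter.EventuallyEq, ae_iff,
    Measure.restrict_apply (by
      simp only [Pi.zero_apply]
      exact (measurableSet_singleton (0 : ℝ≥0∞)).compl.preimage hcm)] at hzero
  refine measure_mono_null (fun y hy => Set.mem_inter ?_ hy) hzero
  have h1 : 0 < |(x - y).1| := abs_pos.2 hy.1
  have h2 : 0 < 1 / 2 * (4 * |(x - y).1|)⁻¹ ^ n := by positivity
  rw [Set.mem_ofPred_eq, Pi.zero_apply]
  exact (ENNReal.ofReal_pos.2 h2).ne'

end ExceptionalSet

/-! ### From slope charts to the sphere, and the dimension bound. -/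

section UpperBound

variable {d : ℕ}

/-- Separating the `i`-th coordinate from the others. -/
def splitCoord (i : Fin d) (y : EuclideanSpace ℝ (Fin d)) : ℝ × ({j : Fin d // j ≠ i} → ℝ) :=
  (y i, fun j => y j)

theorem measurable_splitCoord (i : Fin d) : Measurable (splitCoord i) := by
  unfold splitCoord; fun_prop

theorem card_ne (i : Fin d) : Fintype.card {j : Fin d // j ≠ i} = d - 1 := by
  simp [Fintype.card_subtype_compl]

theorem antilipschitzWith_splitCoord (i : Fin d) :
    ∃ K : NNReal, AntilipschitzWith K (splitCoord i) := by
  refine ⟨_, fun x y => (PiLp.antilipschitzWith_ofLp 2 (fun _ : Fin d => ℝ) x y).trans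
    (mul_le_mul_right ?_ _)⟩
  refine edist_pi_le_iff.2 fun j => ?_
  by_cases hj : j = i
  · subst hj
    exact le_max_left _ _
  · exact (edist_le_pi_edist (splitCoord i x).2 (splitCoord i y).2 ⟨j, hj⟩).trans (le_max_right _ _)

theorem norm_splitCoord_le (i : Fin d) (y : EuclideanSpace ℝ (Fin d)) :
    ‖splitCoord i y‖ ≤ ‖y‖ :=
  max_le (PiLp.norm_apply_le y i) ((pi_norm_le_iff_of_nonneg (norm_nonneg _)).2 fun j =>
    PiLp.norm_apply_le y j)

/-- A map that shrinks distances by at most a factor K raises the kernel by at most K^s. The carrier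
`A` is there for maps that are controlled only almost everywhere. -/
theorem energy_map_ne_top {X Y : Type*} [MetricSpace X] [MeasurableSpace X] [BorelSpace X]
    [SecondCountableTopology X] [MetricSpace Y] [MeasurableSpace Y] [BorelSpace Y]
    [SecondCountableTopology Y] {μ : Measure X} [SFinite μ] {f : X → Y} (hf : Measurable f)
    {K : NNReal} (hK1 : K ≠ 0) {A : Set X} (hA : ∀ᵐ x ∂μ, x ∈ A)
    (hK : ∀ x ∈ A, ∀ y ∈ A, edist x y ≤ K * edist (f x) (f y))
    {s : ℝ} (hs : 0 < s) (h : ∫⁻ x, ∫⁻ y, edist x y ^ (-s) ∂μ ∂μ ≠ ∞) :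
    ∫⁻ x, ∫⁻ y, edist x y ^ (-s) ∂(μ.map f) ∂(μ.map f) ≠ ∞ := by
  have hm : Measurable fun p : Y × Y => edist p.1 p.2 ^ (-s) := by fun_prop
  rw [lintegral_map hm.lintegral_prod_right' hf]
  have hinner : ∀ x, ∫⁻ y, edist (f x) y ^ (-s) ∂(μ.map f) = ∫⁻ y, edist (f x) (f y) ^ (-s) ∂μ :=
    fun x => lintegral_map (hm.comp measurable_prodMk_left) hf
  simp only [hinner]
  have hK0 : (K : ℝ≥0∞) ^ s ≠ ∞ := ENNReal.rpow_ne_top_of_nonneg hs.le ENNReal.coe_ne_top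
  refine ne_top_of_le_ne_top (ENNReal.mul_ne_top hK0 h) ?_
  rw [← lintegral_const_mul' _ _ hK0]
  refine lintegral_mono_ae ?_
  filter_upwards [hA] with x hx
  rw [← lintegral_const_mul' _ _ hK0]
  refine lintegral_mono_ae ?_
  filter_upwards [hA] with y hy
  have hKs0 : (K : ℝ≥0∞) ^ s ≠ 0 := by simp [ENNReal.rpow_eq_zero_iff, hK1, hs.not_gt]
  have h1 : edist x y ^ s ≤ (K : ℝ≥0∞) ^ s * edist (f x) (f y) ^ s := by
    rw [← ENNReal.mul_rpow_of_nonneg _ _ hs.le]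
    exact ENNReal.rpow_le_rpow (hK x hx y hy) hs.le
  rw [ENNReal.rpow_neg, ENNReal.rpow_neg]
  calc (edist (f x) (f y) ^ s)⁻¹
      = (K : ℝ≥0∞) ^ s * ((K : ℝ≥0∞) ^ s * edist (f x) (f y) ^ s)⁻¹ := by
        rw [ENNReal.mul_inv (Or.inl hKs0) (Or.inl hK0), ← mul_assoc,
          ENNReal.mul_inv_cancel hKs0 hK0, one_mul]
    _ ≤ _ := by gcongr

theorem measure_singleton_eq_zero_of_energy {X : Type*} [MetricSpace X] [MeasurableSpace X]
    [BorelSpace X] {μ : Measure X} {s : ℝ} (hs : 0 < s)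
    (h : ∫⁻ x, ∫⁻ y, edist x y ^ (-s) ∂μ ∂μ ≠ ∞) (x : X) : μ {x} = 0 := by
  by_contra hx
  refine h (top_le_iff.1 ?_)
  calc ∞ = (∞ * μ {x}) * μ {x} := by rw [ENNReal.top_mul hx, ENNReal.top_mul hx]
    _ = ∫⁻ x' in {x}, (∫⁻ y in {x}, edist x' y ^ (-s) ∂μ) ∂μ := by
      rw [lintegral_singleton, lintegral_singleton, edist_self,
        ENNReal.zero_rpow_of_neg (by linarith)]
    _ ≤ ∫⁻ x' in {x}, (∫⁻ y, edist x' y ^ (-s) ∂μ) ∂μ :=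
      lintegral_mono fun x' => setLIntegral_le_lintegral _ _
    _ ≤ _ := setLIntegral_le_lintegral _ _

/-- A measure of finite `s`-energy vanishes when `s` exceeds the dimension of the space. -/
theorem eq_zero_of_energy_ne_top {X : Type*} [MetricSpace X] [MeasurableSpace X]
    [BorelSpace X] [SecondCountableTopology X] {μ : Measure X} [SFinite μ] {s : ℝ} (hs : 0 < s)
    (hX : μH[s] (Set.univ : Set X) = 0)
    (h : ∫⁻ x, ∫⁻ y, edist x y ^ (-s) ∂μ ∂μ ≠ ∞) : μ = 0 := by
  have hm : Measurable fun p : X × X => edist p.1 p.2 ^ (-s) := by fun_prop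
  have hU : Measurable fun x => ∫⁻ y, edist x y ^ (-s) ∂μ := hm.lintegral_prod_right'
  have hae : ∀ᵐ x ∂μ, ∫⁻ y, edist x y ^ (-s) ∂μ < ∞ := ae_lt_top hU h
  have hlevel : ∀ M : ℕ, μ {x | ∫⁻ y, edist x y ^ (-s) ∂μ ≤ (M : ℝ≥0∞) + 1} = 0 := by
    intro M
    set A := {x | ∫⁻ y, edist x y ^ (-s) ∂μ ≤ (M : ℝ≥0∞) + 1}
    have hA : MeasurableSet A := measurableSet_le hU measurable_const
    have hM0 : (M : ℝ≥0∞) + 1 ≠ 0 := by simp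
    have hMt : (M : ℝ≥0∞) + 1 ≠ ∞ := by simp
    -- If S contains a point of `A`, its potential is at least diam(S)^{-s} μ(S ∩ A). So the
    -- restricted measure is bounded by M + 1 times diam(S)^s.
    have hle : ((M : ℝ≥0∞) + 1)⁻¹ • μ.restrict A ≤ μH[s] := by
      refine Measure.le_hausdorffMeasure s _ 1 one_pos fun S hS => ?_
      rw [Measure.smul_apply, smul_eq_mul, Measure.restrict_apply' hA]
      rcases (S ∩ A).eq_empty_or_nonempty with he | ⟨x, hxS, hxA⟩
      · simp [he]
      have h1 : Metric.ediam S ^ (-s) * μ (S ∩ A) ≤ M + 1 := by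
        refine le_trans ?_ hxA
        calc Metric.ediam S ^ (-s) * μ (S ∩ A)
            = ∫⁻ _ in S ∩ A, Metric.ediam S ^ (-s) ∂μ := (setLIntegral_const _ _).symm
          _ ≤ ∫⁻ y in S ∩ A, edist x y ^ (-s) ∂μ := by
            refine setLIntegral_mono (hm.comp measurable_prodMk_left) fun y hy => ?_
            rw [ENNReal.rpow_neg, ENNReal.rpow_neg]
            exact ENNReal.inv_le_inv.2
              (ENNReal.rpow_le_rpow (Metric.edist_le_ediam_of_mem hxS hy.1) hs.le)
          _ ≤ _ := setLIntegral_le_lintegral _ _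
      rw [ENNReal.inv_mul_le_iff hM0 hMt]
      rw [ENNReal.rpow_neg] at h1
      rcases eq_or_ne (Metric.ediam S ^ s) 0 with h0 | h0
      · rw [h0, ENNReal.inv_zero] at h1
        have : μ (S ∩ A) = 0 := by
          by_contra hne
          rw [ENNReal.top_mul hne] at h1
          exact hMt (top_le_iff.1 h1)
        rw [this]
        exact zero_le
      · rw [mul_comm]
        exact (ENNReal.inv_mul_le_iff h0 (ENNReal.rpow_ne_top_of_nonneg hs.le
          (ne_top_of_le_ne_top ENNReal.one_ne_top hS))).1 h1
    have h2 := hle A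
    rw [measure_mono_null (Set.subset_univ A) hX, nonpos_iff_eq_zero, Measure.smul_apply,
      Measure.restrict_apply_self, smul_eq_mul, mul_eq_zero] at h2
    exact h2.resolve_left (ENNReal.inv_ne_zero.2 hMt)
  have hall : μ (⋃ M : ℕ, {x | ∫⁻ y, edist x y ^ (-s) ∂μ ≤ (M : ℝ≥0∞) + 1}) = 0 :=
    measure_iUnion_null hlevel
  refine Measure.measure_univ_eq_zero.1 (le_antisymm ?_ zero_le)
  have : (Set.univ : Set X) ⊆ {x | ¬ ∫⁻ y, edist x y ^ (-s) ∂μ < ∞} ∪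
      ⋃ M : ℕ, {x | ∫⁻ y, edist x y ^ (-s) ∂μ ≤ (M : ℝ≥0∞) + 1} := by
    intro x _
    by_cases hx : ∫⁻ y, edist x y ^ (-s) ∂μ < ∞
    · obtain ⟨M, hM⟩ := ENNReal.exists_nat_gt hx.ne
      exact Or.inr (Set.mem_iUnion.2 ⟨M, hM.le.trans le_self_add⟩)
    · exact Or.inl hx
  refine (measure_mono this).trans ((measure_union_le _ _).trans ?_)
  rw [hall, ae_iff.1 hae, add_zero]

/-- The slopes of a direction relative to the `i`-th coordinate. -/
noncomputable def directionSlope (i : Fin d) (θ : EuclideanSpace ℝ (Fin d)) :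
    {j : Fin d // j ≠ i} → ℝ := fun j => θ j / θ i

/-- Unit vectors whose `i`-th coordinate is largest in absolute value. -/
def dominantCap (i : Fin d) : Set (EuclideanSpace ℝ (Fin d)) :=
  {θ | θ ∈ Metric.sphere 0 1 ∧ ∀ j, |θ j| ≤ |θ i|}

theorem inv_le_abs_of_mem_dominantCap {i : Fin d} {θ : EuclideanSpace ℝ (Fin d)}
    (hθ : θ ∈ dominantCap i) : (d : ℝ)⁻¹ ≤ |θ i| := by
  have hd : (1 : ℝ) ≤ d := by exact_mod_cast Nat.one_le_iff_ne_zero.2 (Fin.pos i).ne'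
  have h1 : ‖θ‖ = 1 := by simpa using hθ.1
  have h2 : ∑ j, θ j ^ 2 = 1 := by rw [← EuclideanSpace.real_norm_sq_eq, h1, one_pow]
  have h3 : ∑ j, θ j ^ 2 ≤ ∑ _j : Fin d, |θ i| ^ 2 :=
    Finset.sum_le_sum fun j _ => by
      rw [← sq_abs (θ j)]; exact pow_le_pow_left₀ (abs_nonneg _) (hθ.2 j) 2
  rw [h2, Finset.sum_const, Finset.card_univ, Fintype.card_fin, nsmul_eq_mul] at h3
  by_contra hlt
  push Not at hlt
  have h4 : |θ i| * d < 1 := by rwa [← lt_div_iff₀ (by positivity), one_div]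
  have h5 := abs_nonneg (θ i)
  nlinarith

/-- On the cap the denominator is at least 1/d and the slopes are at most 1. The Lipschitz chart
sends surface-null sets to Lebesgue-null sets of slopes. -/
theorem lipschitzOnWith_directionSlope (i : Fin d) :
    LipschitzOnWith (2 * d) (directionSlope i) (dominantCap i) := by
  refine LipschitzOnWith.of_dist_le_mul fun θ hθ φ hφ => ?_
  have hd : (0 : ℝ) < d := by exact_mod_cast Fin.pos i
  have hθi : 0 < |θ i| := (inv_pos.2 hd).trans_le (inv_le_abs_of_mem_dominantCap hθ)
  have hφi' := inv_le_abs_of_mem_dominantCap hφ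
  have hφi : 0 < |φ i| := (inv_pos.2 hd).trans_le hφi'
  push_cast
  refine (dist_pi_le_iff (by positivity)).2 fun j => ?_
  have hcoord : ∀ k, |θ k - φ k| ≤ dist θ φ := fun k => by
    rw [dist_eq_norm]; exact PiLp.norm_apply_le (θ - φ) k
  have h1 : θ j / θ i - φ j / φ i = (θ j * (φ i - θ i) + θ i * (θ j - φ j)) / (θ i * φ i) := by
    field_simp [abs_pos.1 hθi, abs_pos.1 hφi]
    ring
  rw [Real.dist_eq, directionSlope, directionSlope, h1, abs_div, abs_mul (θ i),
    div_le_iff₀ (by positivity)]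
  have h2 : |θ j * (φ i - θ i) + θ i * (θ j - φ j)| ≤ |θ i| * dist θ φ + |θ i| * dist θ φ := by
    refine (abs_add_le _ _).trans ?_
    rw [abs_mul, abs_mul]
    have := hcoord i
    rw [abs_sub_comm] at this
    exact add_le_add (mul_le_mul (hθ.2 j) this (abs_nonneg _) (abs_nonneg _))
      (mul_le_mul_of_nonneg_left (hcoord j) (abs_nonneg _))
  have h3 : 1 ≤ d * |φ i| := by
    rw [inv_le_iff_one_le_mul₀ hd] at hφi'
    linarith
  have h4 : 0 ≤ |θ i| * dist θ φ := by positivity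
  calc _ ≤ _ := h2
    _ ≤ 2 * (|θ i| * dist θ φ) * (d * |φ i|) := by nlinarith
    _ = _ := by ring

/-- Every direction lies in the cap of its largest coordinate, where its slope has norm at most 1. A
null set of directions thus becomes finitely many null sets of slopes, one per chart. -/
theorem absolutelyContinuous_radialProj {μ : Measure (EuclideanSpace ℝ (Fin d))}
    [IsFiniteMeasure μ] {x : EuclideanSpace ℝ (Fin d)} (hx0 : μ {x} = 0)
    (hx : ∀ i, Summable fun k => coneOscillation (μ.map (splitCoord i)) k (splitCoord i x)) :
    (μ.map (radialProj x)).AbsolutelyContinuous (sphereMeasure d) := by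
  refine Measure.AbsolutelyContinuous.mk fun N hN hN0 => ?_
  rw [sphereMeasure, Measure.restrict_apply hN] at hN0
  rw [Measure.map_apply (measurable_radialProj x) hN]
  set Ni : (i : Fin d) → Set ({j : Fin d // j ≠ i} → ℝ) :=
    fun i => directionSlope i '' (N ∩ dominantCap i) with hNi
  have hNi0 : ∀ i, volume (Ni i) = 0 := by
    intro i
    have hd : 1 ≤ d := Fin.pos i
    have hcast : ((Fintype.card {j : Fin d // j ≠ i} : ℕ) : ℝ) = (d : ℝ) - 1 := by
      rw [card_ne, Nat.cast_sub hd, Nat.cast_one]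
    rw [← hausdorffMeasure_pi_real, hcast]
    have h1 := ((lipschitzOnWith_directionSlope i).mono
      (Set.inter_subset_right : N ∩ dominantCap i ⊆ _)).hausdorffMeasure_image_le
      (d := (d : ℝ) - 1) (by rw [← hcast]; positivity)
    have h2 : μH[(d : ℝ) - 1] (N ∩ dominantCap i) = 0 :=
      measure_mono_null (fun θ hθ => Set.mem_inter hθ.1 hθ.2.1) hN0
    rwa [h2, mul_zero, nonpos_iff_eq_zero] at h1
  set T : (i : Fin d) → Set (ℝ × ({j : Fin d // j ≠ i} → ℝ)) := fun i =>
    {Y | (splitCoord i x - Y).1 ≠ 0 ∧ ‖slopeOf (splitCoord i x) Y‖ ≤ 1 ∧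
      slopeOf (splitCoord i x) Y ∈ Ni i} with hT
  have hT0 : ∀ i, μ (splitCoord i ⁻¹' T i) = 0 := fun i =>
    Measure.preimage_null_of_map_null (measurable_splitCoord i).aemeasurable
      (measure_slopeOf_mem_eq_zero (hx i) (hNi0 i))
  refine measure_mono_null (t := {x} ∪ ⋃ i, splitCoord i ⁻¹' T i) (fun y hy => ?_)
    (measure_union_null hx0 (measure_iUnion_null hT0))
  rcases eq_or_ne y x with rfl | hyx
  · exact Or.inl rfl
  refine Or.inr ?_
  have hne : Nonempty (Fin d) := by
    by_contra hemp
    rw [not_nonempty_iff] at hemp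
    exact hyx (Subsingleton.elim _ _)
  obtain ⟨i, -, hi⟩ := Finset.exists_max_image Finset.univ (fun i => |(y - x) i|)
    Finset.univ_nonempty
  have hnorm : 0 < ‖y - x‖ := norm_pos_iff.2 (sub_ne_zero.2 hyx)
  have hzi : (y - x) i ≠ 0 := by
    intro h0
    refine sub_ne_zero.2 hyx ?_
    ext j
    have := hi j (Finset.mem_univ j)
    rw [h0, abs_zero] at this
    exact abs_nonpos_iff.1 this
  -- Slopes are quotients of coordinates, so neither the sign of y - x nor its normalisation
  -- matters.
  have hslope : slopeOf (splitCoord i x) (splitCoord i y)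
      = directionSlope i (radialProj x y) := by
    ext j
    simp only [slopeOf, splitCoord, directionSlope, radialProj, Prod.fst_sub, Prod.snd_sub,
      Pi.smul_apply, Pi.sub_apply, PiLp.smul_apply, PiLp.sub_apply, smul_eq_mul]
    rw [mul_div_mul_left _ _ (inv_ne_zero hnorm.ne'), ← neg_sub (y i), ← neg_sub (y j), inv_neg,
      neg_mul_neg, inv_mul_eq_div]
  have hcap : radialProj x y ∈ dominantCap i := by
    refine ⟨?_, fun j => ?_⟩
    · rw [mem_sphere_zero_iff_norm, radialProj, norm_smul, norm_inv, norm_norm,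
        inv_mul_cancel₀ hnorm.ne']
    · simp only [radialProj, PiLp.smul_apply, smul_eq_mul, abs_mul]
      exact mul_le_mul_of_nonneg_left (hi j (Finset.mem_univ j)) (abs_nonneg _)
  refine Set.mem_iUnion.2 ⟨i, ?_, ?_, ?_⟩
  · simp only [splitCoord, Prod.fst_sub]
    rw [PiLp.sub_apply] at hzi
    exact sub_ne_zero.2 (sub_ne_zero.1 hzi).symm
  · rw [hslope]
    refine (pi_norm_le_iff_of_nonneg zero_le_one).2 fun j => ?_
    rw [directionSlope, Real.norm_eq_abs, abs_div]
    exact div_le_one_of_le₀ (hcap.2 j) (abs_nonneg _)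
  · rw [hslope]
    exact ⟨_, ⟨hy, hcap⟩, rfl⟩

theorem IsCompactlySupportedRadon.isFiniteMeasure {μ : Measure (EuclideanSpace ℝ (Fin d))}
    (hμ : IsCompactlySupportedRadon μ) : IsFiniteMeasure μ := by
  have := hμ.regular
  refine ⟨?_⟩
  rw [← Set.union_compl_self μ.support]
  refine (measure_union_le _ _).trans_lt ?_
  rw [Measure.measure_compl_support, add_zero]
  exact hμ.isCompact_support.measure_lt_top

/-- An exceptional point has a divergent oscillation series in some chart. The charts are
antilipschitz, so null sets of slopes' base points pull back without raising the dimension. -/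
theorem dimH_exceptionalSet_le (hd : 2 ≤ d) {s : ℝ} (hs : (d : ℝ) - 1 < s)
    {μ : Measure (EuclideanSpace ℝ (Fin d))} (hμ : IsCompactlySupportedRadon μ)
    (hE : energy s μ < ∞) :
    dimH (exceptionalSet μ) ≤ ENNReal.ofReal (2 * ((d : ℝ) - 1) - s) := by
  have := hμ.isFiniteMeasure
  have hd' : (2 : ℝ) ≤ d := by exact_mod_cast hd
  have hs0 : 0 < s := by linarith
  have hE' : ∫⁻ x, ∫⁻ y, edist x y ^ (-s) ∂μ ∂μ ≠ ∞ := hE.ne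
  -- Cancellation only reaches s ≤ n + 1 = d. Beyond it the energy hypothesis kills the measure.
  rcases lt_or_ge (d : ℝ) s with hsd | hsd
  · have hzero : μ = 0 := by
      refine eq_zero_of_energy_ne_top hs0 ?_ hE'
      rw [Real.hausdorffMeasure_of_finrank_lt (by rwa [finrank_euclideanSpace_fin])]
      rfl
    have : exceptionalSet μ = ∅ := by
      rw [hzero, exceptionalSet]
      ext x
      simp [Measure.AbsolutelyContinuous.zero]
    rw [this, dimH_empty]
    exact zero_le
  refine le_of_forall_gt_imp_ge_of_dense fun b hb => ?_
  -- Capping t at d - 1 is harmless, because s > d - 1 puts the critical exponent 2(d-1) - s below d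
  -- - 1.
  obtain ⟨t, ht0, ht1, ht2, htb⟩ : ∃ t : ℝ, 0 < t ∧ t ≤ (d : ℝ) - 1 ∧ 2 * ((d : ℝ) - 1) - s < t ∧
      ENNReal.ofReal t ≤ b := by
    rcases eq_or_ne b ∞ with rfl | hbt
    · exact ⟨(d : ℝ) - 1, by linarith, le_rfl, by linarith, le_top⟩
    · rw [← ENNReal.ofReal_toReal hbt, ENNReal.ofReal_lt_ofReal_iff'] at hb
      exact ⟨min b.toReal ((d : ℝ) - 1), lt_min hb.2 (by linarith), min_le_right _ _,
        lt_min hb.1 (by linarith), ENNReal.ofReal_le_of_le_toReal (min_le_left _ _)⟩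
  have hsub : exceptionalSet μ ⊆ ⋃ i : Fin d, splitCoord i ⁻¹'
      {X | ¬ Summable fun k => coneOscillation (μ.map (splitCoord i)) k X} := by
    intro x hx
    by_contra hcon
    simp only [Set.mem_iUnion, not_exists, Set.mem_preimage, Set.mem_ofPred_eq, not_not] at hcon
    exact hx.2 (absolutelyContinuous_radialProj (measure_singleton_eq_zero_of_energy hs0 hE' x) hcon)
  refine (dimH_mono hsub).trans ?_
  rw [dimH_iUnion]
  refine iSup_le fun i => ?_
  obtain ⟨K, hK⟩ := antilipschitzWith_splitCoord i
  refine (hK.dimH_preimage_le _).trans (le_trans ?_ htb)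
  have hne : Nonempty {j : Fin d // j ≠ i} := by
    rw [← Fintype.card_pos_iff, card_ne]
    omega
  have hcast : ((Fintype.card {j : Fin d // j ≠ i} : ℕ) : ℝ) = (d : ℝ) - 1 := by
    rw [card_ne, Nat.cast_sub (by omega), Nat.cast_one]
  obtain ⟨R, hR⟩ := hμ.isCompact_support.isBounded.exists_norm_le
  have hRae : ∀ᵐ Y ∂(μ.map (splitCoord i)), ‖Y‖ ≤ R := by
    rw [ae_map_iff (measurable_splitCoord i).aemeasurable
      (measurableSet_le measurable_norm measurable_const)]
    filter_upwards [Measure.support_mem_ae (μ := μ)] with y hy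
    exact (norm_splitCoord_le i y).trans (hR y hy)
  have hzero := hausdorffMeasure_setOf_not_summable_coneOscillation hRae hs0
    (by rw [hcast]; linarith) ht0 (by rw [hcast]; exact ht1) (by rw [hcast]; linarith)
    (energy_map_ne_top (measurable_splitCoord i) (K := K + 1) (by positivity) (A := Set.univ)
      (by simp) (fun x _ y _ => (hK x y).trans (by gcongr; simp)) hs0 hE')
  lift t to NNReal using ht0.le
  rw [ENNReal.ofReal_coe_nnreal]
  refine dimH_le_of_hausdorffMeasure_ne_top ?_
  rw [hzero]
  exact ENNReal.zero_ne_top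

end UpperBound

/-! ### Random binary expansions with prescribed digit positions. -/

section DigitMeasure

/-- The law of a fair coin. -/
noncomputable def coin : Measure Bool := (PMF.uniformOfFintype Bool).toMeasure

instance : IsProbabilityMeasure coin := by unfold coin; infer_instance

theorem coin_singleton (b : Bool) : coin {b} = 2⁻¹ := by
  rw [coin, PMF.toMeasure_apply_singleton _ _ (measurableSet_singleton b),
    PMF.uniformOfFintype_apply]
  simp

/-- A summand of a binary expansion using only the digit positions in `A`. -/
noncomputable def digitTerm (A : Set ℕ) (ε : ℕ → Bool) (i : ℕ) : ℝ :=
  open Classical in if i ∈ A ∧ ε i = true then (1 / 2 : ℝ) ^ (i + 1) else 0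

/-- The number with binary digits `ε i` at the positions `i ∈ A` and `0` elsewhere. -/
noncomputable def digitSum (A : Set ℕ) (ε : ℕ → Bool) : ℝ := ∑' i, digitTerm A ε i

/-- The law of a random number with independent fair binary digits at the positions in `A`. -/
noncomputable def digitMeasure (A : Set ℕ) : Measure ℝ :=
  (Measure.infinitePi fun _ : ℕ => coin).map (digitSum A)

variable {A : Set ℕ} {ε : ℕ → Bool}

theorem digitTerm_nonneg (i : ℕ) : 0 ≤ digitTerm A ε i := by
  unfold digitTerm; split_ifs <;> positivity

theorem digitTerm_le (i : ℕ) : digitTerm A ε i ≤ (1 / 2 : ℝ) ^ (i + 1) := by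
  unfold digitTerm; split_ifs
  · exact le_rfl
  · positivity

theorem hasSum_half_pow_tail (k : ℕ) : HasSum (fun i => (1 / 2 : ℝ) ^ (i + k + 1)) ((1 / 2) ^ k) := by
  have h := (hasSum_geometric_of_lt_one (by norm_num : (0 : ℝ) ≤ 1 / 2) (by norm_num)).mul_left
    ((1 / 2 : ℝ) ^ (k + 1))
  convert! h using 1
  · funext i; rw [← pow_add]; congr 1; omega
  · rw [pow_succ]; ring

theorem summable_digitTerm : Summable (digitTerm A ε) :=
  Summable.of_nonneg_of_le digitTerm_nonneg digitTerm_le (by simpa using (hasSum_half_pow_tail 0).summable)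

theorem digitSum_sub_sum_range_mem (k : ℕ) :
    digitSum A ε - ∑ i ∈ Finset.range k, digitTerm A ε i ∈ Set.Icc 0 ((1 / 2 : ℝ) ^ k) := by
  have h := summable_digitTerm (A := A) (ε := ε)
  rw [digitSum, ← h.sum_add_tsum_nat_add k, add_sub_cancel_left]
  refine ⟨tsum_nonneg fun i => digitTerm_nonneg _, ?_⟩
  rw [← (hasSum_half_pow_tail k).tsum_eq]
  exact ((summable_nat_add_iff k).2 h).tsum_le_tsum (fun i => digitTerm_le _)
    (hasSum_half_pow_tail k).summable

theorem digitSum_mem_Icc : digitSum A ε ∈ Set.Icc (0 : ℝ) 1 := by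
  simpa using digitSum_sub_sum_range_mem (A := A) (ε := ε) 0

theorem measurable_digitSum (A : Set ℕ) : Measurable (digitSum A) := by
  have h : ∀ i, Measurable fun ε => digitTerm A ε i := by
    intro i
    unfold digitTerm
    refine Measurable.ite ?_ measurable_const measurable_const
    by_cases hi : i ∈ A
    · simp only [hi, true_and]
      exact (measurableSet_singleton true).preimage (measurable_pi_apply i)
    · simp [hi]
  refine measurable_of_tendsto_metrizable (f := fun k ε => ∑ i ∈ Finset.range k, digitTerm A ε i)
    (fun k => Finset.measurable_fun_sum _ fun i _ => h i) ?_
  rw [tendsto_pi_nhds]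
  exact fun ε => summable_digitTerm.hasSum.tendsto_sum_nat

instance (A : Set ℕ) : IsProbabilityMeasure (digitMeasure A) :=
  Measure.isProbabilityMeasure_map (measurable_digitSum A).aemeasurable

open Classical in
/-- The positions, counted from the `k`-th digit, of the nonzero digits among the first `k`. -/
noncomputable def leadingDigits (A : Set ℕ) (k : ℕ) (ε : ℕ → Bool) : Finset ℕ :=
  {j ∈ Finset.range k | k - 1 - j ∈ A ∧ ε (k - 1 - j) = true}

/-- Reversing the positions displays a truncation as an integer over 2^k, so that uniqueness of
binary expansions of naturals can be used. -/
theorem sum_range_digitTerm (k : ℕ) :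
    ∑ i ∈ Finset.range k, digitTerm A ε i
      = ((∑ j ∈ leadingDigits A k ε, 2 ^ j : ℕ) : ℝ) / 2 ^ k := by
  classical
  rw [← Finset.sum_range_reflect, leadingDigits, Finset.sum_filter]
  push_cast
  rw [Finset.sum_div]
  refine Finset.sum_congr rfl fun j hj => ?_
  rw [Finset.mem_range] at hj
  rw [digitTerm]
  split_ifs
  · rw [show k - 1 - j + 1 = k - j by omega, one_div, inv_pow, eq_div_iff (by positivity),
      inv_mul_eq_iff_eq_mul₀ (by positivity), ← pow_add]
    congr 1; omega
  · simp

-- The integer determines its binary digits, so the event fixes one coin for each position of `A`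
-- below k.
open Classical in
theorem infinitePi_coin_sum_eq_le (A : Set ℕ) (k N : ℕ) :
    Measure.infinitePi (fun _ : ℕ => coin) {ε | ∑ j ∈ leadingDigits A k ε, 2 ^ j = N}
      ≤ 2⁻¹ ^ (Finset.card {i ∈ Finset.range k | i ∈ A}) := by
  rcases {ε : ℕ → Bool | ∑ j ∈ leadingDigits A k ε, 2 ^ j = N}.eq_empty_or_nonempty with
    he | ⟨ε₀, hε₀⟩
  · simp [he]
  have hsub : {ε : ℕ → Bool | ∑ j ∈ leadingDigits A k ε, 2 ^ j = N}
      ⊆ Set.pi ({i ∈ Finset.range k | i ∈ A} : Finset ℕ) fun i => {ε₀ i} := by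
    intro ε hε i hi
    simp only [Finset.coe_filter, Finset.mem_range, Set.mem_ofPred_eq] at hi
    have h1 : leadingDigits A k ε = leadingDigits A k ε₀ :=
      Finset.geomSum_injective le_rfl (hε.trans hε₀.symm)
    have h2 := Finset.ext_iff.1 h1 (k - 1 - i)
    simp only [leadingDigits, Finset.mem_filter, Finset.mem_range,
      show k - 1 - (k - 1 - i) = i by omega, hi.2, true_and, show k - 1 - i < k by omega] at h2
    exact Bool.eq_iff_iff.2 h2
  refine (measure_mono hsub).trans ?_
  rw [Measure.infinitePi_pi _ fun i _ => measurableSet_singleton _]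
  simp [coin_singleton]

-- The k-digit truncation lies within 2^{-k} below the number. Its numerator is then confined to an
-- interval of length 2, leaving at most three integers.
open Classical in
theorem digitMeasure_Icc_le (A : Set ℕ) (k : ℕ) (c : ℝ) :
    digitMeasure A (Set.Icc c (c + (1 / 2) ^ k))
      ≤ 3 * 2⁻¹ ^ (Finset.card {i ∈ Finset.range k | i ∈ A}) := by
  rw [digitMeasure, Measure.map_apply (measurable_digitSum A) measurableSet_Icc]
  have hsub : digitSum A ⁻¹' Set.Icc c (c + (1 / 2) ^ k) ⊆
      ⋃ N ∈ Finset.Icc (⌈2 ^ k * c - 1⌉) (⌊2 ^ k * c + 1⌋),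
        {ε | ∑ j ∈ leadingDigits A k ε, 2 ^ j = N.toNat} := by
    intro ε hε
    have h1 := digitSum_sub_sum_range_mem (A := A) (ε := ε) k
    rw [sum_range_digitTerm] at h1
    set N := ∑ j ∈ leadingDigits A k ε, 2 ^ j
    have h2 : (2 : ℝ) ^ k * (1 / 2) ^ k = 1 := by rw [← mul_pow]; norm_num
    have h3 : (0 : ℝ) < 2 ^ k := by positivity
    have h4 : (2 : ℝ) ^ k * ((N : ℝ) / 2 ^ k) = N := by field_simp
    obtain ⟨h5, h6⟩ := h1
    obtain ⟨h7, h8⟩ := hε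
    refine Set.mem_iUnion₂.2 ⟨(N : ℤ), ?_, (Int.toNat_natCast N).symm⟩
    rw [Finset.mem_Icc, Int.ceil_le, Int.le_floor]
    push_cast
    constructor
    · nlinarith
    · nlinarith
  refine (measure_mono hsub).trans ((measure_biUnion_finset_le _ _).trans ?_)
  refine (Finset.sum_le_sum fun N _ => infinitePi_coin_sum_eq_le A k N.toNat).trans ?_
  rw [Finset.sum_const, nsmul_eq_mul, Int.card_Icc]
  gcongr
  have h1 : (⌊2 ^ k * c + 1⌋ : ℝ) ≤ 2 ^ k * c + 1 := Int.floor_le _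
  have h2 : 2 ^ k * c - 1 ≤ (⌈2 ^ k * c - 1⌉ : ℝ) := Int.le_ceil _
  have h3 : (⌊2 ^ k * c + 1⌋ : ℝ) - ⌈2 ^ k * c - 1⌉ ≤ 2 := by linarith
  have h4 : ⌊2 ^ k * c + 1⌋ - ⌈2 ^ k * c - 1⌉ ≤ 2 := by exact_mod_cast h3
  have h5 : (⌊2 ^ k * c + 1⌋ + 1 - ⌈2 ^ k * c - 1⌉).toNat ≤ 3 := by omega
  exact_mod_cast h5

/-- The `2^{-l}`-neighbourhood of `2^{-p} ℤ`. -/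
def nearLattice (p l : ℕ) : Set ℝ := {u | ∃ m : ℤ, |u - m / 2 ^ p| ≤ (1 / 2) ^ l}

theorem measurableSet_nearLattice (p l : ℕ) : MeasurableSet (nearLattice p l) := by
  have : nearLattice p l = ⋃ m : ℤ, {u : ℝ | |u - m / 2 ^ p| ≤ (1 / 2) ^ l} := by
    ext u; simp only [nearLattice, Set.mem_iUnion, Set.mem_ofPred_eq]
  rw [this]
  exact MeasurableSet.iUnion fun m => measurableSet_le (by fun_prop) measurable_const

/-- Without digits between p and l, truncating at l is the same as truncating at p, and the tail is
at most 2^{-l}. -/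
theorem digitSum_mem_nearLattice {p l : ℕ} (hpl : p ≤ l) (hA : ∀ i, p ≤ i → i < l → i ∉ A) :
    digitSum A ε ∈ nearLattice p l := by
  have h1 := digitSum_sub_sum_range_mem (A := A) (ε := ε) l
  have h2 : ∑ i ∈ Finset.range l, digitTerm A ε i = ∑ i ∈ Finset.range p, digitTerm A ε i := by
    refine (Finset.sum_subset (Finset.range_mono hpl) fun i hi hi' => ?_).symm
    rw [Finset.mem_range] at hi hi'
    rw [digitTerm, if_neg fun h => hA i (not_lt.1 hi') hi h.1]
  rw [h2, sum_range_digitTerm] at h1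
  refine ⟨(∑ j ∈ leadingDigits A p ε, 2 ^ j : ℕ), ?_⟩
  rw [Int.cast_natCast, abs_of_nonneg h1.1]
  exact h1.2

theorem ae_digitMeasure {P : ℝ → Prop} (hP : MeasurableSet {u | P u}) (h : ∀ ε, P (digitSum A ε)) :
    ∀ᵐ u ∂(digitMeasure A), P u := by
  rw [digitMeasure, ae_map_iff (measurable_digitSum A).aemeasurable hP]
  exact Filter.Eventually.of_forall h

end DigitMeasure

/-! ### Frostman measures: images, products, dimension and energy. -/

section Frostman

/-- The measure of a ball of radius `r ≤ 1` is `O(r ^ γ)`. -/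
def IsFrostman {X : Type*} [PseudoMetricSpace X] [MeasurableSpace X] (γ : ℝ) (μ : Measure X) :
    Prop :=
  ∃ C : NNReal, ∀ x r, 0 < r → r ≤ 1 → μ (Metric.closedBall x r) ≤ C * ENNReal.ofReal (r ^ γ)

theorem isFrostman_zero {X : Type*} [PseudoMetricSpace X] [MeasurableSpace X] (μ : Measure X)
    [IsProbabilityMeasure μ] : IsFrostman 0 μ :=
  ⟨1, fun x r _ _ => by simpa using prob_le_one⟩

-- A digit count of at least γk makes dyadic intervals of length 2^{-k} have mass at most 3 ·
-- 2^{-kγ}. Two such intervals cover a ball of comparable radius, and 12 = 3 · 2 · 2, the last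
-- factor bounding 2^γ.
open Classical in
theorem isFrostman_digitMeasure {A : Set ℕ} {γ : ℝ} (hγ0 : 0 ≤ γ) (hγ1 : γ ≤ 1)
    (hA : ∀ k : ℕ, γ * k ≤ Finset.card {i ∈ Finset.range k | i ∈ A}) :
    IsFrostman γ (digitMeasure A) := by
  have hk : ∀ (k : ℕ) (c : ℝ), digitMeasure A (Set.Icc c (c + (1 / 2) ^ k))
      ≤ ENNReal.ofReal (3 * ((1 / 2 : ℝ) ^ k) ^ γ) := by
    intro k c
    refine (digitMeasure_Icc_le A k c).trans ?_
    have h1 : (2⁻¹ : ℝ≥0∞) ^ (Finset.card {i ∈ Finset.range k | i ∈ A})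
        = ENNReal.ofReal ((1 / 2 : ℝ) ^ (Finset.card {i ∈ Finset.range k | i ∈ A})) := by
      rw [ENNReal.ofReal_pow (by norm_num), one_div, ENNReal.ofReal_inv_of_pos (by norm_num)]
      norm_num
    rw [h1, ENNReal.ofReal_mul (by norm_num)]
    gcongr
    · norm_num
    · rw [← Real.rpow_natCast, ← Real.rpow_natCast, ← Real.rpow_mul (by norm_num)]
      refine Real.rpow_le_rpow_of_exponent_ge (by norm_num) (by norm_num) ?_
      rw [mul_comm]
      exact hA k
  refine ⟨12, fun x r hr0 hr1 => ?_⟩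
  obtain ⟨k, hk1, hk2⟩ := exists_nat_pow_near_of_lt_one hr0 hr1
    (by norm_num : (0 : ℝ) < 1 / 2) (by norm_num)
  have hsub : Metric.closedBall x r ⊆
      Set.Icc (x - (1 / 2) ^ k) (x - (1 / 2) ^ k + (1 / 2) ^ k) ∪ Set.Icc x (x + (1 / 2) ^ k) := by
    intro u hu
    rw [Real.closedBall_eq_Icc, Set.mem_Icc] at hu
    rcases le_total u x with h | h
    · left; constructor <;> linarith
    · right; constructor <;> linarith
  have hle : ((1 / 2 : ℝ) ^ k) ^ γ ≤ 2 * r ^ γ := by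
    have h2r : (1 / 2 : ℝ) ^ k ≤ 2 * r := by
      rw [pow_succ] at hk1
      linarith
    calc ((1 / 2 : ℝ) ^ k) ^ γ ≤ (2 * r) ^ γ := Real.rpow_le_rpow (by positivity) h2r hγ0
      _ = 2 ^ γ * r ^ γ := Real.mul_rpow (by norm_num) hr0.le
      _ ≤ 2 ^ (1 : ℝ) * r ^ γ := by gcongr; norm_num
      _ = _ := by rw [Real.rpow_one]
  calc digitMeasure A (Metric.closedBall x r)
      ≤ ENNReal.ofReal (3 * ((1 / 2 : ℝ) ^ k) ^ γ) + ENNReal.ofReal (3 * ((1 / 2 : ℝ) ^ k) ^ γ) :=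
        (measure_mono hsub).trans ((measure_union_le _ _).trans (add_le_add (hk _ _) (hk _ _)))
    _ = ENNReal.ofReal (6 * ((1 / 2 : ℝ) ^ k) ^ γ) := by
        rw [← ENNReal.ofReal_add (by positivity) (by positivity)]
        congr 1; ring
    _ ≤ ENNReal.ofReal (12 * r ^ γ) := ENNReal.ofReal_le_ofReal (by linarith)
    _ = _ := by rw [ENNReal.ofReal_mul (by norm_num)]; norm_num

theorem IsFrostman.map {X Y : Type*} [PseudoMetricSpace X] [MeasurableSpace X]
    [PseudoMetricSpace Y] [MeasurableSpace Y] [OpensMeasurableSpace Y] {γ : ℝ} {μ : Measure X}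
    (hμ : IsFrostman γ μ) {f : X → Y} (hf : Measurable f) (hsurj : Function.Surjective f)
    (hdist : ∀ x y, dist x y ≤ dist (f x) (f y)) : IsFrostman γ (μ.map f) := by
  obtain ⟨C, hC⟩ := hμ
  refine ⟨C, fun y r hr0 hr1 => ?_⟩
  obtain ⟨x, rfl⟩ := hsurj y
  rw [Measure.map_apply hf Metric.isClosed_closedBall.measurableSet]
  exact (measure_mono fun z hz => (hdist z x).trans hz).trans (hC x r hr0 hr1)

/-- Balls of the sup metric are products, so exponents add. -/
theorem isFrostman_pi {ι : Type*} [Fintype ι] {m : ι → Measure ℝ} [∀ i, SigmaFinite (m i)]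
    {γ : ι → ℝ} (hm : ∀ i, IsFrostman (γ i) (m i)) : IsFrostman (∑ i, γ i) (Measure.pi m) := by
  choose C hC using hm
  refine ⟨∏ i, C i, fun x r hr0 hr1 => ?_⟩
  rw [closedBall_pi _ hr0.le, Measure.pi_pi]
  refine (Finset.prod_le_prod' fun i _ => hC i (x i) r hr0 hr1).trans_eq ?_
  rw [Finset.prod_mul_distrib, ← ENNReal.ofReal_prod_of_nonneg fun i _ => by positivity,
    Real.rpow_sum_of_pos hr0]
  push_cast
  rfl

theorem IsFrostman.measure_singleton {X : Type*} [PseudoMetricSpace X] [MeasurableSpace X]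
    {γ : ℝ} (hγ : 0 < γ) {μ : Measure X} (hμ : IsFrostman γ μ) (x : X) : μ {x} = 0 := by
  obtain ⟨C, hC⟩ := hμ
  have hlim : Filter.Tendsto (fun r : ℝ => (C : ℝ≥0∞) * ENNReal.ofReal (r ^ γ))
      (nhdsWithin 0 (Set.Ioi 0)) (nhds 0) := by
    have h1 : Filter.Tendsto (fun r : ℝ => r ^ γ) (nhdsWithin 0 (Set.Ioi 0)) (nhds 0) := by
      have := (Real.continuousAt_rpow_const 0 γ (Or.inr hγ.le)).tendsto
      rw [Real.zero_rpow hγ.ne'] at this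
      exact this.mono_left nhdsWithin_le_nhds
    have h2 := ENNReal.Tendsto.const_mul (ENNReal.tendsto_ofReal h1)
      (Or.inr (ENNReal.coe_ne_top (r := C)))
    simpa using h2
  refine nonpos_iff_eq_zero.1 (ge_of_tendsto hlim ?_)
  filter_upwards [Ioc_mem_nhdsGT (zero_lt_one' ℝ)] with r hr
  exact (measure_mono (by simpa using hr.1.le)).trans (hC x r hr.1 hr.2)

/-- The mass distribution principle. -/
theorem IsFrostman.le_dimH {X : Type*} [MetricSpace X] [MeasurableSpace X] [BorelSpace X]
    {γ : ℝ} (hγ : 0 < γ) {μ : Measure X} (hμ : IsFrostman γ μ) {E : Set X} (hE : μ E ≠ 0) :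
    ENNReal.ofReal γ ≤ dimH E := by
  have hsing := hμ.measure_singleton hγ
  obtain ⟨C, hC⟩ := hμ
  have hle : ((C : ℝ≥0∞) + 1)⁻¹ • μ ≤ μH[γ] := by
    refine Measure.le_hausdorffMeasure γ _ 1 one_pos fun S hS => ?_
    rw [Measure.smul_apply, smul_eq_mul, ENNReal.inv_mul_le_iff (by simp) (by simp)]
    rcases S.eq_empty_or_nonempty with rfl | ⟨x, hx⟩
    · simp
    have hSt : Metric.ediam S ≠ ∞ := ne_top_of_le_ne_top ENNReal.one_ne_top hS
    -- Sets of diameter zero give no admissible radius and are handled by the absence of atoms.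
    rcases eq_or_ne (Metric.ediam S) 0 with h0 | h0
    · have hsub : S ⊆ {x} := fun y hy => (Metric.ediam_eq_zero_iff.1 h0) hy hx
      rw [measure_mono_null hsub (hsing x)]
      exact zero_le
    · have hpos : 0 < (Metric.ediam S).toReal := ENNReal.toReal_pos h0 hSt
      have hsub : S ⊆ Metric.closedBall x (Metric.ediam S).toReal := by
        intro y hy
        rw [Metric.mem_closedBall, dist_edist]
        exact ENNReal.toReal_mono hSt (Metric.edist_le_ediam_of_mem hy hx)
      refine (measure_mono hsub).trans ((hC x _ hpos ?_).trans ?_)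
      · exact ENNReal.toReal_le_of_le_ofReal zero_le_one (by simpa using hS)
      · rw [← ENNReal.ofReal_rpow_of_pos hpos, ENNReal.ofReal_toReal hSt]
        gcongr
        exact le_self_add
  lift γ to NNReal using hγ.le
  rw [ENNReal.ofReal_coe_nnreal]
  refine le_dimH_of_hausdorffMeasure_ne_zero fun h0 => hE ?_
  have := hle E
  rw [h0, nonpos_iff_eq_zero, Measure.smul_apply, smul_eq_mul, mul_eq_zero] at this
  exact this.resolve_left (by simp)

/-- Decomposing the kernel over dyadic balls gives terms 2^{ks} · 2^{-kγ} up to constants, a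
convergent geometric series. -/
theorem IsFrostman.energy_ne_top {X : Type*} [PseudoMetricSpace X] [MeasurableSpace X]
    [OpensMeasurableSpace X] {γ s : ℝ} (hs : 0 < s) (hsγ : s < γ) {μ : Measure X}
    [IsFiniteMeasure μ] (hμ : IsFrostman γ μ) :
    ∫⁻ x, ∫⁻ y, edist x y ^ (-s) ∂μ ∂μ ≠ ∞ := by
  obtain ⟨C, hC⟩ := hμ
  set q : ℝ := (1 / 2 : ℝ) ^ (γ - s) with hq
  have hq0 : 0 ≤ q := by positivity
  have hq1 : q < 1 := Real.rpow_lt_one (by norm_num) (by norm_num) (by linarith)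
  have hpt : ∀ x y : X, edist x y ^ (-s) ≤ 1 + ∑' k : ℕ,
      (Metric.closedBall x ((1 / 2 : ℝ) ^ k)).indicator
        (fun _ => ENNReal.ofReal (((1 / 2 : ℝ) ^ (k + 1)) ^ (-s))) y := by
    intro x y
    rcases le_or_gt (edist x y) 1 with h1 | h1
    swap
    · exact (ENNReal.rpow_le_one_of_one_le_of_neg h1.le (by linarith)).trans le_self_add
    refine le_trans ?_ le_add_self
    rw [edist_dist, ENNReal.ofReal_le_one] at h1
    rcases (dist_nonneg (x := x) (y := y)).eq_or_lt with h0 | h0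
    -- At distance zero every dyadic term is present and at least 1, so the majorant is infinite as
    -- well.
    · have hmem : ∀ k : ℕ, y ∈ Metric.closedBall x ((1 / 2 : ℝ) ^ k) := fun k => by
        rw [Metric.mem_closedBall, dist_comm, ← h0]; positivity
      refine le_top.trans_eq (Eq.symm (top_le_iff.1 ?_))
      rw [← ENNReal.tsum_const_eq_top_of_ne_zero (α := ℕ) one_ne_zero]
      refine ENNReal.tsum_le_tsum fun k => ?_
      rw [Set.indicator_of_mem (hmem k), ENNReal.one_le_ofReal]
      exact Real.one_le_rpow_of_pos_of_le_one_of_nonpos (by positivity)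
        (pow_le_one₀ (by norm_num) (by norm_num)) (by linarith)
    · obtain ⟨k, hk1, hk2⟩ := exists_nat_pow_near_of_lt_one h0 h1
        (by norm_num : (0 : ℝ) < 1 / 2) (by norm_num)
      refine le_trans ?_ (ENNReal.le_tsum k)
      rw [Set.indicator_of_mem (by rwa [Metric.mem_closedBall, dist_comm]), edist_dist,
        ENNReal.ofReal_rpow_of_pos h0]
      exact ENNReal.ofReal_le_ofReal
        (Real.rpow_le_rpow_of_nonpos (by positivity) hk1.le (by linarith))
  have hinner : ∀ x, ∫⁻ y, edist x y ^ (-s) ∂μ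
      ≤ μ Set.univ + ∑' k : ℕ, C * ENNReal.ofReal (2 ^ s * q ^ k) := by
    intro x
    calc ∫⁻ y, edist x y ^ (-s) ∂μ
        ≤ ∫⁻ y, (1 + ∑' k : ℕ, (Metric.closedBall x ((1 / 2 : ℝ) ^ k)).indicator
          (fun _ => ENNReal.ofReal (((1 / 2 : ℝ) ^ (k + 1)) ^ (-s))) y) ∂μ := lintegral_mono (hpt x)
      _ = μ Set.univ + ∑' k : ℕ, ENNReal.ofReal (((1 / 2 : ℝ) ^ (k + 1)) ^ (-s))
            * μ (Metric.closedBall x ((1 / 2 : ℝ) ^ k)) := by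
          rw [lintegral_add_left measurable_const, lintegral_one, lintegral_tsum fun k =>
            (measurable_const.indicator Metric.isClosed_closedBall.measurableSet).aemeasurable]
          simp only [lintegral_indicator_const Metric.isClosed_closedBall.measurableSet]
      _ ≤ _ := by
          refine add_le_add le_rfl (ENNReal.tsum_le_tsum fun k => ?_)
          refine (mul_le_mul_right (hC x _ (by positivity)
            (pow_le_one₀ (by norm_num) (by norm_num))) _).trans_eq ?_
          rw [mul_left_comm, ← ENNReal.ofReal_mul (by positivity)]
          congr 2
          have h1 : (1 / 2 : ℝ) ^ (-s) = 2 ^ s := by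
            rw [one_div, Real.inv_rpow (by norm_num), ← Real.rpow_neg (by norm_num), neg_neg]
          have h2 : ((1 / 2 : ℝ) ^ k) ^ (γ - s) = q ^ k := by
            rw [hq, ← Real.rpow_natCast, ← Real.rpow_natCast, ← Real.rpow_mul (by norm_num),
              ← Real.rpow_mul (by norm_num), mul_comm]
          rw [pow_succ, Real.mul_rpow (by positivity) (by norm_num), h1, mul_right_comm,
            ← Real.rpow_add (by positivity), ← h2, mul_comm, neg_add_eq_sub]
  have hsum : ∑' k : ℕ, C * ENNReal.ofReal (2 ^ s * q ^ k) ≠ ∞ := by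
    rw [ENNReal.tsum_mul_left]
    exact ENNReal.mul_ne_top ENNReal.coe_ne_top
      ((summable_geometric_of_lt_one hq0 hq1).mul_left _).tsum_ofReal_ne_top
  refine ne_top_of_le_ne_top ?_ (lintegral_mono hinner)
  rw [lintegral_const]
  exact ENNReal.mul_ne_top (ENNReal.add_ne_top.2 ⟨measure_ne_top _ _, hsum⟩) (measure_ne_top _ _)

end Frostman

/-! ### Digit sets with gaps, and the arithmetic of near-lattice points. -/

section DigitSets

/-- All digit positions outside the gaps `[g j, K ^ (j + 1))`. -/
def gapDigits (K : ℕ) (g : ℕ → ℕ) : Set ℕ := {i | ∀ j, ¬ (g j ≤ i ∧ i < K ^ (j + 1))}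

-- The digit density is lowest at the end of a gap, and there the full block [K^j, g j) alone
-- contains at least γK^{j+1} digits. Inside a full block the count grows at rate 1 ≥ γ.
open Classical in
theorem mul_le_card_gapDigits {K : ℕ} (hK : 1 < K) {g : ℕ → ℕ} (hgK : ∀ j, g j ≤ K ^ (j + 1))
    {γ : ℝ} (hγ0 : 0 ≤ γ) (hγ1 : γ ≤ 1) (hg : ∀ j, γ * K ^ (j + 1) + K ^ j ≤ g j) (m : ℕ) :
    γ * m ≤ Finset.card {i ∈ Finset.range m | i ∈ gapDigits K g} := by
  have hgK' : ∀ j, K ^ j ≤ g j := by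
    intro j
    have h1 := hg j
    have h2 : (0 : ℝ) ≤ γ * K ^ (j + 1) := by positivity
    have h3 : (K : ℝ) ^ j ≤ g j := by linarith
    exact_mod_cast h3
  have hmem : ∀ j i, K ^ j ≤ i → i < g j → i ∈ gapDigits K g := by
    rintro j i h1 h2 j' ⟨h3, h4⟩
    rcases lt_trichotomy j' j with h | rfl | h
    · exact absurd (h4.trans_le ((Nat.pow_le_pow_right hK.le h).trans h1)) (lt_irrefl _)
    · exact absurd h2 (not_lt.2 h3)
    · exact absurd (h2.trans_le ((hgK j).trans ((Nat.pow_le_pow_right hK.le h).trans (hgK' j'))))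
        (not_lt.2 h3)
  have key : ∀ j m, m ≤ K ^ j →
      γ * m ≤ Finset.card {i ∈ Finset.range m | i ∈ gapDigits K g} := by
    intro j
    induction j with
    | zero =>
      intro m hm
      rw [pow_zero] at hm
      interval_cases m
      · simp
      · have h0 : (0 : ℕ) ∈ gapDigits K g := fun j ⟨h, _⟩ =>
          absurd ((Nat.pow_pos (by omega)).trans_le (hgK' j)) (not_lt.2 h)
        simpa [h0, Finset.filter_singleton] using hγ1
    | succ j ih =>
      intro m hm
      rcases le_or_gt m (K ^ j) with h | h
      · exact ih m h
      -- The full block is counted up to `m` or up to the start of the gap, whichever comes first.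
      set M := min m (g j) with hM
      have hMK : K ^ j ≤ M := le_min h.le (hgK' j)
      have hsub : ({i ∈ Finset.range (K ^ j) | i ∈ gapDigits K g} : Finset ℕ) ∪ Finset.Ico (K ^ j) M
          ⊆ {i ∈ Finset.range m | i ∈ gapDigits K g} := by
        intro i hi
        rw [Finset.mem_union, Finset.mem_filter, Finset.mem_Ico, Finset.mem_range] at hi
        rw [Finset.mem_filter, Finset.mem_range]
        rcases hi with ⟨hi1, hi2⟩ | ⟨hi1, hi2⟩
        · exact ⟨hi1.trans h, hi2⟩
        · exact ⟨hi2.trans_le (min_le_left _ _), hmem j i hi1 (hi2.trans_le (min_le_right _ _))⟩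
      have hdisj : Disjoint ({i ∈ Finset.range (K ^ j) | i ∈ gapDigits K g} : Finset ℕ)
          (Finset.Ico (K ^ j) M) := by
        rw [Finset.disjoint_left]
        intro i hi hi'
        rw [Finset.mem_filter, Finset.mem_range] at hi
        exact absurd hi.1 (not_lt.2 (Finset.mem_Ico.1 hi').1)
      have hcard := Finset.card_le_card hsub
      rw [Finset.card_union_of_disjoint hdisj, Nat.card_Ico] at hcard
      have h1 := ih (K ^ j) le_rfl
      push_cast at h1
      have h2 : (Finset.card {i ∈ Finset.range (K ^ j) | i ∈ gapDigits K g} : ℝ) + (M - K ^ j)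
          ≤ Finset.card {i ∈ Finset.range m | i ∈ gapDigits K g} := by
        have : ((M - K ^ j : ℕ) : ℝ) = M - (K : ℝ) ^ j := by rw [Nat.cast_sub hMK]; push_cast; rfl
        rw [← this]
        exact_mod_cast hcard
      rcases le_total m (g j) with h3 | h3
      · rw [min_eq_left h3] at hM
        have h4 : (K : ℝ) ^ j ≤ m := by exact_mod_cast h.le
        rw [hM] at h2
        nlinarith
      · rw [min_eq_right h3] at hM
        have h4 : (m : ℝ) ≤ (K : ℝ) ^ (j + 1) := by exact_mod_cast hm
        have h5 : γ * m ≤ γ * (K : ℝ) ^ (j + 1) := by gcongr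
        have h6 : 0 ≤ γ * (K : ℝ) ^ j := by positivity
        rw [hM] at h2
        linarith [hg j]
  exact key m m (Nat.lt_pow_self hK).le

theorem isFrostman_digitMeasure_univ : IsFrostman 1 (digitMeasure Set.univ) :=
  isFrostman_digitMeasure zero_le_one le_rfl (by simp)

theorem digitSum_gapDigits_mem {K : ℕ} {g : ℕ → ℕ} (hgK : ∀ j, g j ≤ K ^ (j + 1)) (j : ℕ)
    (ε : ℕ → Bool) : digitSum (gapDigits K g) ε ∈ nearLattice (g j) (K ^ (j + 1)) :=
  digitSum_mem_nearLattice (hgK j) fun _ h1 h2 h3 => h3 j ⟨h1, h2⟩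

/-- Gap positions for which the three digit sets have prescribed lower densities. -/
theorem exists_gap_positions {β h : ℝ} (hh : 0 < h) (hβh : h ≤ β) (hβ1 : β + h ≤ 1) :
    ∃ (K : ℕ) (p r : ℕ → ℕ), 1 < K ∧ (∀ j, p j + r j + j = K ^ (j + 1)) ∧
      (∀ j, (β - h) * K ^ (j + 1) + K ^ j ≤ p j) ∧
      (∀ j, (1 - β - h) * K ^ (j + 1) + K ^ j ≤ r j) ∧
      ∀ j, (1 - h) * K ^ (j + 1) + K ^ j ≤ (p j + r j : ℕ) := by
  -- This size gives hK^{j+1} ≥ 2K^j ≥ K^j + j + 1, which pays for the initial block K^j, the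
  -- surplus j and the rounding error 1.
  obtain ⟨K, hK⟩ := exists_nat_gt (2 / h)
  have hhK : 2 ≤ h * K := by
    rw [div_lt_iff₀ hh] at hK
    linarith
  have hK1 : 1 < K := by
    have : (1 : ℝ) < K := by nlinarith
    exact_mod_cast this
  have hpow : ∀ j : ℕ, 2 * (K : ℝ) ^ j ≤ h * K ^ (j + 1) := by
    intro j
    rw [pow_succ]
    have : (0 : ℝ) < (K : ℝ) ^ j := by positivity
    nlinarith
  have hj : ∀ j : ℕ, (j : ℝ) + 1 ≤ (K : ℝ) ^ j := by
    intro j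
    exact_mod_cast Nat.lt_pow_self hK1
  set p : ℕ → ℕ := fun j => ⌊β * (K : ℝ) ^ (j + 1)⌋₊ with hp
  have hp1 : ∀ j, (p j : ℝ) ≤ β * (K : ℝ) ^ (j + 1) := fun j =>
    Nat.floor_le (by have := hh.le.trans hβh; positivity)
  have hp2 : ∀ j, β * (K : ℝ) ^ (j + 1) - 1 < p j := fun j => Nat.sub_one_lt_floor _
  have hpj : ∀ j, p j + j ≤ K ^ (j + 1) := by
    intro j
    have h1 : (p j : ℝ) + j ≤ (K : ℝ) ^ (j + 1) := by
      have : 0 ≤ (1 - β - h) * (K : ℝ) ^ (j + 1) :=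
        mul_nonneg (by linarith) (by positivity)
      nlinarith [hp1 j, hpow j, hj j]
    exact_mod_cast h1
  have hr : ∀ j, ((K ^ (j + 1) - j - p j : ℕ) : ℝ) = (K : ℝ) ^ (j + 1) - j - p j := by
    intro j
    have := hpj j
    rw [Nat.cast_sub (by omega), Nat.cast_sub (by omega)]
    push_cast
    rfl
  refine ⟨K, p, fun j => K ^ (j + 1) - j - p j, hK1, fun j => ?_, fun j => ?_, fun j => ?_,
    fun j => ?_⟩
  · have := hpj j
    simp only
    omega
  · nlinarith [hp2 j, hpow j, hj j, (Nat.cast_nonneg j : (0 : ℝ) ≤ j)]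
  · rw [hr]
    nlinarith [hp1 j, hpow j, hj j]
  · rw [Nat.cast_add, hr]
    nlinarith [hpow j, hj j]

/-- At stage j at most 15 · 2^p intervals of length 10 · 2^{-l} are needed. Their total length is at
most 150 · 2^{-j}, and the surplus j drives it to zero. -/
theorem volume_setOf_near_lattices_eq_zero {p l : ℕ → ℕ} (hpl : ∀ j, p j + j ≤ l j) :
    volume {u : ℝ | |u| ≤ 2 ∧ ∀ j, ∃ m : ℤ, |u - m / 2 ^ p j| ≤ 5 * (1 / 2) ^ l j} = 0 := by
  set Z := {u : ℝ | |u| ≤ 2 ∧ ∀ j, ∃ m : ℤ, |u - m / 2 ^ p j| ≤ 5 * (1 / 2) ^ l j} with hZ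
  have hbound : ∀ j : ℕ, volume Z ≤ ENNReal.ofReal (150 * (1 / 2 : ℝ) ^ j) := by
    intro j
    have h2p : (0 : ℝ) < 2 ^ p j := by positivity
    have hsub : Z ⊆ ⋃ m ∈ Finset.Icc (-(7 * 2 ^ p j) : ℤ) (7 * 2 ^ p j),
        Metric.closedBall ((m : ℝ) / 2 ^ p j) (5 * (1 / 2) ^ l j) := by
      rintro u ⟨hu, hu'⟩
      obtain ⟨m, hm⟩ := hu' j
      refine Set.mem_iUnion₂.2 ⟨m, ?_, by rwa [Metric.mem_closedBall, Real.dist_eq]⟩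
      have h1 : (1 / 2 : ℝ) ^ l j ≤ 1 := pow_le_one₀ (by norm_num) (by norm_num)
      have h2 : |(m : ℝ) / 2 ^ p j| ≤ 7 := by
        rw [abs_le] at hm hu ⊢
        constructor <;> linarith [hm.1, hm.2, hu.1, hu.2]
      rw [abs_div, abs_of_pos h2p, div_le_iff₀ h2p, abs_le] at h2
      rw [Finset.mem_Icc]
      exact_mod_cast h2
    refine (measure_mono hsub).trans ((measure_biUnion_finset_le _ _).trans ?_)
    simp only [Real.volume_closedBall]
    rw [Finset.sum_const, Int.card_Icc, nsmul_eq_mul, ← ENNReal.ofReal_natCast,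
      ← ENNReal.ofReal_mul (by positivity)]
    refine ENNReal.ofReal_le_ofReal ?_
    have h3 : (((7 * 2 ^ p j + 1 - -(7 * 2 ^ p j) : ℤ).toNat : ℕ) : ℝ) ≤ 15 * 2 ^ p j := by
      have h4 : (7 * 2 ^ p j + 1 - -(7 * 2 ^ p j) : ℤ) = ((14 * 2 ^ p j + 1 : ℕ) : ℤ) := by
        push_cast; ring
      rw [h4, Int.toNat_natCast]
      push_cast
      have : (1 : ℝ) ≤ 2 ^ p j := one_le_pow₀ (by norm_num)
      linarith
    have h5 : (2 : ℝ) ^ p j * (1 / 2) ^ l j ≤ (1 / 2) ^ j := by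
      have h6 : (1 / 2 : ℝ) ^ l j ≤ (1 / 2) ^ (p j + j) :=
        pow_le_pow_of_le_one (by norm_num) (by norm_num) (hpl j)
      have h7 : (2 : ℝ) ^ p j * (1 / 2) ^ (p j + j) = (1 / 2) ^ j := by
        rw [pow_add, ← mul_assoc, ← mul_pow]; norm_num
      rw [← h7]
      gcongr
    calc _ ≤ 15 * 2 ^ p j * (2 * (5 * (1 / 2 : ℝ) ^ l j)) := by gcongr
      _ = 150 * (2 ^ p j * (1 / 2 : ℝ) ^ l j) := by ring
      _ ≤ _ := by gcongr
  have hlim : Filter.Tendsto (fun j : ℕ => ENNReal.ofReal (150 * (1 / 2 : ℝ) ^ j)) Filter.atTop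
      (nhds 0) := by
    have := (tendsto_pow_atTop_nhds_zero_of_lt_one (by norm_num : (0 : ℝ) ≤ 1 / 2)
      (by norm_num)).const_mul 150
    simpa using ENNReal.tendsto_ofReal this
  exact nonpos_iff_eq_zero.1 (ge_of_tendsto' hlim hbound)

/-- If `x` and `y` are near lattices, then `z - x * (1 + y)` is near the product lattice. -/
theorem exists_abs_sub_mul_le {x y z : ℝ} {p r l : ℕ} (hx : x ∈ nearLattice r l)
    (hy : y ∈ nearLattice p l) (hz : z ∈ nearLattice (p + r) l) (hx1 : |x| ≤ 1)
    (hy1 : y ∈ Set.Icc (0 : ℝ) 1) :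
    ∃ m : ℤ, |z - x * (1 + y) - m / 2 ^ (p + r)| ≤ 5 * (1 / 2) ^ l := by
  obtain ⟨b, hb⟩ := hx
  obtain ⟨a, ha⟩ := hy
  obtain ⟨c, hc⟩ := hz
  -- This is the numerator of c/2^{p+r} - (b/2^r)(1 + a/2^p). The errors from z, x and y contribute
  -- 1 + 2 + 2 = 5 multiples of 2^{-l}.
  refine ⟨c - b * (2 ^ p + a), ?_⟩
  set δ : ℝ := (1 / 2) ^ l
  have hδ : δ ≤ 1 := pow_le_one₀ (by norm_num) (by norm_num)
  have heq : z - x * (1 + y) - ((c - b * (2 ^ p + a) : ℤ) : ℝ) / 2 ^ (p + r)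
      = (z - c / 2 ^ (p + r)) - (x - b / 2 ^ r) * (1 + y) - (b / 2 ^ r) * (y - a / 2 ^ p) := by
    push_cast
    rw [pow_add]
    field_simp
    ring
  have hb2 : |(b : ℝ) / 2 ^ r| ≤ 2 := by
    rw [abs_le] at hb hx1 ⊢
    constructor <;> linarith [hb.1, hb.2, hx1.1, hx1.2]
  have h1y : |1 + y| ≤ 2 := by
    rw [abs_le]; constructor <;> linarith [hy1.1, hy1.2]
  rw [heq]
  calc _ ≤ |z - c / 2 ^ (p + r)| + |(x - b / 2 ^ r) * (1 + y)|
        + |(b / 2 ^ r) * (y - a / 2 ^ p)| :=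
        (abs_sub _ _).trans (add_le_add_left (abs_sub _ _) _)
    _ ≤ δ + δ * 2 + 2 * δ := by
        rw [abs_mul, abs_mul]
        have h0 : 0 ≤ δ := by positivity
        gcongr
    _ = _ := by ring

end DigitSets

/-! ### The projective change of coordinates and the sharp example. -/

section Construction

variable {d : ℕ}

theorem norm_normalize_sub_le {V : Type*} [NormedAddCommGroup V] [NormedSpace ℝ V] {v w : V}
    (hv : 1 ≤ ‖v‖) (hw : 1 ≤ ‖w‖) : ‖‖v‖⁻¹ • v - ‖w‖⁻¹ • w‖ ≤ 2 * ‖v - w‖ := by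
  have hv0 : 0 < ‖v‖ := by linarith
  have hw0 : 0 < ‖w‖ := by linarith
  have h1 : ‖v‖⁻¹ • v - ‖w‖⁻¹ • w = ‖v‖⁻¹ • (v - w) + (‖v‖⁻¹ - ‖w‖⁻¹) • w := by
    rw [smul_sub, sub_smul]; abel
  have h2 : ‖(‖v‖⁻¹ - ‖w‖⁻¹) • w‖ = ‖v‖⁻¹ * |‖w‖ - ‖v‖| := by
    rw [norm_smul, inv_sub_inv hv0.ne' hw0.ne', Real.norm_eq_abs, abs_div, abs_mul, abs_norm,
      abs_norm]
    field_simp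
  have h3 : ‖v‖⁻¹ ≤ 1 := inv_le_one_of_one_le₀ hv
  have h4 : |‖w‖ - ‖v‖| ≤ ‖v - w‖ := by
    rw [norm_sub_rev]; exact abs_norm_sub_norm_le w v
  calc _ ≤ ‖v‖⁻¹ * ‖v - w‖ + ‖v‖⁻¹ * |‖w‖ - ‖v‖| := by
        rw [h1, ← h2]
        refine (norm_add_le _ _).trans_eq ?_
        rw [norm_smul, norm_inv, norm_norm]
    _ ≤ 1 * ‖v - w‖ + 1 * ‖v - w‖ := by gcongr
    _ = _ := by ring

/-- The point of the hyperplane `y i = 1` with the given remaining coordinates. -/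
def affinePoint (i : Fin d) (a : {j : Fin d // j ≠ i} → ℝ) : EuclideanSpace ℝ (Fin d) :=
  WithLp.toLp 2 fun j => if h : j = i then 1 else a ⟨j, h⟩

theorem splitCoord_affinePoint (i : Fin d) (a : {j : Fin d // j ≠ i} → ℝ) :
    splitCoord i (affinePoint i a) = (1, a) := by
  ext j
  · simp [splitCoord, affinePoint]
  · simp [splitCoord, affinePoint, j.2]

theorem one_le_norm_affinePoint (i : Fin d) (a : {j : Fin d // j ≠ i} → ℝ) :
    1 ≤ ‖affinePoint i a‖ := by
  have := norm_splitCoord_le i (affinePoint i a)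
  rw [splitCoord_affinePoint] at this
  exact le_trans (by simp) ((norm_fst_le _).trans this)

theorem lipschitzWith_normalize_affinePoint (i : Fin d) :
    ∃ K : NNReal, LipschitzWith K fun a => ‖affinePoint i a‖⁻¹ • affinePoint i a := by
  obtain ⟨K, hK⟩ := antilipschitzWith_splitCoord i
  refine ⟨2 * K, LipschitzWith.of_dist_le_mul fun a b => ?_⟩
  rw [dist_eq_norm]
  refine (norm_normalize_sub_le (one_le_norm_affinePoint i a)
    (one_le_norm_affinePoint i b)).trans ?_
  have h := hK.le_mul_dist (affinePoint i a) (affinePoint i b)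
  rw [splitCoord_affinePoint, splitCoord_affinePoint, Prod.dist_eq, dist_self,
    max_eq_right dist_nonneg, dist_eq_norm] at h
  push_cast
  linarith

/-- Normalising the points of the hyperplane y i = 1 is Lipschitz, and these directions are the
image of a cylinder over the null set `Z`. -/
theorem sphereMeasure_setOf_div_mem_eq_zero {i k : Fin d} (hik : k ≠ i) {Z : Set ℝ}
    (hZ : volume Z = 0) :
    sphereMeasure d {θ | 0 < θ i ∧ θ k / θ i ∈ Z} = 0 := by
  rw [sphereMeasure, Measure.restrict_apply' Metric.isClosed_sphere.measurableSet]
  obtain ⟨K, hK⟩ := lipschitzWith_normalize_affinePoint i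
  have hd : 1 ≤ d := Fin.pos i
  have hcast : ((Fintype.card {j : Fin d // j ≠ i} : ℕ) : ℝ) = (d : ℝ) - 1 := by
    rw [card_ne, Nat.cast_sub hd, Nat.cast_one]
  set S : Set ({j : Fin d // j ≠ i} → ℝ) := {a | a ⟨k, hik⟩ ∈ Z} with hS
  have hS0 : μH[(d : ℝ) - 1] S = 0 := by
    rw [← hcast, hausdorffMeasure_pi_real]
    exact (Measure.quasiMeasurePreserving_eval
      (fun _ : {j : Fin d // j ≠ i} => (volume : Measure ℝ)) ⟨k, hik⟩).preimage_null hZ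
  have hle := hK.hausdorffMeasure_image_le (d := (d : ℝ) - 1) (by rw [← hcast]; positivity) S
  rw [hS0, mul_zero, nonpos_iff_eq_zero] at hle
  refine measure_mono_null ?_ hle
  rintro θ ⟨⟨hθi, hθk⟩, hθ⟩
  rw [mem_sphere_zero_iff_norm] at hθ
  have haff : affinePoint i (fun j => θ j / θ i) = (θ i)⁻¹ • θ := by
    ext j
    by_cases hj : j = i
    · subst hj
      simp [affinePoint, hθi.ne']
    · simp [affinePoint, hj, div_eq_inv_mul]
  refine ⟨fun j => θ j / θ i, hθk, ?_⟩
  simp only [haff, norm_smul, hθ, mul_one, norm_inv, inv_inv, Real.norm_of_nonneg hθi.le, smul_smul,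
    mul_inv_cancel₀ hθi.ne', one_smul]

/-- The projective change of coordinates `Y ↦ (1, Y) / Y i`, the entry `1` at position `i`. -/
noncomputable def projectiveMap (i : Fin d) (Y : Fin d → ℝ) : EuclideanSpace ℝ (Fin d) :=
  WithLp.toLp 2 fun j => if j = i then (Y i)⁻¹ else Y j / Y i

theorem projectiveMap_self (i : Fin d) (Y : Fin d → ℝ) : projectiveMap i Y i = (Y i)⁻¹ := by
  simp [projectiveMap]

theorem projectiveMap_of_ne {i j : Fin d} (hj : j ≠ i) (Y : Fin d → ℝ) :
    projectiveMap i Y j = Y j / Y i := by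
  simp [projectiveMap, hj]

theorem measurable_projectiveMap (i : Fin d) : Measurable (projectiveMap i) := by
  unfold projectiveMap
  refine (PiLp.continuous_toLp 2 _).measurable.comp (measurable_pi_lambda _ fun j => ?_)
  split_ifs <;> fun_prop

/-- The box on which the projective map is bi-Lipschitz. -/
def projectiveBox (i : Fin d) : Set (Fin d → ℝ) :=
  {Y | Y i ∈ Set.Icc 1 2 ∧ ∀ j, j ≠ i → Y j ∈ Set.Icc 0 1}

/-- Only this direction is needed to transfer finite energy to the image. The constant is 6 = 2 + 4:
the factor Y i ≤ 2, plus the error 4 in recovering Y i from its inverse. -/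
theorem edist_le_edist_projectiveMap {i : Fin d} {Y Y' : Fin d → ℝ} (hY : Y ∈ projectiveBox i)
    (hY' : Y' ∈ projectiveBox i) :
    edist Y Y' ≤ (6 : NNReal) * edist (projectiveMap i Y) (projectiveMap i Y') := by
  rw [edist_nndist, edist_nndist, ← ENNReal.coe_mul, ENNReal.coe_le_coe, ← NNReal.coe_le_coe]
  push_cast
  have hcoord : ∀ j, |projectiveMap i Y j - projectiveMap i Y' j|
      ≤ dist (projectiveMap i Y) (projectiveMap i Y') := fun j => by
    rw [dist_eq_norm]
    exact PiLp.norm_apply_le (projectiveMap i Y - projectiveMap i Y') j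
  set D := dist (projectiveMap i Y) (projectiveMap i Y') with hD
  have hD0 : 0 ≤ D := dist_nonneg
  obtain ⟨⟨h1, h2⟩, h⟩ := hY
  obtain ⟨⟨h1', h2'⟩, h'⟩ := hY'
  have hi : |Y i - Y' i| ≤ 4 * D := by
    have h3 : Y i - Y' i = Y i * Y' i * -(projectiveMap i Y i - projectiveMap i Y' i) := by
      rw [projectiveMap_self, projectiveMap_self]
      field_simp
      ring
    have h4 : Y i * Y' i ≤ 4 := by nlinarith
    rw [h3, abs_mul, abs_neg, abs_of_nonneg (by positivity)]
    exact mul_le_mul h4 (hcoord i) (abs_nonneg _) (by norm_num)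
  refine (dist_pi_le_iff (by positivity)).2 fun j => ?_
  rw [Real.dist_eq]
  by_cases hj : j = i
  · subst hj
    linarith
  have h3 : Y j - Y' j = (projectiveMap i Y j - projectiveMap i Y' j) * Y i
      + projectiveMap i Y' j * (Y i - Y' i) := by
    rw [projectiveMap_of_ne hj, projectiveMap_of_ne hj]
    field_simp
    ring
  have h4 : |projectiveMap i Y' j| ≤ 1 := by
    rw [projectiveMap_of_ne hj, abs_of_nonneg (div_nonneg (h' j hj).1 (by linarith)),
      div_le_one (by linarith)]
    linarith [(h' j hj).2]
  calc _ ≤ |projectiveMap i Y j - projectiveMap i Y' j| * |Y i|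
        + |projectiveMap i Y' j| * |Y i - Y' i| := by
        rw [h3, ← abs_mul, ← abs_mul]; exact abs_add_le _ _
    _ ≤ D * 2 + 1 * (4 * D) := by
        gcongr
        · exact hcoord j
        · rwa [abs_of_nonneg (by linarith)]
    _ = 6 * D := by ring

theorem projectiveMap_mem_of_mem_projectiveBox {i : Fin d} {Y : Fin d → ℝ}
    (hY : Y ∈ projectiveBox i) :
    projectiveMap i Y ∈ WithLp.toLp 2 '' Set.univ.pi (fun _ : Fin d => Set.Icc (0 : ℝ) 1)
      ∩ {y | 1 / 2 ≤ y i} := by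
  obtain ⟨⟨h1, h2⟩, h⟩ := hY
  have h0 : 0 < Y i := by linarith
  have hinv : (Y i)⁻¹ ≤ 1 := inv_le_one_of_one_le₀ h1
  refine ⟨⟨_, fun j _ => ?_, rfl⟩, ?_⟩
  · by_cases hj : j = i
    · simp only [hj, if_true]
      exact ⟨by positivity, hinv⟩
    · simp only [hj, if_false]
      exact ⟨div_nonneg (h j hj).1 h0.le, div_le_one_of_le₀ ((h j hj).2.trans h1) h0.le⟩
  · rw [Set.mem_ofPred_eq, projectiveMap_self, one_div]
    exact inv_anti₀ h0 h2

theorem support_map_projectiveMap_subset {i : Fin d} {P : Measure (Fin d → ℝ)}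
    (hP : ∀ᵐ Y ∂P, Y ∈ projectiveBox i) :
    IsCompact (P.map (projectiveMap i)).support ∧
      (P.map (projectiveMap i)).support ⊆ {y | 1 / 2 ≤ y i} := by
  have hK : IsCompact (WithLp.toLp 2 '' Set.univ.pi (fun _ : Fin d => Set.Icc (0 : ℝ) 1)
      : Set (EuclideanSpace ℝ (Fin d))) :=
    (isCompact_univ_pi fun _ => isCompact_Icc).image (PiLp.continuous_toLp 2 _)
  have hC : IsClosed {y : EuclideanSpace ℝ (Fin d) | 1 / 2 ≤ y i} :=
    isClosed_le continuous_const (by fun_prop)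
  have hKC := hK.inter_right hC
  have hsub : (P.map (projectiveMap i)).support ⊆ _ ∩ _ :=
    Measure.support_subset_of_isClosed hKC.isClosed (by
      refine (ae_map_iff (measurable_projectiveMap i).aemeasurable hKC.isClosed.measurableSet).2 ?_
      filter_upwards [hP] with Y hY using projectiveMap_mem_of_mem_projectiveBox hY)
  exact ⟨hKC.of_isClosed_subset Measure.isClosed_support hsub,
    hsub.trans Set.inter_subset_right⟩

/-- Points `x` with `x i = 0` are exceptional if the lines from `x` through the image points have
slopes in a null set. -/
theorem mem_exceptionalSet_map_projectiveMap {i k : Fin d} (hik : k ≠ i)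
    {P : Measure (Fin d → ℝ)} [IsProbabilityMeasure P] (hP : ∀ᵐ Y ∂P, Y ∈ projectiveBox i)
    {Z : Set ℝ} (hZ : volume Z = 0) {x : EuclideanSpace ℝ (Fin d)} (hxi : x i = 0)
    (hx : ∀ᵐ Y ∂P, Y k - x k * Y i ∈ Z) :
    x ∈ exceptionalSet (P.map (projectiveMap i)) := by
  refine ⟨fun hxs => ?_, fun hac => ?_⟩
  · have := (support_map_projectiveMap_subset hP).2 hxs
    rw [Set.mem_ofPred_eq, hxi] at this
    norm_num at this
  have h1 := Measure.preimage_null_of_map_null (measurable_projectiveMap i).aemeasurable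
    (Measure.preimage_null_of_map_null (measurable_radialProj x).aemeasurable
      (hac (sphereMeasure_setOf_div_mem_eq_zero hik hZ)))
  have h2 : ∀ᵐ Y ∂P, Y ∈ projectiveMap i ⁻¹' (radialProj x ⁻¹' {θ | 0 < θ i ∧ θ k / θ i ∈ Z}) := by
    filter_upwards [hP, hx] with Y hY hYx
    have h0 : 0 < Y i := by linarith [hY.1.1]
    have hYi : (projectiveMap i Y - x) i = (Y i)⁻¹ := by
      rw [PiLp.sub_apply, projectiveMap_self, hxi, sub_zero]
    have hn : 0 < ‖projectiveMap i Y - x‖⁻¹ := by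
      rw [inv_pos, norm_pos_iff]
      intro h
      rw [h, PiLp.zero_apply] at hYi
      exact (inv_pos.2 h0).ne hYi
    refine ⟨?_, ?_⟩
    · simp only [radialProj, PiLp.smul_apply, smul_eq_mul, hYi]
      positivity
    -- The point of the projective map: as x i = 0, the slope (Y k / Y i - x k) / (Y i)⁻¹ equals Y k
    -- - x k · Y i.
    · simp only [radialProj, PiLp.smul_apply, smul_eq_mul]
      rw [mul_div_mul_left _ _ hn.ne', hYi, PiLp.sub_apply, projectiveMap_of_ne hik]
      convert hYx using 1
      field_simp
  obtain ⟨Y, hY1, hY2⟩ := (h2.and (measure_eq_zero_iff_ae_notMem.1 h1)).exists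
  exact hY2 hY1

/-- Coordinate laws: `m` at `i`, `n` at `k` and uniform on `[0, 1]` elsewhere. -/
noncomputable def coordMeasure (i k : Fin d) (m n : Measure ℝ) (j : Fin d) : Measure ℝ :=
  if j = i then m else if j = k then n else digitMeasure Set.univ

instance (i k j : Fin d) (m n : Measure ℝ) [IsProbabilityMeasure m] [IsProbabilityMeasure n] :
    IsProbabilityMeasure (coordMeasure i k m n j) := by
  unfold coordMeasure
  split_ifs <;> infer_instance

theorem isFrostman_pi_coordMeasure {i k : Fin d} (hik : k ≠ i) {m n : Measure ℝ}
    [IsProbabilityMeasure m] [IsProbabilityMeasure n] {a b : ℝ} (hm : IsFrostman a m)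
    (hn : IsFrostman b n) :
    IsFrostman (a + b + (d - 2)) (Measure.pi (coordMeasure i k m n)) := by
  have hsum : ∑ j : Fin d, (if j = i then a else if j = k then b else 1) = a + b + (d - 2) := by
    have : ∀ j : Fin d, (if j = i then a else if j = k then b else 1)
        = 1 + (if j = i then a - 1 else 0) + (if j = k then b - 1 else 0) := by
      intro j
      by_cases h1 : j = i
      · simp [h1, hik.symm]
      · by_cases h2 : j = k <;> simp [h1, h2, hik]
    simp only [this, Finset.sum_add_distrib, Finset.sum_ite_eq', Finset.mem_univ, if_true,
      Finset.sum_const, Finset.card_univ, Fintype.card_fin, nsmul_eq_mul]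
    ring
  rw [← hsum]
  refine isFrostman_pi fun j => ?_
  unfold coordMeasure
  split_ifs
  · exact hm
  · exact hn
  · exact isFrostman_digitMeasure_univ

theorem ae_pi_coordMeasure {i k : Fin d} (hik : k ≠ i) {m n : Measure ℝ}
    [IsProbabilityMeasure m] [IsProbabilityMeasure n] {p q : ℝ → Prop} (hp : ∀ᵐ u ∂m, p u)
    (hq : ∀ᵐ u ∂n, q u) :
    ∀ᵐ Y ∂(Measure.pi (coordMeasure i k m n)),
      p (Y i) ∧ q (Y k) ∧ ∀ j, j ≠ i → j ≠ k → Y j ∈ Set.Icc 0 1 := by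
  have h : ∀ j, ∀ᵐ Y ∂(Measure.pi (coordMeasure i k m n)), (j = i → p (Y j)) ∧ (j = k → q (Y j))
      ∧ (j ≠ i → j ≠ k → Y j ∈ Set.Icc (0 : ℝ) 1) := by
    intro j
    have h1 : ∀ᵐ u ∂(coordMeasure i k m n j), (j = i → p u) ∧ (j = k → q u)
      ∧ (j ≠ i → j ≠ k → u ∈ Set.Icc (0 : ℝ) 1) := by
      unfold coordMeasure
      split_ifs with h1 h2
      · filter_upwards [hp] with u hu
        exact ⟨fun _ => hu, fun h => absurd (h.symm.trans h1) hik, fun h => absurd h1 h⟩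
      · filter_upwards [hq] with u hu
        exact ⟨fun h => absurd h h1, fun _ => hu, fun _ h => absurd h2 h⟩
      · filter_upwards [ae_digitMeasure (A := Set.univ) measurableSet_Icc
          fun ε => digitSum_mem_Icc] with u hu
        exact ⟨fun h => absurd h h1, fun h => absurd h h2, fun _ _ => hu⟩
    exact (Measure.tendsto_eval_ae_ae (μ := coordMeasure i k m n) (i := j)).eventually h1
  filter_upwards [ae_all_iff.2 h] with Y hY
  exact ⟨(hY i).1 rfl, (hY k).2.1 rfl, fun j => (hY j).2.2⟩

/-- The gap lengths balance two demands. Large β raises the exponent of the measure, small β that of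
the exceptional set, and β just above s - (d - 1) serves both. -/
theorem exists_lt_dimH_exceptionalSet (hd : 2 ≤ d) {s t : ℝ} (hs : (d : ℝ) - 1 < s) (hsd : s < d)
    (ht : t < 2 * ((d : ℝ) - 1) - s) :
    ∃ μ : Measure (EuclideanSpace ℝ (Fin d)), IsCompactlySupportedRadon μ ∧ energy s μ < ∞ ∧
      ENNReal.ofReal t < dimH (exceptionalSet μ) := by
  have hd2 : (2 : ℝ) ≤ d := by exact_mod_cast hd
  set σ : ℝ := s - (d - 1) with hσ
  set T : ℝ := max (t - (d - 2)) 0 with hT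
  have hT0 : 0 ≤ T := le_max_right _ _
  have hTt : t - (d - 2) ≤ T := le_max_left _ _
  have hTσ : T < 1 - σ := max_lt (by linarith) (by linarith)
  -- With β = σ + 4h, the measure has exponent d - 1 + β - 2h = s + 2h. The exceptional set gets 1 -
  -- β - h + (d - 2) = T + 3h + (d - 2), which exceeds both t and 0.
  obtain ⟨h, hh⟩ : ∃ h : ℝ, 8 * h = 1 - σ - T := ⟨(1 - σ - T) / 8, by ring⟩
  have hh0 : 0 < h := by linarith
  obtain ⟨β, hβ⟩ : ∃ β : ℝ, β = σ + 4 * h := ⟨_, rfl⟩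
  obtain ⟨K, p, r, hK, hprj, hp, hr, hpr⟩ :=
    exists_gap_positions (β := β) hh0 (by linarith) (by linarith)
  have hple : ∀ j, p j ≤ K ^ (j + 1) := fun j => by have := hprj j; omega
  have hrle : ∀ j, r j ≤ K ^ (j + 1) := fun j => by have := hprj j; omega
  have hprle : ∀ j, p j + r j ≤ K ^ (j + 1) := fun j => by have := hprj j; omega
  have hF1 : IsFrostman (β - h) (digitMeasure (gapDigits K p)) :=
    isFrostman_digitMeasure (by linarith) (by linarith)
      (mul_le_card_gapDigits hK hple (by linarith) (by linarith) hp)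
  have hF2 : IsFrostman (1 - β - h) (digitMeasure (gapDigits K r)) :=
    isFrostman_digitMeasure (by linarith) (by linarith)
      (mul_le_card_gapDigits hK hrle (by linarith) (by linarith) hr)
  have hF3 : IsFrostman (1 - h) (digitMeasure (gapDigits K fun j => p j + r j)) :=
    isFrostman_digitMeasure (by linarith) (by linarith)
      (mul_le_card_gapDigits hK hprle (by linarith) (by linarith) hpr)
  have hF1' : IsFrostman (β - h) ((digitMeasure (gapDigits K p)).map (· + 1)) :=
    hF1.map (measurable_add_const 1) (fun x => ⟨x - 1, by ring⟩) fun x y => by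
      rw [dist_add_right]
  have hprob : IsProbabilityMeasure ((digitMeasure (gapDigits K p)).map (· + 1)) :=
    Measure.isProbabilityMeasure_map (measurable_add_const 1).aemeasurable
  obtain ⟨i, k, hik⟩ : ∃ i k : Fin d, k ≠ i :=
    ⟨⟨0, by omega⟩, ⟨1, by omega⟩, by simp [Fin.ext_iff]⟩
  -- Coordinate `i` carries 1 + y, which stays in [1, 2] so that division by it is harmless, and
  -- coordinate `k` carries z.
  set P := Measure.pi (coordMeasure i k ((digitMeasure (gapDigits K p)).map (· + 1))
    (digitMeasure (gapDigits K fun j => p j + r j))) with hPdef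
  have hmeas : ∀ g : ℕ → ℕ, MeasurableSet
      {u : ℝ | u ∈ Set.Icc (0 : ℝ) 1 ∧ ∀ j, u ∈ nearLattice (g j) (K ^ (j + 1))} := fun g => by
    have : {u : ℝ | u ∈ Set.Icc (0 : ℝ) 1 ∧ ∀ j, u ∈ nearLattice (g j) (K ^ (j + 1))}
        = Set.Icc 0 1 ∩ ⋂ j, nearLattice (g j) (K ^ (j + 1)) := by
      ext u; simp [Set.mem_iInter]
    rw [this]
    exact measurableSet_Icc.inter (MeasurableSet.iInter fun j => measurableSet_nearLattice _ _)
  have hdig : ∀ g : ℕ → ℕ, (∀ j, g j ≤ K ^ (j + 1)) → ∀ᵐ u ∂(digitMeasure (gapDigits K g)),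
      u ∈ Set.Icc (0 : ℝ) 1 ∧ ∀ j, u ∈ nearLattice (g j) (K ^ (j + 1)) := fun g hg =>
    ae_digitMeasure (hmeas g) fun ε => ⟨digitSum_mem_Icc, fun j => digitSum_gapDigits_mem hg j ε⟩
  have hP : ∀ᵐ Y ∂P, ((Y i - 1) ∈ Set.Icc (0 : ℝ) 1 ∧
      ∀ j, Y i - 1 ∈ nearLattice (p j) (K ^ (j + 1))) ∧ (Y k ∈ Set.Icc (0 : ℝ) 1 ∧
      ∀ j, Y k ∈ nearLattice (p j + r j) (K ^ (j + 1))) ∧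
      ∀ j, j ≠ i → j ≠ k → Y j ∈ Set.Icc 0 1 := by
    refine ae_pi_coordMeasure (p := fun u => u - 1 ∈ Set.Icc (0 : ℝ) 1 ∧
      ∀ j, u - 1 ∈ nearLattice (p j) (K ^ (j + 1))) hik ?_ (hdig _ hprle)
    refine (ae_map_iff (measurable_add_const 1).aemeasurable
      ((measurable_sub_const (1 : ℝ)) (hmeas p))).2 ?_
    simpa using hdig p hple
  have hbox : ∀ᵐ Y ∂P, Y ∈ projectiveBox i := by
    filter_upwards [hP] with Y hY
    obtain ⟨⟨⟨h1, h2⟩, -⟩, ⟨h3, -⟩, h4⟩ := hY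
    refine ⟨⟨by linarith, by linarith⟩, fun j hj => ?_⟩
    by_cases hjk : j = k
    · rwa [hjk]
    · exact h4 j hj hjk
  have hs0 : 0 < s := by linarith
  refine ⟨P.map (projectiveMap i), ⟨?_, (support_map_projectiveMap_subset hbox).1⟩, ?_, ?_⟩
  · infer_instance
  · refine lt_top_iff_ne_top.2 (energy_map_ne_top (measurable_projectiveMap i) (K := 6)
      (by norm_num) hbox (fun Y hY Y' hY' => edist_le_edist_projectiveMap hY hY') hs0 ?_)
    exact (isFrostman_pi_coordMeasure hik hF1' hF3).energy_ne_top hs0 (by linarith)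
  have hE : {x : EuclideanSpace ℝ (Fin d) | x i = 0 ∧ x k ∈ Set.Icc (0 : ℝ) 1 ∧
      ∀ j, x k ∈ nearLattice (r j) (K ^ (j + 1))} ⊆ exceptionalSet (P.map (projectiveMap i)) := by
    rintro x ⟨hxi, hxk, hxr⟩
    refine mem_exceptionalSet_map_projectiveMap hik hbox
      (volume_setOf_near_lattices_eq_zero fun j => (hprj j).le) hxi ?_
    filter_upwards [hP] with Y hY
    obtain ⟨⟨h1, h2⟩, ⟨h3, h4⟩, -⟩ := hY
    have hx1 : |x k| ≤ 1 := abs_le.2 ⟨by linarith [hxk.1], hxk.2⟩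
    refine ⟨?_, fun j => ?_⟩
    · have h5 : x k * Y i ≤ 1 * 2 :=
        mul_le_mul hxk.2 (by linarith [h1.2]) (by linarith [h1.1]) (by norm_num)
      have h6 : 0 ≤ x k * Y i := mul_nonneg hxk.1 (by linarith [h1.1])
      exact abs_le.2 ⟨by linarith [h3.1], by linarith [h3.2]⟩
    · obtain ⟨m, hm⟩ := exists_abs_sub_mul_le (hxr j) (h2 j)
        (by simpa only [add_comm] using h4 j) hx1 h1
      refine ⟨m, ?_⟩
      simpa [add_comm] using hm
  -- A Frostman measure on the exceptional points: coordinate `i` is frozen at 0, coordinate `k` has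
  -- the r-gaps and the other d - 2 are uniform.
  set ν := (Measure.pi (coordMeasure i k (Measure.dirac 0)
    (digitMeasure (gapDigits K r)))).map (WithLp.toLp 2 : _ → EuclideanSpace ℝ (Fin d)) with hν
  have htoLp : Measurable (WithLp.toLp 2 : (Fin d → ℝ) → EuclideanSpace ℝ (Fin d)) :=
    (PiLp.continuous_toLp 2 _).measurable
  have hνF : IsFrostman (0 + (1 - β - h) + (d - 2)) ν :=
    (isFrostman_pi_coordMeasure hik (isFrostman_zero _) hF2).map htoLp
      (WithLp.toLp_surjective 2) fun x y => by
        have := (PiLp.lipschitzWith_ofLp 2 (fun _ : Fin d => ℝ)).dist_le_mul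
          (WithLp.toLp 2 x) (WithLp.toLp 2 y)
        simpa using this
  have hνE : ∀ᵐ x ∂ν, x ∈ {x : EuclideanSpace ℝ (Fin d) | x i = 0 ∧ x k ∈ Set.Icc (0 : ℝ) 1 ∧
      ∀ j, x k ∈ nearLattice (r j) (K ^ (j + 1))} := by
    have hmE : MeasurableSet {x : EuclideanSpace ℝ (Fin d) | x i = 0 ∧ x k ∈ Set.Icc (0 : ℝ) 1 ∧
        ∀ j, x k ∈ nearLattice (r j) (K ^ (j + 1))} :=
      (measurableSet_eq_fun (by fun_prop) measurable_const).inter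
        ((show Measurable fun x : EuclideanSpace ℝ (Fin d) => x k by fun_prop) (hmeas r))
    rw [hν]
    refine (ae_map_iff htoLp.aemeasurable hmE).2 ?_
    filter_upwards [ae_pi_coordMeasure hik (m := Measure.dirac 0) (p := fun u => u = 0)
      (by simp) (hdig r hrle)] with Y hY
    exact ⟨hY.1, hY.2.1⟩
  have hνprob : IsProbabilityMeasure ν := Measure.isProbabilityMeasure_map htoLp.aemeasurable
  have hν1 : ν {x : EuclideanSpace ℝ (Fin d) | x i = 0 ∧ x k ∈ Set.Icc (0 : ℝ) 1 ∧
      ∀ j, x k ∈ nearLattice (r j) (K ^ (j + 1))} ≠ 0 := by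
    intro h0
    obtain ⟨x, hx1, hx2⟩ := (hνE.and (measure_eq_zero_iff_ae_notMem.1 h0)).exists
    exact hx2 hx1
  refine lt_of_lt_of_le ?_ ((hνF.le_dimH (by linarith) hν1).trans (dimH_mono hE))
  exact (ENNReal.ofReal_lt_ofReal_iff (by linarith)).2 (by linarith)

end Construction

theorem theorem1p7 (d : ℕ) (hd : 2 ≤ d) :
    (∀ (s : ℝ), (d : ℝ) - 1 < s →
      ∀ μ : Measure (EuclideanSpace ℝ (Fin d)), IsCompactlySupportedRadon μ → energy s μ < ∞ →
        dimH (exceptionalSet μ) ≤ ENNReal.ofReal (2 * ((d : ℝ) - 1) - s)) ∧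
    (∀ (s : ℝ), (d : ℝ) - 1 < s → s < d →
      ∀ t : ℝ, t < 2 * ((d : ℝ) - 1) - s →
        ∃ μ : Measure (EuclideanSpace ℝ (Fin d)), IsCompactlySupportedRadon μ ∧ energy s μ < ∞ ∧
          ENNReal.ofReal t < dimH (exceptionalSet μ)) :=
  ⟨fun _ hs _ hμ hE => dimH_exceptionalSet_le hd hs hμ hE,
    fun _ hs hsd _ ht => exists_lt_dimH_exceptionalSet hd hs hsd ht⟩
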